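/- Let $\Gamma$ be a finite oriented graph with links $\ell$ and nodes $n$ (multiple links and self-links allowed). Each link $\ell$ has a source seed $s(\ell)$ and a target seed $t(\ell)$, and each seed lies at a node; write $i\in n$ if seed $i$ lies at node $n$. Attach to each seed $i$ two bosonic oscillators $a_i^A$, $A=0,1$; let $\mathcal H_{\mathcal S}$ be their Fock space with vacuum $|0\rangle$, and $\epsilon^{01}=-\epsilon^{10}=1$, $\epsilon^{00}=\epsilon^{11}=0$. For seeds $i,j$ at the same node put $F_{ij}^\dagger=\sum_{A,B}\epsilon^{AB}a_i^{A\dagger}a_j^{B\dagger}$. Let $P_\Gamma$ be the orthogonal projector of $\mathcal H_{\mathcal S}$ onto the subspace of states annihilated by all link constraints $I_{s(\ell)}-I_{t(\ell)}$, $I_i=\tfrac12\sum_A a_i^{A\dagger}a_i^A$, and all node constraints $\sum_{i\in n}\vec J_i$, $\vec J_i=\tfrac12\sum_{A,B}\vec\sigma_{AB}a_i^{A\dagger}a_i^B$, where $\vec\sigma$ are the Pauli matrices. A loop is a non-empty cyclic sequence of oriented links $\ell^{\pm1}$, each ending at the node where the next one starts, up to cyclic permutation and overall reversal; it is non-repeating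 if no proper cyclic permutation leaves the sequence of oriented links invariant. Fix an orientation of each non-repeating loop. The wedges of an oriented loop are the pairs $(i,j)$ consisting of the final seed $i$ of an oriented link of the loop and the initial seed $j$ of the next one. A multiloop $\Phi$ is a finite multiset of non-repeating loops; its wedges are those of its loops, counted with multiplicity, and $2j_\ell=2j_\ell(\Phi)$ is the number of times that $\Phi$ traverses $\ell$ in either direction. Put $F_\Phi^\dagger=\prod_{(i,j)}F_{ij}^\dagger$ and, for a matrix $\gamma=(\gamma_{ij})$, $\gamma_\Phi=\prod_{(i,j)}\gamma_{ij}$, the products being over the wedges of $\Phi$ with multiplicity. Let $\gamma_{ij}(\varepsilon)=\gamma^{(D)}_{ij}+\varepsilon\,\delta\gamma_{ij}$, $\varepsilon\in\mathbb C$, where $\gamma^{(D)},\delta\gamma$ are complex antisymmetric matrices indexed by the seeds, $\gamma^{(D)}_{ij}=0$ if $i,j$ lie at distinct nodes, and $\delta\gamma_{ij}=0$ if $i,j$ lie at the same node. Let $[\gamma_1]^{AB}_{ij}=\epsilon^{AB}\gamma_{ij}(\varepsilon)$, and let $\mathcal D$ be the Siegel disk of complex matrices $\gamma=\gamma^t$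 with $\mathbb 1-\gamma\gamma^\dagger>0$. The braiding of two matrix elements is $$B(\gamma_{ij}\gamma_{kl})=\gamma_{ik}\gamma_{jl}-\gamma_{il}\gamma_{jk}\quad\text{if } i,j\in n,\ k,l\in n'\text{ for nodes } n\neq n',$$ and $B(\gamma_{ij}\gamma_{kl})=0$ otherwise; the braiding of a monomial is the sum, over all unordered pairs of its factors, of the monomial with that pair replaced by its braiding. Then there are functions $r_\Phi(\varepsilon)$ with $r_\Phi(\varepsilon)=O(\varepsilon^3)$ as $\varepsilon\to0$ for each $\Phi$ such that, for every $\varepsilon$ with $\gamma_1\in\mathcal D$, the series of $\exp\big(\tfrac12\sum_{i,j,A,B}[\gamma_1]^{AB}_{ij}a_i^{A\dagger}a_j^{B\dagger}\big)|0\rangle$ converges in $\mathcal H_{\mathcal S}$ and $$P_\Gamma\exp\Big(\tfrac12\sum_{i,j,A,B}[\gamma_1]^{AB}_{ij}a_i^{A\dagger}a_j^{B\dagger}\Big)|0\rangle=\sum_\Phi\frac{1}{\prod_\ell(2j_\ell)!}\Big[\gamma_\Phi+\tfrac12B(\gamma_\Phi)+r_\Phi(\varepsilon)\Big]F_\Phi^\dagger|0\rangle,$$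 where $\gamma_\Phi$ and $B(\gamma_\Phi)$ are formed with $\gamma=\gamma(\varepsilon)$. Here the sum over $\Phi$ is taken as the sum over all spin configurations $(2j_\ell)_\ell$, convergent in $\mathcal H_{\mathcal S}$, of the finite sums over the multiloops $\Phi$ with that spin configuration. -/

import Mathlib

open scoped ComplexOrder Matrix Topology

/-! ### Graphs, loops and multiloops -/

/-- The seeds (half-links) of a graph with set of links `L`: `(ℓ, false)` is the source seed
`s(ℓ)` of the link `ℓ`, and `(ℓ, true)` is its target seed `t(ℓ)`. -/
abbrev Seed (L : Type*) := L × Bool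

/-- The seed at the other end of the link to which the given seed belongs. -/
def Seed.other {L : Type*} (i : Seed L) : Seed L := (i.1, !i.2)

/-- An oriented graph with links `L` and nodes `N` (multiple links and self-links are allowed):
every seed lies at a node. -/
structure SeedGraph (N L : Type*) where
  node : Seed L → N

/-- A cyclic sequence is non-repeating if no proper cyclic permutation leaves it invariant. -/
def Cycle.IsNonRepeating {α : Type*} (c : Cycle α) : Prop :=
  ∀ l : List α, (l : Cycle α) = c → ∀ k : ℕ, 0 < k → k < l.length → l.rotate k ≠ l

/-- An oriented link `ℓ^{±1}` is represented by the seed where it starts; it ends at the other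
seed of the link.  An oriented (non-repeating) loop is a non-empty sequence of oriented links, up
to cyclic permutations, in which each oriented link ends at the node where the next one starts. -/
def OrientedLoop {N L : Type*} (G : SeedGraph N L) : Type _ :=
  {c : Cycle (Seed L) // c ≠ Cycle.nil ∧
    Cycle.Chain (fun d e => G.node d.other = G.node e) c ∧ c.IsNonRepeating}

/-- The same closed sequence of oriented links traversed backwards. -/
def reverseCycle {L : Type*} (c : Cycle (Seed L)) : Cycle (Seed L) :=
  c.reverse.map Seed.other

theorem reverseCycle_reverseCycle {L : Type*} (c : Cycle (Seed L)) :
    reverseCycle (reverseCycle c) = c := by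
  induction c using Quotient.inductionOn with
  | h l =>
    have h : (Seed.other ∘ Seed.other : Seed L → Seed L) = id := by
      funext i; simp [Seed.other]
    change reverseCycle (reverseCycle (l : Cycle (Seed L))) = (l : Cycle (Seed L))
    simp [reverseCycle, h]

/-- Two oriented loops are the same loop if they agree up to an overall change of orientation. -/
instance OrientedLoop.setoid {N L : Type*} (G : SeedGraph N L) : Setoid (OrientedLoop G) where
  r c d := c.1 = d.1 ∨ c.1 = reverseCycle d.1
  iseqv := by
    refine ⟨fun c => Or.inl rfl, ?_, ?_⟩
    · rintro c d (h | h)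
      · exact Or.inl h.symm
      · right; rw [h, reverseCycle_reverseCycle]
    · rintro c d e (h | h) (h' | h')
      · left; rw [h, h']
      · right; rw [h, h']
      · right; rw [h, h']
      · left; rw [h, h', reverseCycle_reverseCycle]

/-- A non-repeating loop: a closed sequence of oriented links up to cyclic permutations and up to
an overall change of orientation. -/
def GraphLoop {N L : Type*} (G : SeedGraph N L) : Type _ := Quotient (OrientedLoop.setoid G)

/-- A multiloop is a finite multiset of non-repeating loops. -/
abbrev Multiloop {N L : Type*} (G : SeedGraph N L) := Multiset (GraphLoop G)

/-- A choice, fixed once and for all, of an orientation of each loop. -/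
structure LoopOrientation {N L : Type*} (G : SeedGraph N L) where
  pick : GraphLoop G → OrientedLoop G
  pick_spec : ∀ α, (Quotient.mk (OrientedLoop.setoid G) (pick α) : GraphLoop G) = α

/-- The multiset of links traversed by a loop. -/
def GraphLoop.links {N L : Type*} {G : SeedGraph N L} (α : GraphLoop G) : Multiset L :=
  Quotient.lift (fun c : OrientedLoop G => c.1.toMultiset.map Prod.fst) (by
    rintro ⟨c, hc⟩ ⟨d, hd⟩ (h | h)
    · simp only at h; subst h; rfl
    · simp only at h
      change c.toMultiset.map Prod.fst = d.toMultiset.map Prod.fst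
      rw [h]
      clear h hc hd
      induction d using Quotient.inductionOn with
      | h l =>
        change ((reverseCycle (l : Cycle (Seed L))).toMultiset).map Prod.fst
          = ((l : Cycle (Seed L)).toMultiset).map Prod.fst
        have h : (Prod.fst ∘ Seed.other : Seed L → L) = Prod.fst := rfl
        simp [reverseCycle, h]) α

/-- `2 j_ℓ(Φ)`: the number of times that the multiloop `Φ` traverses the link `ℓ`. -/
def Multiloop.twiceSpin {N L : Type*} [DecidableEq L] {G : SeedGraph N L} (Φ : Multiloop G)
    (ℓ : L) : ℕ :=
  (Φ.bind GraphLoop.links).count ℓ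

theorem GraphLoop.finite_card_links_le {N L : Type*} [Fintype L] (G : SeedGraph N L) (M : ℕ) :
    {α : GraphLoop G | α.links.card ≤ M}.Finite := by
  have h1 : {c : Cycle (Seed L) | c.length ≤ M}.Finite := by
    refine ((List.finite_length_le (Seed L) M).image
      (fun l : List (Seed L) => (l : Cycle (Seed L)))).subset ?_
    intro c hc
    induction c using Quotient.inductionOn with
    | h l => exact ⟨l, hc, rfl⟩
  have h2 : {o : OrientedLoop G | o.1.length ≤ M}.Finite :=
    h1.preimage (Subtype.val_injective.injOn)
  refine (h2.image (Quotient.mk (OrientedLoop.setoid G))).subset ?_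
  intro α hα
  induction α using Quotient.inductionOn with
  | h o =>
    refine ⟨o, ?_, rfl⟩
    have h : (o.1.toMultiset.map Prod.fst).card ≤ M := hα
    rwa [Multiset.card_map, Cycle.card_toMultiset] at h

theorem GraphLoop.card_links_pos {N L : Type*} {G : SeedGraph N L} (α : GraphLoop G) :
    0 < α.links.card := by
  induction α using Quotient.inductionOn with
  | h o =>
    change 0 < (o.1.toMultiset.map Prod.fst).card
    rw [Multiset.card_map, Multiset.card_pos, Ne, Cycle.toMultiset_eq_nil]
    exact o.2.1

theorem Multiloop.finite_twiceSpin_eq {N L : Type*} [Fintype L] [DecidableEq L]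
    (G : SeedGraph N L) (k : L → ℕ) :
    {Φ : Multiloop G | Φ.twiceSpin = k}.Finite := by
  set M := ∑ ℓ, k ℓ with hM
  have hT : Finite {α : GraphLoop G | α.links.card ≤ M} :=
    (GraphLoop.finite_card_links_le G M).to_subtype
  refine ((List.finite_length_le {α : GraphLoop G | α.links.card ≤ M} M).image
    (fun l => ((l.map Subtype.val : List (GraphLoop G)) : Multiset (GraphLoop G)))).subset ?_
  intro Φ hΦ
  have hcard : (Φ.map (fun α => α.links.card)).sum = M := by
    have h := Multiset.sum_count_eq_card (s := Finset.univ) (m := Φ.bind GraphLoop.links)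
      (fun a _ => Finset.mem_univ a)
    rw [Multiset.card_bind] at h
    rw [hM, ← hΦ]
    exact h.symm
  have hmem : ∀ α ∈ Φ, α.links.card ≤ M := fun α hα =>
    hcard ▸ Multiset.single_le_sum (fun _ _ => Nat.zero_le _) _ (Multiset.mem_map_of_mem _ hα)
  have hlen : Φ.card ≤ M := by
    rw [← hcard]
    have := Multiset.card_nsmul_le_sum (s := Φ.map (fun α => α.links.card)) (a := 1) (by
      intro x hx
      obtain ⟨α, -, rfl⟩ := Multiset.mem_map.1 hx
      exact α.card_links_pos)
    simpa using this
  induction Φ using Quotient.inductionOn with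
  | h l =>
    refine ⟨l.attach.map (fun α => ⟨α.1, hmem α.1 α.2⟩), ?_, ?_⟩
    · simpa using hlen
    · simp [List.map_map, Function.comp_def]

/-- The finite set of multiloops `Φ ∈ {j_ℓ}` with the spin configuration `2 j_ℓ = k ℓ`. -/
noncomputable def multiloopsWithSpins {N L : Type*} [Fintype L] [DecidableEq L]
    (G : SeedGraph N L) (k : L → ℕ) : Finset (Multiloop G) :=
  (Multiloop.finite_twiceSpin_eq G k).toFinset

/-- The oriented wedges of a closed sequence of oriented links: between consecutive oriented links
`d`, `e` there is the wedge `(i, j)` from the final seed `i` of `d` to the initial seed `j` of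
`e`, both at the same node. -/
def cycleWedges {L : Type*} (c : Cycle (Seed L)) : Multiset (Seed L × Seed L) :=
  Quotient.lift
    (fun l : List (Seed L) =>
      ((List.zipWith (fun d e => (d.other, e)) l (l.rotate 1) : List (Seed L × Seed L)) :
        Multiset (Seed L × Seed L)))
    (by
      rintro l _ ⟨n, rfl⟩
      refine Multiset.coe_eq_coe.2 ?_
      rw [List.rotate_rotate, Nat.add_comm, ← List.rotate_rotate,
        ← List.zipWith_rotate_distrib _ _ _ _ (by simp)]
      exact (List.rotate_perm _ _).symm) c

/-- The wedges of a multiloop, counted with multiplicity. -/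
def Multiloop.wedges {N L : Type*} {G : SeedGraph N L} (o : LoopOrientation G)
    (Φ : Multiloop G) : Multiset (Seed L × Seed L) :=
  Φ.bind (fun α => cycleWedges (o.pick α).1)

/-! ### The bosonic Fock space -/

/-- The oscillators: one pair, labelled by `A = 0, 1`, at each seed. -/
abbrev Mode (L : Type*) := Seed L × Fin 2

/-- The bosonic Hilbert space `H_S`: square summable functions of the occupation numbers. -/
noncomputable abbrev BosonSpace (L : Type*) := lp (fun _ : Mode L →₀ ℕ => ℂ) 2

open Classical in
/-- The vector `p(a†)|0⟩`, for a polynomial `p` in the (commuting) creation operators: a monomial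
`∏ (a†_x)^{n_x} |0⟩` is `√(∏ n_x !)` times the normalized occupation-number state `n`.  On these
finite-particle states, `a†_x` is the multiplication by the variable `x`. -/
noncomputable def fockVector (L : Type*) : MvPolynomial (Mode L) ℂ →ₗ[ℂ] BosonSpace L :=
  (MvPolynomial.basisMonomials (Mode L) ℂ).constr ℂ (fun n =>
    lp.single 2 n ((Real.sqrt (n.prod fun _ m => (m.factorial : ℝ)) : ℝ) : ℂ))

/-- `a†_x` on finite-particle states. -/
noncomputable def creation {L : Type*} (x : Mode L) :
    Module.End ℂ (MvPolynomial (Mode L) ℂ) :=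
  LinearMap.mulLeft ℂ (MvPolynomial.X x)

/-- `a_x` on finite-particle states. -/
noncomputable def annihilation {L : Type*} (x : Mode L) :
    Module.End ℂ (MvPolynomial (Mode L) ℂ) :=
  (MvPolynomial.pderiv x).toLinearMap

/-- The Pauli matrices. -/
noncomputable def pauli : Fin 3 → Matrix (Fin 2) (Fin 2) ℂ :=
  ![!![0, 1; 1, 0], !![0, -Complex.I; Complex.I, 0], !![1, 0; 0, -1]]

/-- The antisymmetric tensor with `ε^{01} = 1`. -/
def epsTensor : Matrix (Fin 2) (Fin 2) ℂ := !![0, 1; -1, 0]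

/-- `J_i^a = ½ σ^a_{AB} a_i^A† a_i^B`. -/
noncomputable def fluxOp {L : Type*} (i : Seed L) (a : Fin 3) :
    Module.End ℂ (MvPolynomial (Mode L) ℂ) :=
  (1 / 2 : ℂ) • ∑ A : Fin 2, ∑ B : Fin 2,
    pauli a A B • (creation (i, A) * annihilation (i, B))

/-- `I_i = ½ δ_{AB} a_i^A† a_i^B`. -/
noncomputable def spinOp {L : Type*} (i : Seed L) :
    Module.End ℂ (MvPolynomial (Mode L) ℂ) :=
  (1 / 2 : ℂ) • ∑ A : Fin 2, creation (i, A) * annihilation (i, A)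

/-- The link constraint `C_ℓ = I_{s(ℓ)} - I_{t(ℓ)}`. -/
noncomputable def linkConstraint {L : Type*} (ℓ : L) :
    Module.End ℂ (MvPolynomial (Mode L) ℂ) :=
  spinOp (ℓ, false) - spinOp (ℓ, true)

/-- The node constraint `G_n^a = ∑_{i ∈ n} J_i^a`. -/
noncomputable def nodeConstraint {N L : Type*} [Fintype L] [DecidableEq N] (G : SeedGraph N L)
    (n : N) (a : Fin 3) : Module.End ℂ (MvPolynomial (Mode L) ℂ) :=
  ∑ i : Seed L with G.node i = n, fluxOp i a

/-- The constraints are symmetric and essentially self-adjoint on finite-particle states, so the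
kernels of their closures are the orthogonal complements of their ranges on finite-particle
states; this is the span of all these ranges. -/
noncomputable def constraintRange {N L : Type*} [Fintype L] [DecidableEq N]
    (G : SeedGraph N L) : Submodule ℂ (BosonSpace L) :=
  (⨆ ℓ : L, LinearMap.range (fockVector L ∘ₗ linkConstraint ℓ)) ⊔
    ⨆ n : N, ⨆ a : Fin 3, LinearMap.range (fockVector L ∘ₗ nodeConstraint G n a)

/-- The space `H_Γ` of states that solve all the link and node constraints. -/
noncomputable abbrev physicalSpace {N L : Type*} [Fintype L] [DecidableEq N]
    (G : SeedGraph N L) : Submodule ℂ (BosonSpace L) :=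
  (constraintRange G)ᗮ

/-- The orthogonal projector `P_Γ` of `H_S` onto `H_Γ`. -/
noncomputable def physicalProjector {N L : Type*} [Fintype L] [DecidableEq N]
    (G : SeedGraph N L) : BosonSpace L →L[ℂ] BosonSpace L :=
  (physicalSpace G).starProjection

/-- The wedge creation operator `F†_{ij} = ε_{AB} a_i^A† a_j^B†` for seeds at the same node, and
`0` for seeds at distinct nodes, as a polynomial in the creation operators. -/
noncomputable def wedgeCreation {N L : Type*} [DecidableEq N] (G : SeedGraph N L)
    (w : Seed L × Seed L) : MvPolynomial (Mode L) ℂ :=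
  if G.node w.1 = G.node w.2 then
    ∑ A : Fin 2, ∑ B : Fin 2,
      epsTensor A B • (MvPolynomial.X (w.1, A) * MvPolynomial.X (w.2, B))
  else 0

/-- The multiloop state `F†_Φ |0⟩`. -/
noncomputable def multiloopState {N L : Type*} [DecidableEq N] {G : SeedGraph N L}
    (o : LoopOrientation G) (Φ : Multiloop G) : BosonSpace L :=
  fockVector L ((Φ.wedges o).map (wedgeCreation G)).prod

/-! ### Squeezed vacua -/

/-- The Siegel unit disk: complex symmetric matrices `γ` with `1 - γ γ† > 0`. -/
def siegelDisk (ι : Type*) [Fintype ι] [DecidableEq ι] : Set (Matrix ι ι ℂ) :=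
  {γ | γᵀ = γ ∧ (1 - γ * γᴴ).PosDef}

/-- The `m`-th term of the series of `exp(½ γ_{xy} a†_x a†_y) |0⟩`. -/
noncomputable def squeezedTerm {L : Type*} [Fintype L]
    (γ : Matrix (Mode L) (Mode L) ℂ) (m : ℕ) : BosonSpace L :=
  fockVector L ((m.factorial : ℂ)⁻¹ •
    ((1 / 2 : ℂ) • ∑ x : Mode L, ∑ y : Mode L,
      γ x y • (MvPolynomial.X x * MvPolynomial.X y)) ^ m)

/-- The squeezed vacuum `exp(½ γ_{xy} a†_x a†_y) |0⟩`, without normalization factor. -/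
noncomputable def squeezedVacuum {L : Type*} [Fintype L]
    (γ : Matrix (Mode L) (Mode L) ℂ) : BosonSpace L :=
  ∑' m : ℕ, squeezedTerm γ m

/-- The squeezing matrix `[γ]_{ij}^{AB} = ε^{AB} γ_{ij}`. -/
def spinorSqueezing {L : Type*} (γ : Matrix (Seed L) (Seed L) ℂ) :
    Matrix (Mode L) (Mode L) ℂ :=
  fun x y => epsTensor x.2 y.2 * γ x.1 y.1

/-- `γ_Φ`: the product of the matrix elements `γ_{ij}` over the wedges of `Φ`. -/
def multiloopWeight {N L : Type*} {G : SeedGraph N L} (o : LoopOrientation G)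
    (γ : Matrix (Seed L) (Seed L) ℂ) (Φ : Multiloop G) : ℂ :=
  ((Φ.wedges o).map (fun w => γ w.1 w.2)).prod

/-- The braiding `B(γ_{ij} γ_{kl})` of two matrix elements, for `w = (i, j)` and `v = (k, l)`. -/
def braidPair {N L : Type*} [DecidableEq N] (G : SeedGraph N L)
    (γ : Matrix (Seed L) (Seed L) ℂ) (w v : Seed L × Seed L) : ℂ :=
  if G.node w.1 = G.node w.2 ∧ G.node v.1 = G.node v.2 ∧ G.node w.1 ≠ G.node v.1 then
    γ w.1 v.1 * γ w.2 v.2 - γ w.1 v.2 * γ w.2 v.1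
  else 0

/-- The braiding of the monomial `∏_{w ∈ W} γ_w`: the sum, over the unordered pairs of factors, of
the monomial in which the two factors are replaced by their braiding.  The double sum below runs
over ordered pairs of factors and meets each unordered pair twice, whence the factor `½` (the
braiding of two factors does not depend on their order, for antisymmetric `γ`). -/
noncomputable def braidMonomial {N L : Type*} [DecidableEq N] [DecidableEq L] (G : SeedGraph N L)
    (γ : Matrix (Seed L) (Seed L) ℂ) (W : Multiset (Seed L × Seed L)) : ℂ :=
  (1 / 2 : ℂ) * (W.map fun w => ((W.erase w).map fun v =>
    braidPair G γ w v * (((W.erase w).erase v).map fun u => γ u.1 u.2).prod).sum).sum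

/-- `B(γ_Φ)`. -/
noncomputable def multiloopBraiding {N L : Type*} [DecidableEq N] [DecidableEq L]
    {G : SeedGraph N L} (o : LoopOrientation G) (γ : Matrix (Seed L) (Seed L) ℂ)
    (Φ : Multiloop G) : ℂ :=
  braidMonomial G γ (Φ.wedges o)

/-! A finite-particle state is a polynomial in the creation operators: `a†` multiplies by a
variable, `a` differentiates, and the two are adjoint. The constraints are therefore symmetric on
polynomials, so the projector kills their ranges and fixes the polynomials that all of them
annihilate. The proof is a computation modulo these ranges.

Links. A link constraint compares the numbers of quanta at the two seeds of a link. After projection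
only those multidegrees survive in which both seeds of `ℓ` carry the same number `k ℓ` of quanta,
which gives the sum over spin configurations (`hasSum_projectedState_squeezedPoly`). The series
itself converges by a ratio test: a matrix of the Siegel disk is a strict contraction, and the
number operator turns this into a bound on consecutive terms (`summable_squeezedTerm`).

Nodes. By `sum_nodeConstraint_sq` the Casimir operator of a node with `K` quanta is `(K/2)(K/2+1)`
minus half a sum of brackets times bracket annihilators. The scalar is nonzero for `K > 0`, so
modulo the ranges every polynomial reduces to products of brackets inside nodes. For `K = 1` the
reduction gives zero, and for `K = 2` it gives a bracket. Hence a single bracket between distinct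
nodes projects to zero, while `[ij][kl]`, with `i, k` at one node and `j, l` at another, becomes `½
[ik][jl]` (`bracket_mul_bracket_sub_mem`). The constraints are derivations, so powers of the
invariant polynomial of `γD` can be carried along as factors. In the binomial expansion in `ε`,
order zero is already invariant, order one vanishes, and order two is the braiding
(`projectedState_orderTerm_two`). At fixed spins only finitely many higher orders occur; each is
some combination of multiloop states (`exists_projectedState_eq_sum`), and together they form the
remainder.

Combinatorics. The exponential expands over multisets `m` of unoriented wedges with weight `1/∏
m_p!`. If the seed degrees of `m` come from spins `k`, no wedge joins a seed to itself and every
wedge stays at one node, then exactly `∏ (k ℓ)! / ∏ m_p!` multiloops have the wedges `m`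
(`card_multiloopWith_mul`). This exchanges the weight for `1/∏ (2j_ℓ)!`. The count is an induction
on the number of wedges, run simultaneously for multiloops and for multiloops accompanied by an open
path. Removing the first wedge of the path gives a recursion. Closing the path across a link gives a
closed word, uniquely a power of a primitive word, and a multiloop arises from as many open
configurations as it has passages through that link. -/

/-! ### The inner product of finite-particle states -/

open Classical in
theorem fockVector_monomial {L : Type*} (n : Mode L →₀ ℕ) (c : ℂ) :
    fockVector L (MvPolynomial.monomial n c) =
      lp.single 2 n (c * ((Real.sqrt (n.prod fun _ m => (m.factorial : ℝ)) : ℝ) : ℂ)) := by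
  have h : (MvPolynomial.monomial n c : MvPolynomial (Mode L) ℂ) =
      c • MvPolynomial.basisMonomials (Mode L) ℂ n := by
    simp [MvPolynomial.smul_monomial]
  rw [h, map_smul, fockVector, Module.Basis.constr_basis, ← lp.single_smul, smul_eq_mul]

/-- The normalization `n!` of the occupation numbers `n`. -/
noncomputable def occupationFactorial {L : Type*} (n : Mode L →₀ ℕ) : ℝ :=
  n.prod fun _ m => (m.factorial : ℝ)

theorem occupationFactorial_pos {L : Type*} (n : Mode L →₀ ℕ) : 0 < occupationFactorial n :=
  Finset.prod_pos fun _ _ => by positivity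

theorem fockVector_apply {L : Type*} (p : MvPolynomial (Mode L) ℂ) (n : Mode L →₀ ℕ) :
    (fockVector L p : (Mode L →₀ ℕ) → ℂ) n =
      p.coeff n * ((Real.sqrt (occupationFactorial n) : ℝ) : ℂ) := by
  classical
  induction p using MvPolynomial.induction_on' with
  | monomial u a =>
    rw [fockVector_monomial, MvPolynomial.coeff_monomial]
    split_ifs with h
    · subst h
      rw [lp.single_apply_self]; rfl
    · rw [lp.single_apply_ne _ _ _ (Ne.symm h), zero_mul]
  | add p q hp hq =>
    rw [map_add, lp.coeFn_add, Pi.add_apply, hp, hq, MvPolynomial.coeff_add, add_mul]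

theorem inner_fockVector_monomial {L : Type*} (n : Mode L →₀ ℕ) (c : ℂ)
    (q : MvPolynomial (Mode L) ℂ) :
    inner ℂ (fockVector L (MvPolynomial.monomial n c)) (fockVector L q) =
      (starRingEnd ℂ) c * q.coeff n * (occupationFactorial n : ℂ) := by
  classical
  rw [fockVector_monomial, lp.inner_single_left, fockVector_apply]
  change inner ℂ (c * ((Real.sqrt (occupationFactorial n) : ℝ) : ℂ)) _ = _
  have hs : ((Real.sqrt (occupationFactorial n) : ℝ) : ℂ) *
      ((Real.sqrt (occupationFactorial n) : ℝ) : ℂ) = (occupationFactorial n : ℂ) := by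
    rw [← Complex.ofReal_mul, Real.mul_self_sqrt (occupationFactorial_pos n).le]
  simp only [RCLike.inner_apply, map_mul, Complex.conj_ofReal]
  linear_combination ((starRingEnd ℂ) c * q.coeff n) * hs

/-- The factor `n x + 1` is the one produced by differentiation, which is what makes multiplication
and derivative adjoint. -/
theorem occupationFactorial_add_single {L : Type*} (n : Mode L →₀ ℕ) (x : Mode L) :
    occupationFactorial (n + Finsupp.single x 1) = (n x + 1) * occupationFactorial n := by
  classical
  have hs : ∀ m : Mode L →₀ ℕ, m.support ⊆ insert x n.support → occupationFactorial m =
      ((m x).factorial : ℝ) * ∏ y ∈ n.support.erase x, ((m y).factorial : ℝ) := by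
    intro m hm
    rw [occupationFactorial, Finsupp.prod_of_support_subset m hm _ (by simp),
      ← Finset.mul_prod_erase _ _ (Finset.mem_insert_self x _), Finset.erase_insert_eq_erase]
  rw [hs n (Finset.subset_insert _ _), hs (n + Finsupp.single x 1)]
  · have : ∏ y ∈ n.support.erase x, (((n + Finsupp.single x 1 : Mode L →₀ ℕ) y).factorial : ℝ) =
        ∏ y ∈ n.support.erase x, ((n y).factorial : ℝ) := by
      refine Finset.prod_congr rfl fun y hy => ?_
      have : x ≠ y := (Finset.ne_of_mem_erase hy).symm
      simp [this]
    rw [this]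
    simp only [Finsupp.coe_add, Pi.add_apply, Finsupp.single_eq_same, Nat.factorial_succ,
      Nat.cast_mul]
    push_cast; ring
  · intro y hy
    by_cases h : y = x
    · simp [h]
    · have : x ≠ y := Ne.symm h
      simp_all

/-- `a†_x` and `a_x` are adjoint to each other. -/
theorem inner_fockVector_X_mul {L : Type*} (x : Mode L) (p q : MvPolynomial (Mode L) ℂ) :
    inner ℂ (fockVector L (MvPolynomial.X x * p)) (fockVector L q) =
      inner ℂ (fockVector L p) (fockVector L (MvPolynomial.pderiv x q)) := by
  induction p using MvPolynomial.induction_on' with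
  | monomial u a =>
    have h : (MvPolynomial.X x * MvPolynomial.monomial u a : MvPolynomial (Mode L) ℂ) =
        MvPolynomial.monomial (u + Finsupp.single x 1) a := by
      rw [MvPolynomial.X, MvPolynomial.monomial_mul, one_mul, add_comm]
    rw [h, inner_fockVector_monomial, inner_fockVector_monomial, MvPolynomial.coeff_pderiv,
      occupationFactorial_add_single]
    push_cast; ring
  | add p p' hp hp' =>
    rw [mul_add, map_add, map_add, inner_add_left, inner_add_left, hp, hp']

theorem inner_fockVector_pderiv {L : Type*} (x : Mode L) (p q : MvPolynomial (Mode L) ℂ) :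
    inner ℂ (fockVector L (MvPolynomial.pderiv x p)) (fockVector L q) =
      inner ℂ (fockVector L p) (fockVector L (MvPolynomial.X x * q)) := by
  rw [← inner_conj_symm, ← inner_fockVector_X_mul, inner_conj_symm]

theorem inner_fockVector_creation_annihilation {L : Type*} (x y : Mode L)
    (p q : MvPolynomial (Mode L) ℂ) :
    inner ℂ (fockVector L ((creation x * annihilation y) p)) (fockVector L q) =
      inner ℂ (fockVector L p) (fockVector L ((creation y * annihilation x) q)) := by
  have h : ∀ (x y : Mode L) (p : MvPolynomial (Mode L) ℂ), (creation x * annihilation y) p =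
      MvPolynomial.X x * MvPolynomial.pderiv y p := fun _ _ _ => rfl
  rw [h, h, inner_fockVector_X_mul, inner_fockVector_pderiv]

theorem star_half : (starRingEnd ℂ) (1 / 2 : ℂ) = 1 / 2 := by
  rw [map_div₀, map_one, Complex.conj_ofNat]

theorem inner_fockVector_spinOp {L : Type*} (i : Seed L) (p q : MvPolynomial (Mode L) ℂ) :
    inner ℂ (fockVector L (spinOp i p)) (fockVector L q) =
      inner ℂ (fockVector L p) (fockVector L (spinOp i q)) := by
  simp only [spinOp, LinearMap.smul_apply, LinearMap.sum_apply, map_smul, map_sum,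
    inner_smul_left, inner_smul_right, sum_inner, inner_sum,
    inner_fockVector_creation_annihilation, star_half]

theorem pauli_conj (a : Fin 3) (A B : Fin 2) :
    (starRingEnd ℂ) (pauli a A B) = pauli a B A := by
  fin_cases a <;> fin_cases A <;> fin_cases B <;> simp [pauli]

/-- Taking adjoints exchanges the two spinor indices, and hermiticity of the Pauli matrices
exchanges them back. -/
theorem inner_fockVector_fluxOp {L : Type*} (i : Seed L) (a : Fin 3)
    (p q : MvPolynomial (Mode L) ℂ) :
    inner ℂ (fockVector L (fluxOp i a p)) (fockVector L q) =
      inner ℂ (fockVector L p) (fockVector L (fluxOp i a q)) := by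
  simp only [fluxOp, LinearMap.smul_apply, LinearMap.sum_apply, map_smul, map_sum,
    inner_smul_left, inner_smul_right, sum_inner, inner_sum,
    inner_fockVector_creation_annihilation, pauli_conj, star_half]
  rw [Finset.sum_comm]

theorem inner_fockVector_linkConstraint {L : Type*} (ℓ : L) (p q : MvPolynomial (Mode L) ℂ) :
    inner ℂ (fockVector L (linkConstraint ℓ p)) (fockVector L q) =
      inner ℂ (fockVector L p) (fockVector L (linkConstraint ℓ q)) := by
  simp only [linkConstraint, LinearMap.sub_apply, map_sub, inner_sub_left, inner_sub_right,
    inner_fockVector_spinOp]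

theorem inner_fockVector_nodeConstraint {N L : Type*} [Fintype L] [DecidableEq N]
    (G : SeedGraph N L) (n : N) (a : Fin 3) (p q : MvPolynomial (Mode L) ℂ) :
    inner ℂ (fockVector L (nodeConstraint G n a p)) (fockVector L q) =
      inner ℂ (fockVector L p) (fockVector L (nodeConstraint G n a q)) := by
  simp only [nodeConstraint, LinearMap.sum_apply, map_sum, sum_inner, inner_sum,
    inner_fockVector_fluxOp]

/-! ### The projector on finite-particle states -/

/-- The projection `P_Γ p(a†)|0⟩` of a finite-particle state. -/
noncomputable def projectedState {N L : Type*} [Fintype L] [DecidableEq N]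
    (G : SeedGraph N L) : MvPolynomial (Mode L) ℂ →ₗ[ℂ] BosonSpace L :=
  (physicalProjector G : BosonSpace L →ₗ[ℂ] BosonSpace L) ∘ₗ fockVector L

theorem physicalProjector_eq_zero {N L : Type*} [Fintype L] [DecidableEq N]
    (G : SeedGraph N L) {v : BosonSpace L} (hv : v ∈ constraintRange G) :
    physicalProjector G v = 0 := by
  rw [physicalProjector, Submodule.starProjection_apply_eq_zero_iff]
  exact Submodule.le_orthogonal_orthogonal _ hv

theorem projectedState_linkConstraint {N L : Type*} [Fintype L] [DecidableEq N]
    (G : SeedGraph N L) (ℓ : L) (p : MvPolynomial (Mode L) ℂ) :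
    projectedState G (linkConstraint ℓ p) = 0 :=
  physicalProjector_eq_zero G (Submodule.mem_sup_left
    (Submodule.mem_iSup_of_mem ℓ ⟨p, rfl⟩))

theorem projectedState_nodeConstraint {N L : Type*} [Fintype L] [DecidableEq N]
    (G : SeedGraph N L) (n : N) (a : Fin 3) (p : MvPolynomial (Mode L) ℂ) :
    projectedState G (nodeConstraint G n a p) = 0 :=
  physicalProjector_eq_zero G (Submodule.mem_sup_right
    (Submodule.mem_iSup_of_mem n (Submodule.mem_iSup_of_mem a ⟨p, rfl⟩)))

/-- Symmetry moves each constraint onto `p`, so the state is orthogonal to all the ranges. -/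
theorem projectedState_eq_fockVector {N L : Type*} [Fintype L] [DecidableEq N]
    (G : SeedGraph N L) {p : MvPolynomial (Mode L) ℂ} (hl : ∀ ℓ, linkConstraint ℓ p = 0)
    (hn : ∀ n a, nodeConstraint G n a p = 0) :
    projectedState G p = fockVector L p := by
  refine Submodule.starProjection_eq_self_iff.2 ?_
  have key : constraintRange G ≤ (Submodule.span ℂ {fockVector L p})ᗮ := by
    refine sup_le (iSup_le fun ℓ => ?_) (iSup_le fun n => iSup_le fun a => ?_)
    · rintro _ ⟨q, rfl⟩
      rw [Submodule.mem_orthogonal_singleton_iff_inner_left]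
      change inner ℂ (fockVector L (linkConstraint ℓ q)) (fockVector L p) = 0
      rw [inner_fockVector_linkConstraint, hl, map_zero, inner_zero_right]
    · rintro _ ⟨q, rfl⟩
      rw [Submodule.mem_orthogonal_singleton_iff_inner_left]
      change inner ℂ (fockVector L (nodeConstraint G n a q)) (fockVector L p) = 0
      rw [inner_fockVector_nodeConstraint, hn, map_zero, inner_zero_right]
  exact Submodule.orthogonal_le key (Submodule.le_orthogonal_orthogonal _
    (Submodule.mem_span_singleton_self _))

/-! ### Convergence of the squeezed vacuum -/

/-- Positivity is tested on the conjugate of `u`: since `γ` is symmetric, `γ†` applied to it is the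
conjugate of `γ u`. -/
theorem sum_norm_sq_mulVec_lt {ι : Type*} [Fintype ι] [DecidableEq ι] {γ : Matrix ι ι ℂ}
    (hγ : γ ∈ siegelDisk ι) {u : ι → ℂ} (hu : u ≠ 0) :
    ∑ x, ‖∑ y, γ x y * u y‖ ^ 2 < ∑ x, ‖u x‖ ^ 2 := by
  obtain ⟨hsym, hpos⟩ := hγ
  have hu' : star u ≠ 0 := fun h => hu (by simpa using congrArg star h)
  have h := hpos.dotProduct_mulVec_pos hu'
  have hns : ∀ w : ι → ℂ, star w ⬝ᵥ w = ((∑ x, ‖w x‖ ^ 2 : ℝ) : ℂ) := by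
    intro w
    simp only [dotProduct, Pi.star_apply, RCLike.star_def, Complex.conj_mul']
    push_cast; rfl
  have h2 : γᴴ *ᵥ star u = star (γ *ᵥ u) := by
    rw [Matrix.star_mulVec, ← Matrix.mulVec_transpose]
    congr 1
    ext i j
    exact congrArg star (congrFun (congrFun hsym i) j)
  have h3 : star (star u) ⬝ᵥ ((γ * γᴴ) *ᵥ star u) = star (star (γ *ᵥ u)) ⬝ᵥ star (γ *ᵥ u) := by
    rw [← Matrix.mulVec_mulVec, h2, Matrix.dotProduct_mulVec, star_star, star_star]
    congr 1
    rw [← Matrix.mulVec_transpose, hsym]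
  rw [Matrix.sub_mulVec, Matrix.one_mulVec, dotProduct_sub, h3, hns, hns, ← Complex.ofReal_sub,
    Complex.zero_lt_real, sub_pos] at h
  simp only [Pi.star_apply, norm_star] at h
  exact h

/-- Compactness of the unit sphere makes the strict inequality uniform; homogeneity extends it to
all vectors. -/
theorem exists_contraction_of_mem_siegelDisk {ι : Type*} [Fintype ι] [DecidableEq ι]
    {γ : Matrix ι ι ℂ} (hγ : γ ∈ siegelDisk ι) :
    ∃ ρ : ℝ, 0 ≤ ρ ∧ ρ < 1 ∧ ∀ u : ι → ℂ,
      ∑ x, ‖∑ y, γ x y * u y‖ ^ 2 ≤ ρ * ∑ x, ‖u x‖ ^ 2 := by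
  set K : Set (ι → ℂ) := {u | ∑ x, ‖u x‖ ^ 2 = 1} with hK
  have hc : Continuous fun u : ι → ℂ => ∑ x, ‖u x‖ ^ 2 := by fun_prop
  have hcomp : IsCompact K := by
    refine Metric.isCompact_of_isClosed_isBounded (isClosed_eq hc continuous_const) ?_
    refine (Metric.isBounded_iff_subset_closedBall 0).2 ⟨1, fun u hu => ?_⟩
    rw [mem_closedBall_zero_iff, pi_norm_le_iff_of_nonneg zero_le_one]
    intro x
    have h1 : ‖u x‖ ^ 2 ≤ ∑ x, ‖u x‖ ^ 2 :=
      Finset.single_le_sum (f := fun x => ‖u x‖ ^ 2) (fun _ _ => by positivity)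
        (Finset.mem_univ x)
    rw [show ∑ x, ‖u x‖ ^ 2 = 1 from hu] at h1
    exact (sq_le_one_iff₀ (norm_nonneg _)).1 h1
  have hscale : ∀ (t : ℝ) (u : ι → ℂ), (∑ x, ‖∑ y, γ x y * ((t : ℂ) • u) y‖ ^ 2 =
      t ^ 2 * ∑ x, ‖∑ y, γ x y * u y‖ ^ 2) ∧
      ∑ x, ‖((t : ℂ) • u) x‖ ^ 2 = t ^ 2 * ∑ x, ‖u x‖ ^ 2 := by
    intro t u
    constructor
    · rw [Finset.mul_sum]
      refine Finset.sum_congr rfl fun x _ => ?_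
      have : ∑ y, γ x y * ((t : ℂ) • u) y = t * ∑ y, γ x y * u y := by
        rw [Finset.mul_sum]
        refine Finset.sum_congr rfl fun y _ => ?_
        simp only [Pi.smul_apply, smul_eq_mul]; ring
      rw [this, norm_mul, mul_pow, Complex.norm_real, Real.norm_eq_abs, sq_abs]
    · rw [Finset.mul_sum]
      refine Finset.sum_congr rfl fun x _ => ?_
      rw [Pi.smul_apply, smul_eq_mul, norm_mul, mul_pow, Complex.norm_real, Real.norm_eq_abs,
        sq_abs]
  -- The sphere is empty only when there is no nonzero vector at all, and then `ρ = 0` serves.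
  by_cases hne : K.Nonempty
  · obtain ⟨u₀, hu₀, hmax⟩ := hcomp.exists_isMaxOn hne
      (f := fun u => ∑ x, ‖∑ y, γ x y * u y‖ ^ 2) (by fun_prop)
    refine ⟨∑ x, ‖∑ y, γ x y * u₀ y‖ ^ 2, by positivity, ?_, fun u => ?_⟩
    · have h0 : u₀ ≠ 0 := by
        rintro rfl
        simp [hK] at hu₀
      calc _ < _ := sum_norm_sq_mulVec_lt hγ h0
        _ = 1 := hu₀
    · set s := ∑ x, ‖u x‖ ^ 2 with hs
      have hs0 : 0 ≤ s := by positivity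
      rcases hs0.eq_or_lt with h | h
      · have hz : u = 0 := by
          funext x
          have := (Finset.sum_eq_zero_iff_of_nonneg (fun _ _ => by positivity)).1 (hs ▸ h.symm)
            x (Finset.mem_univ x)
          simpa using this
        simp [hz, ← h]
      · have hmem : (((Real.sqrt s)⁻¹ : ℝ) : ℂ) • u ∈ K := by
          rw [hK, Set.mem_ofPred, (hscale _ u).2, inv_pow, Real.sq_sqrt hs0,
            inv_mul_cancel₀ h.ne']
        have := hmax hmem
        simp only [Set.mem_ofPred] at this
        rw [(hscale _ u).1, inv_pow, Real.sq_sqrt hs0, inv_mul_le_iff₀ h] at this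
        linarith
  · refine ⟨0, le_rfl, one_pos, fun u => ?_⟩
    by_contra h
    have hu : u ≠ 0 := by
      rintro rfl
      simp at h
    have hs : 0 < ∑ x, ‖u x‖ ^ 2 :=
      lt_of_le_of_lt (by positivity) (sum_norm_sq_mulVec_lt hγ hu)
    refine hne ⟨(((Real.sqrt (∑ x, ‖u x‖ ^ 2))⁻¹ : ℝ) : ℂ) • u, ?_⟩
    rw [hK, Set.mem_ofPred, (hscale _ u).2, inv_pow, Real.sq_sqrt hs.le, inv_mul_cancel₀ hs.ne']

/-! ### Norm estimates for the terms of the exponential series -/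

theorem lp.hasSum_norm_sq {α : Type*} (v : lp (fun _ : α => ℂ) 2) :
    HasSum (fun n => ‖v n‖ ^ 2) (‖v‖ ^ 2) := by
  simpa using lp.hasSum_norm (p := 2) (by norm_num) v

/-- The matrix acts on each occupation-number coordinate separately, so the scalar inequality can be
summed over coordinates. -/
theorem sum_norm_sq_contraction {ι α : Type*} [Fintype ι] {γ : Matrix ι ι ℂ} {ρ : ℝ}
    (h : ∀ u : ι → ℂ, ∑ x, ‖∑ y, γ x y * u y‖ ^ 2 ≤ ρ * ∑ x, ‖u x‖ ^ 2)
    (v : ι → lp (fun _ : α => ℂ) 2) :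
    ∑ x, ‖∑ y, γ x y • v y‖ ^ 2 ≤ ρ * ∑ x, ‖v x‖ ^ 2 := by
  refine hasSum_le (fun n => ?_)
    (hasSum_sum fun x _ => lp.hasSum_norm_sq (∑ y, γ x y • v y))
    ((hasSum_sum fun x _ => lp.hasSum_norm_sq (v x)).mul_left ρ)
  have hsum : ∀ x, (∑ y, γ x y • v y : lp (fun _ : α => ℂ) 2) n = ∑ y, γ x y * v y n := by
    intro x
    rw [lp.coeFn_sum]
    exact Finset.sum_apply _ _ _
  simp only [hsum]
  exact h fun x => v x n

/-- The quadratic polynomial `½ γ_{xy} a†_x a†_y`. -/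
noncomputable def squeezingPoly {L : Type*} [Fintype L] (γ : Matrix (Mode L) (Mode L) ℂ) :
    MvPolynomial (Mode L) ℂ :=
  (1 / 2 : ℂ) • ∑ x : Mode L, ∑ y : Mode L, γ x y • (MvPolynomial.X x * MvPolynomial.X y)

/-- The polynomial of the `m`-th term of the series of the squeezed vacuum. -/
noncomputable def squeezedPoly {L : Type*} [Fintype L] (γ : Matrix (Mode L) (Mode L) ℂ) (m : ℕ) :
    MvPolynomial (Mode L) ℂ :=
  (m.factorial : ℂ)⁻¹ • squeezingPoly γ ^ m

theorem squeezingPoly_isHomogeneous {L : Type*} [Fintype L] (γ : Matrix (Mode L) (Mode L) ℂ) :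
    (squeezingPoly γ).IsHomogeneous 2 := by
  simp only [squeezingPoly, MvPolynomial.smul_eq_C_mul]
  exact (MvPolynomial.IsHomogeneous.sum _ _ _ fun x _ => MvPolynomial.IsHomogeneous.sum _ _ _
    fun y _ => ((MvPolynomial.isHomogeneous_X _ x).mul
      (MvPolynomial.isHomogeneous_X _ y)).C_mul _).C_mul _

theorem squeezedPoly_isHomogeneous {L : Type*} [Fintype L] (γ : Matrix (Mode L) (Mode L) ℂ)
    (m : ℕ) : (squeezedPoly γ m).IsHomogeneous (2 * m) := by
  rw [squeezedPoly, MvPolynomial.smul_eq_C_mul]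
  exact ((squeezingPoly_isHomogeneous γ).pow m).C_mul _

theorem pderiv_squeezingPoly {L : Type*} [Fintype L] {γ : Matrix (Mode L) (Mode L) ℂ}
    (hγ : γᵀ = γ) (x : Mode L) :
    MvPolynomial.pderiv x (squeezingPoly γ) = ∑ y, γ x y • MvPolynomial.X y := by
  classical
  have hs : ∀ y, γ y x = γ x y := fun y => congrFun (congrFun hγ x) y
  simp only [squeezingPoly, Derivation.map_smul, map_sum, MvPolynomial.pderiv_mul,
    MvPolynomial.pderiv_X, Pi.single_apply, ite_mul, mul_ite, one_mul, mul_one, zero_mul, mul_zero,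
    smul_add, smul_ite, smul_zero, Finset.sum_add_distrib]
  simp only [Finset.sum_ite_eq', Finset.mem_univ, if_true]
  rw [Finset.sum_comm]
  simp only [Finset.sum_ite_eq', Finset.mem_univ, if_true, hs]
  rw [← smul_add, ← two_smul ℂ, smul_smul]
  norm_num

/-- The term-by-term form of `∂ exp Q = (∂Q) exp Q`. -/
theorem pderiv_squeezedPoly_succ {L : Type*} [Fintype L] {γ : Matrix (Mode L) (Mode L) ℂ}
    (hγ : γᵀ = γ) (x : Mode L) (m : ℕ) :
    MvPolynomial.pderiv x (squeezedPoly γ (m + 1)) =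
      ∑ y, γ x y • (MvPolynomial.X y * squeezedPoly γ m) := by
  rw [squeezedPoly, Derivation.map_smul, MvPolynomial.pderiv_pow, pderiv_squeezingPoly hγ,
    Nat.factorial_succ]
  simp only [squeezedPoly, Nat.add_sub_cancel, Finset.mul_sum, Finset.smul_sum]
  refine Finset.sum_congr rfl fun y _ => ?_
  have h1 : ((m : ℂ) + 1) ≠ 0 := by exact_mod_cast Nat.succ_ne_zero m
  have h2 : (m.factorial : ℂ) ≠ 0 := by exact_mod_cast m.factorial_ne_zero
  have h3 : ((m + 1 : ℕ) : MvPolynomial (Mode L) ℂ) = MvPolynomial.C ((m : ℂ) + 1) := by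
    simp
  have h4 : (MvPolynomial.C (((m + 1) * m.factorial : ℕ) : ℂ)⁻¹ : MvPolynomial (Mode L) ℂ) *
      MvPolynomial.C ((m : ℂ) + 1) = MvPolynomial.C (m.factorial : ℂ)⁻¹ := by
    rw [← MvPolynomial.C_mul]
    congr 1
    push_cast; field_simp
  rw [h3]
  simp only [MvPolynomial.smul_eq_C_mul]
  linear_combination (squeezingPoly γ ^ m * MvPolynomial.C (γ x y) * MvPolynomial.X y) * h4

/-- By adjointness the left side is the expectation of the number operator `∑ a† a`, which Euler's
identity evaluates. -/
theorem sum_norm_sq_pderiv {L : Type*} [Fintype L] {p : MvPolynomial (Mode L) ℂ} {d : ℕ}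
    (hp : p.IsHomogeneous d) :
    ∑ x, ‖fockVector L (MvPolynomial.pderiv x p)‖ ^ 2 = d * ‖fockVector L p‖ ^ 2 := by
  have h : (∑ x, inner ℂ (fockVector L (MvPolynomial.pderiv x p))
      (fockVector L (MvPolynomial.pderiv x p)) : ℂ) =
      d * inner ℂ (fockVector L p) (fockVector L p) := by
    simp only [inner_fockVector_pderiv]
    rw [← inner_sum, ← map_sum, hp.sum_X_mul_pderiv, map_nsmul, ← Nat.cast_smul_eq_nsmul ℂ,
      inner_smul_right]
  simp only [inner_self_eq_norm_sq_to_K] at h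
  refine Complex.ofReal_injective ?_
  push_cast at h ⊢
  exact h

/-- Here the operator is `∑ a a†`; each commutator adds one, whence the number of modes. -/
theorem sum_norm_sq_X_mul {L : Type*} [Fintype L] {p : MvPolynomial (Mode L) ℂ} {d : ℕ}
    (hp : p.IsHomogeneous d) :
    ∑ x, ‖fockVector L (MvPolynomial.X x * p)‖ ^ 2 =
      (d + Fintype.card (Mode L)) * ‖fockVector L p‖ ^ 2 := by
  have h : (∑ x, inner ℂ (fockVector L (MvPolynomial.X x * p))
      (fockVector L (MvPolynomial.X x * p)) : ℂ) =
      (d + Fintype.card (Mode L) : ℕ) * inner ℂ (fockVector L p) (fockVector L p) := by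
    simp only [inner_fockVector_X_mul, MvPolynomial.pderiv_mul, MvPolynomial.pderiv_X_self, one_mul]
    rw [← inner_sum, ← map_sum, Finset.sum_add_distrib, hp.sum_X_mul_pderiv, Finset.sum_const,
      ← add_smul, map_nsmul, ← Nat.cast_smul_eq_nsmul ℂ, inner_smul_right, Finset.card_univ,
      add_comm]
  simp only [inner_self_eq_norm_sq_to_K] at h
  refine Complex.ofReal_injective ?_
  push_cast at h ⊢
  exact h

theorem squeezedTerm_eq {L : Type*} [Fintype L] (γ : Matrix (Mode L) (Mode L) ℂ) (m : ℕ) :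
    squeezedTerm γ m = fockVector L (squeezedPoly γ m) := rfl

/-- The squared norms of consecutive terms have ratio at most `ρ (2m + c) / (2m + 2)`, with `c` the
number of modes. This tends to `ρ < 1`, so it is eventually below the midpoint `(ρ + 1)/2`. -/
theorem summable_squeezedTerm {L : Type*} [Fintype L] [DecidableEq L]
    {γ : Matrix (Mode L) (Mode L) ℂ} (hγ : γ ∈ siegelDisk (Mode L)) :
    Summable (squeezedTerm γ) := by
  obtain ⟨ρ, hρ0, hρ1, hρ⟩ := exists_contraction_of_mem_siegelDisk hγ
  have hrec : ∀ m : ℕ, (2 * (m + 1)) * ‖squeezedTerm γ (m + 1)‖ ^ 2 ≤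
      ρ * ((2 * m + Fintype.card (Mode L)) * ‖squeezedTerm γ m‖ ^ 2) := by
    intro m
    have h1 := sum_norm_sq_pderiv (squeezedPoly_isHomogeneous γ (m + 1))
    have h2 := sum_norm_sq_X_mul (squeezedPoly_isHomogeneous γ m)
    have h3 := sum_norm_sq_contraction hρ
      fun y => fockVector L (MvPolynomial.X y * squeezedPoly γ m)
    simp only [pderiv_squeezedPoly_succ hγ.1, map_sum, map_smul] at h1
    rw [h1, h2] at h3
    simp only [squeezedTerm_eq]
    push_cast at h3
    exact h3
  have hr1 : (ρ + 1) / 2 < 1 := by linarith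
  have hr0 : 0 ≤ (ρ + 1) / 2 := by linarith
  refine summable_of_ratio_norm_eventually_le (r := Real.sqrt ((ρ + 1) / 2)) ?_ ?_
  · rw [Real.sqrt_lt' one_pos]; simpa using hr1
  -- Beyond this index `c ≤ (1 - ρ) m`, which is enough for `ρ (2m + c) ≤ (m + 1)(ρ + 1)`.
  obtain ⟨m₀, hm₀⟩ := exists_nat_ge ((Fintype.card (Mode L) : ℝ) / (1 - ρ))
  filter_upwards [Filter.eventually_ge_atTop m₀] with m hm
  have hm' : (Fintype.card (Mode L) : ℝ) ≤ (1 - ρ) * m := by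
    rw [div_le_iff₀ (by linarith)] at hm₀
    have : (m₀ : ℝ) ≤ m := by exact_mod_cast hm
    nlinarith
  have hsq : ‖squeezedTerm γ (m + 1)‖ ^ 2 ≤ (ρ + 1) / 2 * ‖squeezedTerm γ m‖ ^ 2 := by
    have h0 : 0 ≤ ‖squeezedTerm γ m‖ ^ 2 := by positivity
    have hmpos : (0 : ℝ) < 2 * (m + 1) := by positivity
    have hc0 : (0 : ℝ) ≤ Fintype.card (Mode L) := by positivity
    have hcoef : ρ * (2 * m + Fintype.card (Mode L)) ≤ 2 * (m + 1) * ((ρ + 1) / 2) := by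
      nlinarith
    have := hrec m
    refine le_of_mul_le_mul_left ?_ hmpos
    calc _ ≤ _ := this
      _ = ρ * (2 * m + Fintype.card (Mode L)) * ‖squeezedTerm γ m‖ ^ 2 := by ring
      _ ≤ 2 * (m + 1) * ((ρ + 1) / 2) * ‖squeezedTerm γ m‖ ^ 2 :=
        mul_le_mul_of_nonneg_right hcoef h0
      _ = _ := by ring
  refine abs_le_of_sq_le_sq' ?_ (by positivity) |>.2
  rw [mul_pow, Real.sq_sqrt hr0]
  exact hsq

/-! ### Spin configurations -/

/-- The weight which counts the quanta at each seed. -/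
def seedWeight {L : Type*} [DecidableEq L] (x : Mode L) : Seed L → ℕ := Pi.single x.1 1

theorem weight_seedWeight {L : Type*} [Fintype L] [DecidableEq L] (n : Mode L →₀ ℕ)
    (i : Seed L) : Finsupp.weight seedWeight n i = n (i, 0) + n (i, 1) := by
  rw [Finsupp.weight_apply, Finsupp.sum_fintype _ _ (by simp), Finset.sum_apply,
    Fintype.sum_prod_type]
  simp [seedWeight, Pi.single_apply]

/-- The seed degrees of the spin configuration `2 j_ℓ = k ℓ`. -/
def linkDegree {L : Type*} (k : L → ℕ) : Seed L → ℕ := fun i => k i.1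

theorem sum_linkDegree {L : Type*} [Fintype L] (k : L → ℕ) :
    ∑ i, linkDegree k i = 2 * ∑ ℓ, k ℓ := by
  simp [Fintype.sum_prod_type, linkDegree, ← two_mul, Finset.mul_sum]

theorem degree_eq_sum_weight {L : Type*} [Fintype L] [DecidableEq L] (n : Mode L →₀ ℕ) :
    n.degree = ∑ i, Finsupp.weight seedWeight n i := by
  simp only [weight_seedWeight, Finsupp.degree_eq_sum, Fintype.sum_prod_type, Fin.sum_univ_two]

theorem coeff_X_mul_pderiv_self {L : Type*} (x : Mode L) (p : MvPolynomial (Mode L) ℂ)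
    (n : Mode L →₀ ℕ) :
    (MvPolynomial.X x * MvPolynomial.pderiv x p).coeff n = n x * p.coeff n := by
  classical
  induction p using MvPolynomial.induction_on' with
  | monomial u a =>
    rw [MvPolynomial.X_mul_pderiv_monomial, MvPolynomial.coeff_smul, MvPolynomial.coeff_monomial]
    split_ifs with h
    · simp [h]
    · simp
  | add p q hp hq =>
    rw [map_add, mul_add, MvPolynomial.coeff_add, hp, hq, MvPolynomial.coeff_add, mul_add]

/-- The spin operator is diagonal on monomials, with eigenvalue half the number of quanta at the
seed. -/
theorem spinOp_of_isWeightedHomogeneous {L : Type*} [Fintype L] [DecidableEq L]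
    {p : MvPolynomial (Mode L) ℂ} {d : Seed L → ℕ} (hp : p.IsWeightedHomogeneous seedWeight d)
    (i : Seed L) : spinOp i p = ((1 / 2 : ℂ) * d i) • p := by
  have h : spinOp i p = (1 / 2 : ℂ) • ∑ A : Fin 2,
      MvPolynomial.X (i, A) * MvPolynomial.pderiv (i, A) p := by
    simp only [spinOp, LinearMap.smul_apply, LinearMap.sum_apply]
    rfl
  ext n
  rw [h]
  simp only [Fin.sum_univ_two, MvPolynomial.coeff_smul, MvPolynomial.coeff_add,
    coeff_X_mul_pderiv_self, smul_eq_mul]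
  by_cases hn : p.coeff n = 0
  · simp [hn]
  · rw [← hp hn, weight_seedWeight]
    push_cast; ring

theorem linkConstraint_of_isWeightedHomogeneous {L : Type*} [Fintype L] [DecidableEq L]
    {p : MvPolynomial (Mode L) ℂ} {d : Seed L → ℕ} (hp : p.IsWeightedHomogeneous seedWeight d)
    (ℓ : L) :
    linkConstraint ℓ p = ((1 / 2 : ℂ) * (d (ℓ, false) - d (ℓ, true))) • p := by
  rw [linkConstraint, LinearMap.sub_apply, spinOp_of_isWeightedHomogeneous hp,
    spinOp_of_isWeightedHomogeneous hp, ← sub_smul, mul_sub]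

/-- Such a polynomial is a nonzero multiple of its own image under a link constraint. -/
theorem projectedState_of_ne {N L : Type*} [Fintype L] [DecidableEq N] [DecidableEq L]
    (G : SeedGraph N L) {p : MvPolynomial (Mode L) ℂ} {d : Seed L → ℕ}
    (hp : p.IsWeightedHomogeneous seedWeight d) {ℓ : L} (hd : d (ℓ, false) ≠ d (ℓ, true)) :
    projectedState G p = 0 := by
  have h := projectedState_linkConstraint G ℓ p
  rw [linkConstraint_of_isWeightedHomogeneous hp, map_smul, smul_eq_zero] at h
  refine h.resolve_left (mul_ne_zero (by norm_num) (sub_ne_zero.2 ?_))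
  exact_mod_cast hd

/-- The part of given seed degrees of a polynomial. -/
noncomputable def seedComponent {L : Type*} [DecidableEq L] (d : Seed L → ℕ) :
    MvPolynomial (Mode L) ℂ →ₗ[ℂ] MvPolynomial (Mode L) ℂ :=
  MvPolynomial.weightedHomogeneousComponent seedWeight d

theorem seedComponent_eq_self {L : Type*} [DecidableEq L] {d : Seed L → ℕ}
    {p : MvPolynomial (Mode L) ℂ} (h : p.IsWeightedHomogeneous seedWeight d) :
    seedComponent d p = p :=
  MvPolynomial.weightedHomogeneousComponent_eq_self h

theorem seedComponent_eq_zero {L : Type*} [DecidableEq L] {d d' : Seed L → ℕ}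
    {p : MvPolynomial (Mode L) ℂ} (h : p.IsWeightedHomogeneous seedWeight d') (hd : d ≠ d') :
    seedComponent d p = 0 := by
  classical
  rw [seedComponent, MvPolynomial.weightedHomogeneousComponent_of_mem h, if_neg hd]

/-- The term of index `m` is homogeneous of degree `2m`, so at most one term reaches a given
occupation number. In odd degree the truncated half selects a term whose coefficient vanishes as
well. -/
theorem squeezedVacuum_apply {L : Type*} [Fintype L] [DecidableEq L]
    {γ : Matrix (Mode L) (Mode L) ℂ} (h : Summable (squeezedTerm γ)) (n : Mode L →₀ ℕ) :
    squeezedVacuum γ n = fockVector L (squeezedPoly γ (n.degree / 2)) n := by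
  have h1 : HasSum (fun m => squeezedTerm γ m n) (squeezedVacuum γ n) :=
    (lp.evalCLM ℂ (fun _ : Mode L →₀ ℕ => ℂ) 2 n).hasSum h.hasSum
  refine h1.unique (hasSum_single _ fun m hm => ?_)
  rw [squeezedTerm_eq, fockVector_apply,
    (squeezedPoly_isHomogeneous γ m).coeff_eq_zero, zero_mul]
  omega

open Classical in
theorem projectedState_monomial_coeff {N L : Type*} [Fintype L] [DecidableEq N]
    (G : SeedGraph N L) (p : MvPolynomial (Mode L) ℂ) (n : Mode L →₀ ℕ) :
    projectedState G (MvPolynomial.monomial n (p.coeff n)) =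
      physicalProjector G (lp.single 2 n (fockVector L p n)) := by
  change physicalProjector G (fockVector L _) = _
  rw [fockVector_monomial, fockVector_apply]
  rfl

/-- The projection of the squeezed vacuum is the sum of its parts of given spins. -/
theorem hasSum_projectedState_squeezedPoly {N L : Type*} [DecidableEq N] [Fintype L]
    [DecidableEq L] (G : SeedGraph N L) {γ : Matrix (Mode L) (Mode L) ℂ}
    (h : Summable (squeezedTerm γ)) :
    HasSum (fun k : L → ℕ =>
        projectedState G (seedComponent (linkDegree k) (squeezedPoly γ (∑ ℓ, k ℓ))))
      (physicalProjector G (squeezedVacuum γ)) := by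
  classical
  set v := squeezedVacuum γ with hv
  have h1 : HasSum (fun n : Mode L →₀ ℕ => projectedState G
      (MvPolynomial.monomial n ((squeezedPoly γ (n.degree / 2)).coeff n)))
      (physicalProjector G v) := by
    have := (physicalProjector G).hasSum (lp.hasSum_single (p := 2) (by norm_num) v)
    simp only [projectedState_monomial_coeff, ← squeezedVacuum_apply h]
    convert this
  set g : (Seed L → ℕ) → BosonSpace L := fun d =>
    projectedState G (seedComponent d (squeezedPoly γ ((∑ i, d i) / 2))) with hg
  have h2 : HasSum g (physicalProjector G v) := by
    -- The sum over occupation numbers is grouped by seed degrees; in each group a single polynomial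
    -- `q` contributes, so the inner sum is finite.
    rw [← (Equiv.sigmaFiberEquiv
      (fun n : Mode L →₀ ℕ => Finsupp.weight (seedWeight (L := L)) n)).hasSum_iff] at h1
    refine h1.sigma fun d => ?_
    set q := squeezedPoly γ ((∑ i, d i) / 2) with hq
    have h3 : seedComponent d q = ∑ n ∈ q.support with Finsupp.weight seedWeight n = d,
        MvPolynomial.monomial n (q.coeff n) :=
      MvPolynomial.weightedHomogeneousComponent_apply _ _
    have h4 : g d = ∑ n ∈ q.support with Finsupp.weight seedWeight n = d,
        projectedState G (MvPolynomial.monomial n (q.coeff n)) := by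
      rw [hg]; simp only [← hq, h3, map_sum]
    have h5 : ∀ n : {n : Mode L →₀ ℕ // Finsupp.weight seedWeight n = d},
        squeezedPoly γ (n.1.degree / 2) = q := by
      rintro ⟨n, rfl⟩
      rw [hq, degree_eq_sum_weight]
    rw [h4]
    simp only [Function.comp_def, Equiv.sigmaFiberEquiv_apply, h5]
    rw [← Finset.sum_subtype_of_mem (p := fun n => Finsupp.weight seedWeight n = d)
      (fun n => projectedState G (MvPolynomial.monomial n (q.coeff n)))
      (fun n hn => (Finset.mem_filter.1 hn).2)]
    refine hasSum_sum_of_ne_finset_zero fun n hn => ?_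
    have : q.coeff n.1 = 0 := by
      by_contra h0
      exact hn (Finset.mem_subtype.2 (Finset.mem_filter.2
        ⟨MvPolynomial.mem_support_iff.2 h0, n.2⟩))
    rw [this, map_zero, map_zero]
  have hinj : Function.Injective (linkDegree (L := L)) := fun k k' hk => by
    funext ℓ
    exact congrFun hk (ℓ, false)
  rw [← hinj.hasSum_iff] at h2
  · convert h2 using 2 with k
    simp only [hg, sum_linkDegree, Nat.mul_div_cancel_left _ two_pos, Function.comp_def]
  -- Degrees outside the image of `linkDegree` are unbalanced on some link, and the projector kills
  -- them.
  · intro d hd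
    have : ∃ ℓ, d (ℓ, false) ≠ d (ℓ, true) := by
      by_contra! hall
      refine hd ⟨fun ℓ => d (ℓ, false), ?_⟩
      funext ⟨ℓ, b⟩
      cases b
      · rfl
      · exact hall ℓ
    obtain ⟨ℓ, hℓ⟩ := this
    exact projectedState_of_ne G
      (MvPolynomial.weightedHomogeneousComponent_isWeightedHomogeneous d _) hℓ

/-! ### The node constraints as derivations -/

/-- `ε_{AB} a_i^A† a_j^B†` for any two seeds. -/
noncomputable def bracket {L : Type*} (i j : Seed L) : MvPolynomial (Mode L) ℂ :=
  ∑ A : Fin 2, ∑ B : Fin 2,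
    epsTensor A B • (MvPolynomial.X (i, A) * MvPolynomial.X (j, B))

theorem bracket_eq {L : Type*} (i j : Seed L) :
    (bracket i j : MvPolynomial (Mode L) ℂ) =
      MvPolynomial.X (i, 0) * MvPolynomial.X (j, 1) -
        MvPolynomial.X (i, 1) * MvPolynomial.X (j, 0) := by
  simp [bracket, epsTensor, Fin.sum_univ_two, sub_eq_add_neg]

theorem bracket_swap {L : Type*} (i j : Seed L) : bracket j i = -bracket i j := by
  rw [bracket_eq, bracket_eq]; ring

theorem bracket_self {L : Type*} (i : Seed L) : bracket i i = 0 := by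
  rw [bracket_eq]; ring

theorem wedgeCreation_eq {N L : Type*} [DecidableEq N] (G : SeedGraph N L)
    (w : Seed L × Seed L) :
    wedgeCreation G w = if G.node w.1 = G.node w.2 then bracket w.1 w.2 else 0 := rfl

/-- `ε_{AB} a_i^A a_j^B`. -/
noncomputable def bracketAnnihilation {L : Type*} (i j : Seed L)
    (p : MvPolynomial (Mode L) ℂ) : MvPolynomial (Mode L) ℂ :=
  ∑ A : Fin 2, ∑ B : Fin 2,
    epsTensor A B • MvPolynomial.pderiv (i, A) (MvPolynomial.pderiv (j, B) p)

theorem fluxOp_apply {L : Type*} (i : Seed L) (a : Fin 3) (p : MvPolynomial (Mode L) ℂ) :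
    fluxOp i a p = (1 / 2 : ℂ) • ∑ A : Fin 2, ∑ B : Fin 2, pauli a A B •
      (MvPolynomial.X (i, A) * MvPolynomial.pderiv (i, B) p) := by
  simp only [fluxOp, LinearMap.smul_apply, LinearMap.sum_apply]
  rfl

/-- A first-order differential operator without constant term is a derivation. This is what allows
invariant factors to pass through the constraints. -/
theorem fluxOp_mul {L : Type*} (i : Seed L) (a : Fin 3) (p q : MvPolynomial (Mode L) ℂ) :
    fluxOp i a (p * q) = fluxOp i a p * q + p * fluxOp i a q := by
  simp only [fluxOp_apply, MvPolynomial.pderiv_mul, Fin.sum_univ_two, MvPolynomial.smul_eq_C_mul]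
  ring

theorem nodeConstraint_apply {N L : Type*} [Fintype L] [DecidableEq N] (G : SeedGraph N L)
    (n : N) (a : Fin 3) (p : MvPolynomial (Mode L) ℂ) :
    nodeConstraint G n a p = ∑ i : Seed L with G.node i = n, fluxOp i a p := by
  rw [nodeConstraint, LinearMap.sum_apply]

theorem nodeConstraint_mul {N L : Type*} [Fintype L] [DecidableEq N] (G : SeedGraph N L)
    (n : N) (a : Fin 3) (p q : MvPolynomial (Mode L) ℂ) :
    nodeConstraint G n a (p * q) = nodeConstraint G n a p * q + p * nodeConstraint G n a q := by
  simp only [nodeConstraint_apply, fluxOp_mul, Finset.sum_add_distrib, Finset.sum_mul,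
    Finset.mul_sum]

theorem fluxOp_X_of_ne {L : Type*} {i j : Seed L} (h : i ≠ j) (a : Fin 3) (A : Fin 2) :
    fluxOp i a (MvPolynomial.X (j, A)) = 0 := by
  have h' : ∀ B, MvPolynomial.pderiv (i, B) (MvPolynomial.X (j, A) : MvPolynomial (Mode L) ℂ) =
      0 := fun B => MvPolynomial.pderiv_X_of_ne fun h' => h (congrArg Prod.fst h').symm
  simp [fluxOp_apply, h']

theorem fluxOp_X_self {L : Type*} (i : Seed L) (a : Fin 3) (A : Fin 2) :
    fluxOp i a (MvPolynomial.X (i, A)) =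
      (1 / 2 : ℂ) • ∑ B : Fin 2, pauli a B A • MvPolynomial.X (i, B) := by
  classical
  simp only [fluxOp_apply, MvPolynomial.pderiv_X, Pi.single_apply, Prod.mk.injEq, true_and]
  simp

theorem nodeConstraint_X_of_ne {N L : Type*} [Fintype L] [DecidableEq N] (G : SeedGraph N L)
    {n : N} {i : Seed L} (h : G.node i ≠ n) (a : Fin 3) (A : Fin 2) :
    nodeConstraint G n a (MvPolynomial.X (i, A)) = 0 := by
  rw [nodeConstraint_apply]
  refine Finset.sum_eq_zero fun j hj => fluxOp_X_of_ne ?_ a A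
  rintro rfl
  exact h (Finset.mem_filter.1 hj).2

theorem nodeConstraint_X_self {N L : Type*} [Fintype L] [DecidableEq N] (G : SeedGraph N L)
    (i : Seed L) (a : Fin 3) (A : Fin 2) :
    nodeConstraint G (G.node i) a (MvPolynomial.X (i, A)) =
      (1 / 2 : ℂ) • ∑ B : Fin 2, pauli a B A • MvPolynomial.X (i, B) := by
  rw [nodeConstraint_apply, Finset.sum_eq_single_of_mem i (by simp)
    fun j _ hj => fluxOp_X_of_ne hj a A, fluxOp_X_self]

/-- The tensor `ε` is invariant under `SU(2)`: the constraint acts on both entries at once, and the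
Pauli matrices are traceless. -/
theorem nodeConstraint_bracket {N L : Type*} [Fintype L] [DecidableEq N] (G : SeedGraph N L)
    {i j : Seed L} (h : G.node i = G.node j) (n : N) (a : Fin 3) :
    nodeConstraint G n a (bracket i j) = 0 := by
  rw [bracket_eq, map_sub, nodeConstraint_mul, nodeConstraint_mul]
  by_cases hn : G.node i = n
  · subst hn
    simp only [nodeConstraint_X_self]
    rw [h]
    simp only [nodeConstraint_X_self, MvPolynomial.smul_eq_C_mul, Fin.sum_univ_two]
    fin_cases a <;> simp [pauli] <;> ring
  · have hn' : G.node j ≠ n := h ▸ hn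
    simp [nodeConstraint_X_of_ne G hn, nodeConstraint_X_of_ne G hn']

theorem nodeConstraint_wedgeCreation {N L : Type*} [Fintype L] [DecidableEq N]
    (G : SeedGraph N L) (w : Seed L × Seed L) (n : N) (a : Fin 3) :
    nodeConstraint G n a (wedgeCreation G w) = 0 := by
  rw [wedgeCreation_eq]
  split_ifs with h
  · exact nodeConstraint_bracket G h n a
  · exact map_zero _

theorem nodeConstraint_one {N L : Type*} [Fintype L] [DecidableEq N] (G : SeedGraph N L)
    (n : N) (a : Fin 3) : nodeConstraint G n a 1 = 0 := by
  simp [nodeConstraint_apply, fluxOp_apply]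

theorem nodeConstraint_multiset_prod {N L : Type*} [Fintype L] [DecidableEq N]
    (G : SeedGraph N L) (n : N) (a : Fin 3) (s : Multiset (MvPolynomial (Mode L) ℂ))
    (h : ∀ p ∈ s, nodeConstraint G n a p = 0) : nodeConstraint G n a s.prod = 0 := by
  induction s using Multiset.induction_on with
  | empty => exact nodeConstraint_one G n a
  | cons p s ih =>
    rw [Multiset.prod_cons, nodeConstraint_mul, h p (Multiset.mem_cons_self _ _),
      ih fun q hq => h q (Multiset.mem_cons_of_mem hq), zero_mul, mul_zero, add_zero]

/-! ### The Casimir operator of a node -/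

theorem pderiv_comm {L : Type*} (x y : Mode L) (p : MvPolynomial (Mode L) ℂ) :
    MvPolynomial.pderiv x (MvPolynomial.pderiv y p) =
      MvPolynomial.pderiv y (MvPolynomial.pderiv x p) := by
  classical
  ext n
  simp only [MvPolynomial.coeff_pderiv, Finsupp.add_apply, Finsupp.single_apply]
  rw [add_right_comm]
  by_cases h : x = y
  · simp [h]
  · simp [h, Ne.symm h]; ring

/-- Twice the spin operator. -/
theorem two_spinOp {L : Type*} (i : Seed L) (p : MvPolynomial (Mode L) ℂ) :
    (2 : ℂ) • spinOp i p = ∑ A : Fin 2,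
      MvPolynomial.X (i, A) * MvPolynomial.pderiv (i, A) p := by
  simp only [spinOp, LinearMap.smul_apply, LinearMap.sum_apply, smul_smul]
  norm_num
  rfl

theorem spinOp_apply {L : Type*} (i : Seed L) (p : MvPolynomial (Mode L) ℂ) :
    spinOp i p = (1 / 2 : ℂ) • (MvPolynomial.X (i, 0) * MvPolynomial.pderiv (i, 0) p +
      MvPolynomial.X (i, 1) * MvPolynomial.pderiv (i, 1) p) := by
  rw [← Fin.sum_univ_two (f := fun A =>
    MvPolynomial.X (i, A) * MvPolynomial.pderiv (i, A) p), ← two_spinOp, smul_smul]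
  norm_num

theorem fluxOp_zero_apply {L : Type*} (i : Seed L) (p : MvPolynomial (Mode L) ℂ) :
    fluxOp i 0 p = (1 / 2 : ℂ) • (MvPolynomial.X (i, 0) * MvPolynomial.pderiv (i, 1) p +
      MvPolynomial.X (i, 1) * MvPolynomial.pderiv (i, 0) p) := by
  simp [fluxOp_apply, pauli, Fin.sum_univ_two]

theorem fluxOp_one_apply {L : Type*} (i : Seed L) (p : MvPolynomial (Mode L) ℂ) :
    fluxOp i 1 p = Complex.I • (1 / 2 : ℂ) •
      (MvPolynomial.X (i, 1) * MvPolynomial.pderiv (i, 0) p -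
        MvPolynomial.X (i, 0) * MvPolynomial.pderiv (i, 1) p) := by
  rw [fluxOp_apply, smul_comm]
  congr 1
  simp [pauli, Fin.sum_univ_two, smul_sub]
  ring

theorem fluxOp_two_apply {L : Type*} (i : Seed L) (p : MvPolynomial (Mode L) ℂ) :
    fluxOp i 2 p = (1 / 2 : ℂ) • (MvPolynomial.X (i, 0) * MvPolynomial.pderiv (i, 0) p -
      MvPolynomial.X (i, 1) * MvPolynomial.pderiv (i, 1) p) := by
  simp [fluxOp_apply, pauli, Fin.sum_univ_two, sub_eq_add_neg]

theorem bracketAnnihilation_eq {L : Type*} (i j : Seed L) (p : MvPolynomial (Mode L) ℂ) :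
    bracketAnnihilation i j p =
      MvPolynomial.pderiv (i, 0) (MvPolynomial.pderiv (j, 1) p) -
        MvPolynomial.pderiv (i, 1) (MvPolynomial.pderiv (j, 0) p) := by
  simp [bracketAnnihilation, epsTensor, Fin.sum_univ_two, sub_eq_add_neg]

theorem C_half_mul_two {L : Type*} :
    (MvPolynomial.C (1 / 2 : ℂ) : MvPolynomial (Mode L) ℂ) * 2 = 1 := by
  rw [← map_ofNat MvPolynomial.C 2, ← MvPolynomial.C_mul]
  norm_num

/-- The Fierz identity for Pauli matrices, in the form `J_i · J_j = I_i I_j - ½ F† F`. -/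
theorem sum_fluxOp_fluxOp_of_ne {L : Type*} {i j : Seed L} (h : i ≠ j)
    (p : MvPolynomial (Mode L) ℂ) :
    ∑ a, fluxOp i a (fluxOp j a p) = spinOp i (spinOp j p) -
      (1 / 2 : ℂ) • (bracket i j * bracketAnnihilation i j p) := by
  have hX : ∀ A B, MvPolynomial.pderiv (i, A) (MvPolynomial.X (j, B) : MvPolynomial (Mode L) ℂ) =
      0 := fun A B => MvPolynomial.pderiv_X_of_ne fun h' => h (congrArg Prod.fst h').symm
  -- The imaginary units of the second component multiply to `-1`, leaving an identity with real
  -- coefficients.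
  rw [Fin.sum_univ_three, fluxOp_one_apply j, map_smul, fluxOp_one_apply i, smul_smul,
    Complex.I_mul_I, neg_one_smul]
  simp only [fluxOp_zero_apply, fluxOp_two_apply, spinOp_apply, bracketAnnihilation_eq, bracket_eq,
    map_add, map_sub, MvPolynomial.pderiv_mul, hX, MvPolynomial.smul_eq_C_mul,
    MvPolynomial.pderiv_C]
  linear_combination (MvPolynomial.C (1 / 2 : ℂ) *
    -((MvPolynomial.X (i, 0) * MvPolynomial.X (j, 1) -
        MvPolynomial.X (i, 1) * MvPolynomial.X (j, 0)) *
      (MvPolynomial.pderiv (i, 0) (MvPolynomial.pderiv (j, 1) p) -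
        MvPolynomial.pderiv (i, 1) (MvPolynomial.pderiv (j, 0) p)))) * C_half_mul_two

/-- At one seed the Casimir operator is `I(I + 1)`: the two oscillators of a seed carry only the
symmetric representations. -/
theorem sum_fluxOp_fluxOp_self {L : Type*} (i : Seed L) (p : MvPolynomial (Mode L) ℂ) :
    ∑ a, fluxOp i a (fluxOp i a p) = spinOp i (spinOp i p) + spinOp i p := by
  have h01 : MvPolynomial.pderiv (i, 0) (MvPolynomial.X (i, 1) : MvPolynomial (Mode L) ℂ) = 0 :=
    MvPolynomial.pderiv_X_of_ne (by simp)
  have h10 : MvPolynomial.pderiv (i, 1) (MvPolynomial.X (i, 0) : MvPolynomial (Mode L) ℂ) = 0 :=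
    MvPolynomial.pderiv_X_of_ne (by simp)
  rw [Fin.sum_univ_three, fluxOp_one_apply i p, map_smul, fluxOp_one_apply, smul_smul,
    Complex.I_mul_I, neg_one_smul]
  simp only [fluxOp_zero_apply, fluxOp_two_apply, spinOp_apply,
    MvPolynomial.pderiv_C, map_add, map_sub, MvPolynomial.pderiv_mul, h01, h10,
    MvPolynomial.pderiv_X_self, MvPolynomial.smul_eq_C_mul,
    pderiv_comm (i, 1) (i, 0)]
  linear_combination (MvPolynomial.C (1 / 2 : ℂ) *
    (MvPolynomial.X (i, 0) * MvPolynomial.pderiv (i, 0) p +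
      MvPolynomial.X (i, 1) * MvPolynomial.pderiv (i, 1) p)) * C_half_mul_two

/-- `∑_a (G_n^a)²` in terms of the number of quanta at the node and of the brackets. -/
theorem sum_nodeConstraint_sq {N L : Type*} [Fintype L] [DecidableEq N] [DecidableEq L]
    (G : SeedGraph N L) (n : N) {p : MvPolynomial (Mode L) ℂ} {d : Seed L → ℕ}
    (hp : p.IsWeightedHomogeneous seedWeight d) :
    ∑ a, nodeConstraint G n a (nodeConstraint G n a p) =
      ((1 / 2 : ℂ) * (∑ i : Seed L with G.node i = n, (d i : ℂ)) *
        ((1 / 2 : ℂ) * (∑ i : Seed L with G.node i = n, (d i : ℂ)) + 1)) • p -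
      (1 / 2 : ℂ) • ∑ i : Seed L with G.node i = n, ∑ j : Seed L with G.node j = n,
        bracket i j * bracketAnnihilation i j p := by
  -- The cases `i = j` and `i ≠ j` are put in one form; the extra diagonal term sums to `K/2` and
  -- produces the `+ 1` in `(K/2)(K/2 + 1)`.
  have h : ∀ i j, ∑ a, fluxOp i a (fluxOp j a p) =
      (((1 / 2 : ℂ) * d i) * ((1 / 2 : ℂ) * d j) + if i = j then (1 / 2 : ℂ) * d i else 0) • p -
      (1 / 2 : ℂ) • (bracket i j * bracketAnnihilation i j p) := by
    intro i j
    split_ifs with hij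
    · subst hij
      rw [sum_fluxOp_fluxOp_self, spinOp_of_isWeightedHomogeneous hp, map_smul,
        spinOp_of_isWeightedHomogeneous hp, bracket_self, smul_smul, zero_mul, smul_zero, sub_zero,
        add_smul]
    · rw [sum_fluxOp_fluxOp_of_ne hij, spinOp_of_isWeightedHomogeneous hp, map_smul,
        spinOp_of_isWeightedHomogeneous hp, smul_smul, add_zero, mul_comm ((1 / 2 : ℂ) * d j)]
  have h1 : ∑ a, nodeConstraint G n a (nodeConstraint G n a p) =
      ∑ i : Seed L with G.node i = n, ∑ j : Seed L with G.node j = n,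
        ∑ a, fluxOp i a (fluxOp j a p) := by
    simp only [nodeConstraint_apply, map_sum]
    rw [Finset.sum_comm]
    conv_rhs => rw [Finset.sum_comm]
    refine Finset.sum_congr rfl fun i _ => ?_
    rw [Finset.sum_comm]
  rw [h1]
  simp only [h, Finset.sum_sub_distrib, ← Finset.sum_smul, ← Finset.smul_sum]
  congr 2
  simp only [Finset.sum_add_distrib, ← Finset.mul_sum, ← Finset.sum_mul]
  have h2 : ∑ i : Seed L with G.node i = n, ∑ j : Seed L with G.node j = n,
      (if i = j then (1 / 2 : ℂ) * d i else 0) =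
      ∑ i : Seed L with G.node i = n, (1 / 2 : ℂ) * d i := by
    refine Finset.sum_congr rfl fun i hi => ?_
    rw [Finset.sum_ite_eq, if_pos hi]
  rw [h2, ← Finset.mul_sum]
  ring

/-! ### Reduction modulo the ranges of the node constraints -/

/-- The span of the ranges of the constraints of a node on finite-particle states. -/
noncomputable def nodeRangeAt {N L : Type*} [Fintype L] [DecidableEq N] (G : SeedGraph N L)
    (n : N) : Submodule ℂ (MvPolynomial (Mode L) ℂ) :=
  ⨆ a : Fin 3, LinearMap.range (nodeConstraint G n a)

/-- The span of the ranges of all the node constraints on finite-particle states. -/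
noncomputable def nodeRange {N L : Type*} [Fintype L] [DecidableEq N] (G : SeedGraph N L) :
    Submodule ℂ (MvPolynomial (Mode L) ℂ) :=
  ⨆ n : N, nodeRangeAt G n

theorem nodeConstraint_mem_nodeRangeAt {N L : Type*} [Fintype L] [DecidableEq N]
    (G : SeedGraph N L) (n : N) (a : Fin 3) (p : MvPolynomial (Mode L) ℂ) :
    nodeConstraint G n a p ∈ nodeRangeAt G n :=
  Submodule.mem_iSup_of_mem a ⟨p, rfl⟩

theorem nodeRangeAt_le_nodeRange {N L : Type*} [Fintype L] [DecidableEq N] (G : SeedGraph N L)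
    (n : N) : nodeRangeAt G n ≤ nodeRange G := le_iSup _ n

theorem projectedState_of_mem_nodeRange {N L : Type*} [Fintype L] [DecidableEq N]
    (G : SeedGraph N L) {p : MvPolynomial (Mode L) ℂ} (hp : p ∈ nodeRange G) :
    projectedState G p = 0 := by
  have h : nodeRange G ≤ LinearMap.ker (projectedState G) := by
    refine iSup_le fun n => iSup_le fun a => ?_
    rintro _ ⟨q, rfl⟩
    exact projectedState_nodeConstraint G n a q
  exact h hp

/-- By the Leibniz rule `q · G(r) = G(q r)` when `G(q) = 0`. Only the constraints of the node `n`
need to annihilate `q`. -/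
theorem mul_mem_nodeRangeAt {N L : Type*} [Fintype L] [DecidableEq N] (G : SeedGraph N L)
    {n : N} {p q : MvPolynomial (Mode L) ℂ} (hq : ∀ a, nodeConstraint G n a q = 0)
    (hp : p ∈ nodeRangeAt G n) : q * p ∈ nodeRangeAt G n := by
  have h : nodeRangeAt G n ≤ (nodeRangeAt G n).comap (LinearMap.mulLeft ℂ q) := by
    refine iSup_le fun a => ?_
    rintro _ ⟨r, rfl⟩
    have : q * nodeConstraint G n a r = nodeConstraint G n a (q * r) := by
      rw [nodeConstraint_mul, hq, zero_mul, zero_add]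
    change q * nodeConstraint G n a r ∈ nodeRangeAt G n
    rw [this]
    exact nodeConstraint_mem_nodeRangeAt G n a _
  exact h hp

theorem mul_mem_nodeRange {N L : Type*} [Fintype L] [DecidableEq N] (G : SeedGraph N L)
    {p q : MvPolynomial (Mode L) ℂ} (hq : ∀ n a, nodeConstraint G n a q = 0)
    (hp : p ∈ nodeRange G) : q * p ∈ nodeRange G := by
  have h : nodeRange G ≤ (nodeRange G).comap (LinearMap.mulLeft ℂ q) :=
    iSup_le fun n r hr => nodeRangeAt_le_nodeRange G n (mul_mem_nodeRangeAt G (hq n) hr)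
  exact h hp

/-- Node constraints preserve the seed degrees. -/
theorem isWeightedHomogeneous_X_mul_pderiv {L : Type*} [Fintype L] [DecidableEq L] (i : Seed L)
    (A B : Fin 2) (u : Mode L →₀ ℕ) (c : ℂ) :
    (MvPolynomial.X (i, A) * MvPolynomial.pderiv (i, B)
      (MvPolynomial.monomial u c)).IsWeightedHomogeneous seedWeight
        (Finsupp.weight (seedWeight (L := L)) u) := by
  rw [MvPolynomial.pderiv_monomial]
  by_cases h : u (i, B) = 0
  · rw [h, Nat.cast_zero, mul_zero, map_zero, mul_zero]
    exact MvPolynomial.isWeightedHomogeneous_zero _ _ _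
  · obtain ⟨v, rfl⟩ : ∃ v : Mode L →₀ ℕ, u = v + Finsupp.single (i, B) 1 :=
      ⟨u - Finsupp.single (i, B) 1,
        (tsub_add_cancel_of_le (Finsupp.single_le_iff.2 (Nat.one_le_iff_ne_zero.2 h))).symm⟩
    rw [add_tsub_cancel_right, MvPolynomial.X, MvPolynomial.monomial_mul]
    refine MvPolynomial.isWeightedHomogeneous_monomial _ _ _ ?_
    rw [map_add, map_add, add_comm]
    simp [Finsupp.weight_single, seedWeight]

theorem isWeightedHomogeneous_nodeConstraint_monomial {N L : Type*} [Fintype L] [DecidableEq N]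
    [DecidableEq L] (G : SeedGraph N L) (n : N) (a : Fin 3) (u : Mode L →₀ ℕ) (c : ℂ) :
    (nodeConstraint G n a (MvPolynomial.monomial u c)).IsWeightedHomogeneous seedWeight
      (Finsupp.weight (seedWeight (L := L)) u) := by
  rw [← MvPolynomial.mem_weightedHomogeneousSubmodule, nodeConstraint_apply]
  refine Submodule.sum_mem _ fun i _ => ?_
  rw [fluxOp_apply]
  exact Submodule.smul_mem _ _ (Submodule.sum_mem _ fun A _ => Submodule.sum_mem _ fun B _ =>
    Submodule.smul_mem _ _ (isWeightedHomogeneous_X_mul_pderiv i A B u c))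

/-- Each flux operator replaces a quantum of a seed by another quantum of the same seed, so it
respects the grading. -/
theorem seedComponent_nodeConstraint {N L : Type*} [Fintype L] [DecidableEq N]
    [DecidableEq L] (G : SeedGraph N L) (n : N) (a : Fin 3) (d : Seed L → ℕ)
    (p : MvPolynomial (Mode L) ℂ) :
    seedComponent d (nodeConstraint G n a p) = nodeConstraint G n a (seedComponent d p) := by
  induction p using MvPolynomial.induction_on' with
  | monomial u c =>
    have h1 := isWeightedHomogeneous_nodeConstraint_monomial G n a u c
    have h2 := MvPolynomial.isWeightedHomogeneous_monomial (seedWeight (L := L)) u c rfl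
    by_cases h : d = Finsupp.weight seedWeight u
    · subst h
      rw [seedComponent_eq_self h1, seedComponent_eq_self h2]
    · rw [seedComponent_eq_zero h1 h, seedComponent_eq_zero h2 h, map_zero]
  | add p q hp hq => rw [map_add, map_add, map_add, map_add, hp, hq]

theorem seedComponent_mem_nodeRange {N L : Type*} [Fintype L] [DecidableEq N]
    [DecidableEq L] (G : SeedGraph N L) (d : Seed L → ℕ) {p : MvPolynomial (Mode L) ℂ}
    (hp : p ∈ nodeRange G) : seedComponent d p ∈ nodeRange G := by
  have h : nodeRange G ≤ (nodeRange G).comap (seedComponent d) := by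
    refine iSup_le fun n => iSup_le fun a => ?_
    rintro _ ⟨q, rfl⟩
    rw [Submodule.mem_comap, seedComponent_nodeConstraint]
    exact nodeRangeAt_le_nodeRange G n (nodeConstraint_mem_nodeRangeAt G n a _)
  exact h hp

/-! ### Products of brackets span the invariants -/

/-- The product of the wedge creation operators of a multiset of wedges. -/
noncomputable def wedgeProd {N L : Type*} [DecidableEq N] (G : SeedGraph N L)
    (W : Multiset (Seed L × Seed L)) : MvPolynomial (Mode L) ℂ :=
  (W.map (wedgeCreation G)).prod

/-- The number of times that each seed occurs in a multiset of wedges. -/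
def wedgeDegree {L : Type*} [DecidableEq L] (W : Multiset (Seed L × Seed L)) : Seed L → ℕ :=
  (W.map fun w => (Pi.single w.1 1 + Pi.single w.2 1 : Seed L → ℕ)).sum

theorem isWeightedHomogeneous_bracket {L : Type*} [DecidableEq L] (i j : Seed L) :
    (bracket i j).IsWeightedHomogeneous seedWeight
      (Pi.single i 1 + Pi.single j 1 : Seed L → ℕ) := by
  rw [bracket_eq]
  have h := fun A => MvPolynomial.isWeightedHomogeneous_X ℂ (seedWeight (L := L)) (i, A)
  have h' := fun A => MvPolynomial.isWeightedHomogeneous_X ℂ (seedWeight (L := L)) (j, A)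
  exact ((h 0).mul (h' 1)).sub ((h 1).mul (h' 0))

theorem isWeightedHomogeneous_wedgeCreation {N L : Type*} [DecidableEq N] [DecidableEq L]
    (G : SeedGraph N L) (w : Seed L × Seed L) :
    (wedgeCreation G w).IsWeightedHomogeneous seedWeight
      (Pi.single w.1 1 + Pi.single w.2 1 : Seed L → ℕ) := by
  rw [wedgeCreation_eq]
  split_ifs
  · exact isWeightedHomogeneous_bracket _ _
  · exact MvPolynomial.isWeightedHomogeneous_zero _ _ _

theorem isWeightedHomogeneous_wedgeProd {N L : Type*} [DecidableEq N] [DecidableEq L]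
    (G : SeedGraph N L) (W : Multiset (Seed L × Seed L)) :
    (wedgeProd G W).IsWeightedHomogeneous seedWeight (wedgeDegree W) := by
  induction W using Multiset.induction_on with
  | empty => exact MvPolynomial.isWeightedHomogeneous_one _ _
  | cons w W ih =>
    rw [wedgeProd, wedgeDegree, Multiset.map_cons, Multiset.map_cons, Multiset.prod_cons,
      Multiset.sum_cons]
    exact (isWeightedHomogeneous_wedgeCreation G w).mul ih

theorem nodeConstraint_wedgeProd {N L : Type*} [Fintype L] [DecidableEq N]
    (G : SeedGraph N L) (W : Multiset (Seed L × Seed L)) (n : N) (a : Fin 3) :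
    nodeConstraint G n a (wedgeProd G W) = 0 := by
  refine nodeConstraint_multiset_prod G n a _ fun p hp => ?_
  obtain ⟨w, -, rfl⟩ := Multiset.mem_map.1 hp
  exact nodeConstraint_wedgeCreation G w n a

/-- The span of the products of brackets of given seed degrees. -/
noncomputable def wedgeSpan {N L : Type*} [DecidableEq N] [DecidableEq L]
    (G : SeedGraph N L) (d : Seed L → ℕ) : Submodule ℂ (MvPolynomial (Mode L) ℂ) :=
  Submodule.span ℂ {p | ∃ W, wedgeDegree W = d ∧ wedgeProd G W = p}

theorem bracket_mul_mem {N L : Type*} [Fintype L] [DecidableEq N] [DecidableEq L]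
    (G : SeedGraph N L) {i j : Seed L} (hij : G.node i = G.node j) {d : Seed L → ℕ}
    {p : MvPolynomial (Mode L) ℂ} (hp : p ∈ nodeRange G ⊔ wedgeSpan G d) :
    bracket i j * p ∈
      nodeRange G ⊔ wedgeSpan G (Pi.single i 1 + Pi.single j 1 + d) := by
  have h : nodeRange G ⊔ wedgeSpan G d ≤
      (nodeRange G ⊔ wedgeSpan G (Pi.single i 1 + Pi.single j 1 + d)).comap
        (LinearMap.mulLeft ℂ (bracket i j)) := by
    refine sup_le (fun r hr => Submodule.mem_sup_left
      (mul_mem_nodeRange G (nodeConstraint_bracket G hij) hr)) (Submodule.span_le.2 ?_)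
    rintro _ ⟨W, rfl, rfl⟩
    refine Submodule.mem_sup_right (Submodule.subset_span ⟨(i, j) ::ₘ W, ?_, ?_⟩)
    · simp [wedgeDegree]
    · simp [wedgeProd, wedgeCreation_eq, hij]
  exact h hp

/-- Induction on the degree with the Casimir identity at an occupied node. It writes a nonzero
multiple of the monomial as an element of the range plus brackets times polynomials of degree two
less. This is the first fundamental theorem of invariants for `SU(2)`, in a form that also controls
the complement of the invariants. -/
theorem monomial_mem_nodeRange_sup_wedgeSpan {N L : Type*} [Fintype L] [DecidableEq N]
    [DecidableEq L] (G : SeedGraph N L) (u : Mode L →₀ ℕ) (c : ℂ) :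
    MvPolynomial.monomial u c ∈
      nodeRange G ⊔ wedgeSpan G (Finsupp.weight (seedWeight (L := L)) u) := by
  induction hD : u.degree using Nat.strong_induction_on generalizing u c with
  | _ D ih =>
  by_cases hu : u = 0
  · subst hu
    refine Submodule.mem_sup_right ?_
    rw [← mul_one c, ← smul_eq_mul, ← MvPolynomial.smul_monomial]
    exact Submodule.smul_mem _ _ (Submodule.subset_span ⟨0, by simp [wedgeDegree],
      by simp [wedgeProd]⟩)
  obtain ⟨x, hx⟩ : ∃ x, u x ≠ 0 := by
    by_contra! h
    exact hu (Finsupp.ext h)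
  set d := Finsupp.weight (seedWeight (L := L)) u with hd
  set S := nodeRange G ⊔ wedgeSpan G d with hS
  set n := G.node x.1 with hn
  have hw : (MvPolynomial.monomial u c).IsWeightedHomogeneous seedWeight d :=
    MvPolynomial.isWeightedHomogeneous_monomial _ _ _ rfl
  have hcas := sum_nodeConstraint_sq G n hw
  have hGG : ∑ a, nodeConstraint G n a (nodeConstraint G n a (MvPolynomial.monomial u c)) ∈ S :=
    Submodule.mem_sup_left (nodeRangeAt_le_nodeRange G n
      (Submodule.sum_mem _ fun a _ => nodeConstraint_mem_nodeRangeAt G n a _))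
  have hb : ∑ i : Seed L with G.node i = n, ∑ j : Seed L with G.node j = n,
      bracket i j * bracketAnnihilation i j (MvPolynomial.monomial u c) ∈ S := by
    refine Submodule.sum_mem _ fun i hi => Submodule.sum_mem _ fun j hj => ?_
    have hij : G.node i = G.node j := by
      rw [(Finset.mem_filter.1 hi).2, (Finset.mem_filter.1 hj).2]
    rw [bracketAnnihilation]
    simp only [Finset.mul_sum, mul_smul_comm]
    refine Submodule.sum_mem _ fun A _ => Submodule.sum_mem _ fun B _ =>
      Submodule.smul_mem _ _ ?_
    rw [MvPolynomial.pderiv_monomial]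
    by_cases h1 : u (j, B) = 0
    · simp [h1]
    obtain ⟨v, rfl⟩ : ∃ v : Mode L →₀ ℕ, u = v + Finsupp.single (j, B) 1 :=
      ⟨u - Finsupp.single (j, B) 1,
        (tsub_add_cancel_of_le (Finsupp.single_le_iff.2 (Nat.one_le_iff_ne_zero.2 h1))).symm⟩
    rw [add_tsub_cancel_right, MvPolynomial.pderiv_monomial]
    by_cases h2 : v (i, A) = 0
    · simp [h2]
    obtain ⟨v', rfl⟩ : ∃ v' : Mode L →₀ ℕ, v = v' + Finsupp.single (i, A) 1 :=
      ⟨v - Finsupp.single (i, A) 1,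
        (tsub_add_cancel_of_le (Finsupp.single_le_iff.2 (Nat.one_le_iff_ne_zero.2 h2))).symm⟩
    rw [add_tsub_cancel_right]
    have hlt : v'.degree < D := by
      rw [← hD]; simp [add_assoc]
    have hd' : d = Pi.single i 1 + Pi.single j 1 + Finsupp.weight (seedWeight (L := L)) v' := by
      rw [hd, map_add, map_add]
      simp only [Finsupp.weight_single, seedWeight, one_smul]
      abel
    rw [hS, hd']
    exact bracket_mul_mem G hij (ih _ hlt v' _ rfl)
  have hK : (∑ i : Seed L with G.node i = n, (d i : ℂ)) =
      ((∑ i : Seed L with G.node i = n, d i : ℕ) : ℂ) := by push_cast; rfl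
  have hpos : 0 < ∑ i : Seed L with G.node i = n, d i := by
    refine Finset.sum_pos' (fun _ _ => Nat.zero_le _) ⟨x.1, by simp [hn], ?_⟩
    rw [hd, weight_seedWeight]
    obtain ⟨i, A⟩ := x
    fin_cases A <;> simp at hx ⊢ <;> omega
  rw [hK] at hcas
  set K := ∑ i : Seed L with G.node i = n, d i
  -- The node was chosen to carry at least one quantum, so the coefficient is a positive real number
  -- and can be divided out.
  have hne : (1 / 2 : ℂ) * (K : ℂ) * ((1 / 2 : ℂ) * (K : ℂ) + 1) ≠ 0 := by
    have : (1 / 2 : ℂ) * (K : ℂ) * ((1 / 2 : ℂ) * (K : ℂ) + 1) =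
        ((1 / 2 * K * (1 / 2 * K + 1) : ℝ) : ℂ) := by push_cast; rfl
    rw [this]
    have : (0 : ℝ) < K := by exact_mod_cast hpos
    exact_mod_cast (by positivity : (0 : ℝ) < 1 / 2 * K * (1 / 2 * K + 1)).ne'
  rw [← Submodule.smul_mem_iff S hne]
  rw [eq_sub_iff_add_eq] at hcas
  rw [← hcas]
  exact Submodule.add_mem _ hGG (Submodule.smul_mem _ _ hb)

theorem mem_nodeRange_sup_wedgeSpan {N L : Type*} [Fintype L] [DecidableEq N]
    [DecidableEq L] (G : SeedGraph N L) {p : MvPolynomial (Mode L) ℂ} {d : Seed L → ℕ}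
    (hp : p.IsWeightedHomogeneous seedWeight d) : p ∈ nodeRange G ⊔ wedgeSpan G d := by
  rw [p.as_sum]
  refine Submodule.sum_mem _ fun u hu => ?_
  rw [← hp (MvPolynomial.mem_support_iff.1 hu)]
  exact monomial_mem_nodeRange_sup_wedgeSpan G u _

/-! ### Reduction of brackets between distinct nodes -/

theorem pderiv_X_eq_C {L : Type*} [DecidableEq L] (i i' : Seed L) (A A' : Fin 2) :
    MvPolynomial.pderiv (i', A') (MvPolynomial.X (i, A) : MvPolynomial (Mode L) ℂ) =
      MvPolynomial.C (if i = i' then 1 else 0) * MvPolynomial.C (if A = A' then 1 else 0) := by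
  rw [MvPolynomial.pderiv_X, Pi.single_apply]
  by_cases h1 : i = i' <;> by_cases h2 : A = A' <;> simp [h1, h2]

/-- A spin one half contains no singlet: for `K = 1` the bracket term of the Casimir identity
vanishes and the scalar is `3/4`. -/
theorem X_mem_nodeRangeAt {N L : Type*} [Fintype L] [DecidableEq N] [DecidableEq L]
    (G : SeedGraph N L) (i : Seed L) (A : Fin 2) :
    MvPolynomial.X (i, A) ∈ nodeRangeAt G (G.node i) := by
  have hcas := sum_nodeConstraint_sq G (G.node i)
    (MvPolynomial.isWeightedHomogeneous_X ℂ (seedWeight (L := L)) (i, A))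
  have h0 : ∀ i' j', bracketAnnihilation i' j' (MvPolynomial.X (i, A)) = 0 := by
    intro i' j'
    simp only [bracketAnnihilation_eq, pderiv_X_eq_C, ← MvPolynomial.C_mul, MvPolynomial.pderiv_C,
      sub_zero]
  have hK : ∑ j : Seed L with G.node j = G.node i, ((seedWeight (i, A) j : ℕ) : ℂ) = 1 := by
    rw [Finset.sum_eq_single_of_mem i (by simp)]
    · simp [seedWeight]
    · intro j _ hj
      simp [seedWeight, hj]
  simp only [hK, h0, mul_zero, Finset.sum_const_zero, smul_zero, sub_zero] at hcas
  refine (Submodule.smul_mem_iff _ (show (1 / 2 : ℂ) * 1 * (1 / 2 * 1 + 1) ≠ 0 by norm_num)).1 ?_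
  rw [← hcas]
  exact Submodule.sum_mem _ fun a _ => nodeConstraint_mem_nodeRangeAt G _ a _

theorem bracketAnnihilation_X_mul_X {L : Type*} [DecidableEq L] (i' j' i k : Seed L)
    (A C : Fin 2) :
    bracketAnnihilation i' j' (MvPolynomial.X (i, A) * MvPolynomial.X (k, C)) =
      MvPolynomial.C (epsTensor A C * ((if i = i' then 1 else 0) * (if k = j' then 1 else 0)) +
        epsTensor C A * ((if k = i' then 1 else 0) * (if i = j' then 1 else 0))) := by
  simp only [bracketAnnihilation_eq, MvPolynomial.pderiv_mul, map_add, pderiv_X_eq_C,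
    MvPolynomial.pderiv_C, zero_mul, mul_zero, zero_add, add_zero, map_mul]
  generalize (MvPolynomial.C (if i = i' then 1 else 0) : MvPolynomial (Mode L) ℂ) = a
  generalize (MvPolynomial.C (if i = j' then 1 else 0) : MvPolynomial (Mode L) ℂ) = b
  generalize (MvPolynomial.C (if k = i' then 1 else 0) : MvPolynomial (Mode L) ℂ) = c
  generalize (MvPolynomial.C (if k = j' then 1 else 0) : MvPolynomial (Mode L) ℂ) = d
  fin_cases A <;> fin_cases C <;> simp [epsTensor] <;> ring

theorem epsTensor_swap (A B : Fin 2) : epsTensor B A = -epsTensor A B := by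
  fin_cases A <;> fin_cases B <;> simp [epsTensor]

/-- Two spins one half contain one singlet, the bracket. For `K = 2` the scalar is `2` and the
bracket sum is `2 ε^{AC} [ik]`, half of which is divided by `2`. The case `i = k` is included, with
zero bracket. -/
theorem X_mul_X_sub_mem_nodeRangeAt {N L : Type*} [Fintype L] [DecidableEq N] [DecidableEq L]
    (G : SeedGraph N L) {i k : Seed L} (h : G.node k = G.node i) (A C : Fin 2) :
    MvPolynomial.X (i, A) * MvPolynomial.X (k, C) - ((1 / 2 : ℂ) * epsTensor A C) • bracket i k ∈
      nodeRangeAt G (G.node i) := by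
  have hcas := sum_nodeConstraint_sq G (G.node i)
    ((MvPolynomial.isWeightedHomogeneous_X ℂ (seedWeight (L := L)) (i, A)).mul
      (MvPolynomial.isWeightedHomogeneous_X ℂ (seedWeight (L := L)) (k, C)))
  have h1 : ∀ x : Seed L, G.node x = G.node i →
      ∑ j : Seed L with G.node j = G.node i, ((Pi.single x 1 : Seed L → ℕ) j : ℂ) = 1 := by
    intro x hx
    rw [Finset.sum_eq_single_of_mem x (by simp [hx])]
    · simp
    · intro j _ hj
      simp [hj]
  have hK : ∑ j : Seed L with G.node j = G.node i,
      (((seedWeight (i, A) + seedWeight (k, C)) j : ℕ) : ℂ) = 2 := by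
    simp only [seedWeight, Pi.add_apply, Nat.cast_add, Finset.sum_add_distrib, h1 i rfl, h1 k h]
    norm_num
  have hb : ∑ i' : Seed L with G.node i' = G.node i, ∑ j' : Seed L with G.node j' = G.node i,
      bracket i' j' * bracketAnnihilation i' j' (MvPolynomial.X (i, A) * MvPolynomial.X (k, C)) =
      (2 * epsTensor A C) • bracket i k := by
    have : ∀ i' j', bracket i' j' *
        bracketAnnihilation i' j' (MvPolynomial.X (i, A) * MvPolynomial.X (k, C)) =
        (if i = i' then (if k = j' then epsTensor A C • bracket i' j' else 0) else 0) +
        (if k = i' then (if i = j' then -epsTensor A C • bracket i' j' else 0) else 0) := by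
      intro i' j'
      rw [bracketAnnihilation_X_mul_X, epsTensor_swap A C, mul_comm, ← MvPolynomial.smul_eq_C_mul]
      split_ifs <;> simp only [mul_one, mul_zero, add_zero, zero_add, zero_smul, add_smul]
    have hk : k ∈ Finset.univ.filter (fun j : Seed L => G.node j = G.node i) := by simp [h]
    have hi : i ∈ Finset.univ.filter (fun j : Seed L => G.node j = G.node i) := by simp
    simp only [this, Finset.sum_add_distrib, Finset.sum_ite_irrel, Finset.sum_ite_eq,
      Finset.sum_const_zero, hk, hi, if_true]
    rw [bracket_swap i k, neg_smul, smul_neg, neg_neg, two_mul, add_smul]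
  rw [hK, hb] at hcas
  refine (Submodule.smul_mem_iff _ (show (1 / 2 : ℂ) * 2 * (1 / 2 * 2 + 1) ≠ 0 by norm_num)).1 ?_
  rw [smul_sub, smul_smul]
  rw [smul_smul] at hcas
  have : (1 / 2 : ℂ) * 2 * (1 / 2 * 2 + 1) * (1 / 2 * epsTensor A C) =
      1 / 2 * (2 * epsTensor A C) := by ring
  rw [this, ← hcas]
  exact Submodule.sum_mem _ fun a _ => nodeConstraint_mem_nodeRangeAt G _ a _

theorem nodeConstraint_X_mul_X_of_ne {N L : Type*} [Fintype L] [DecidableEq N]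
    (G : SeedGraph N L) {n : N} {i j : Seed L} (hi : G.node i ≠ n) (hj : G.node j ≠ n)
    (a : Fin 3) (A B : Fin 2) :
    nodeConstraint G n a (MvPolynomial.X (i, A) * MvPolynomial.X (j, B)) = 0 := by
  rw [nodeConstraint_mul, nodeConstraint_X_of_ne G hi, nodeConstraint_X_of_ne G hj, zero_mul,
    mul_zero, add_zero]

/-- The node of `j` carries a single quantum; the other factor does not feel its constraints. -/
theorem bracket_mem_nodeRange {N L : Type*} [Fintype L] [DecidableEq N] [DecidableEq L]
    (G : SeedGraph N L) {i j : Seed L} (h : G.node i ≠ G.node j) :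
    bracket i j ∈ nodeRange G := by
  refine nodeRangeAt_le_nodeRange G (G.node j) ?_
  refine Submodule.sum_mem _ fun A _ => Submodule.sum_mem _ fun B _ => Submodule.smul_mem _ _ ?_
  exact mul_mem_nodeRangeAt G (fun a => nodeConstraint_X_of_ne G h a A) (X_mem_nodeRangeAt G j B)

/-- The seed `j` is alone at its node, whose constraints annihilate the three other factors. -/
theorem bracket_mul_bracket_mem_of_alone {N L : Type*} [Fintype L] [DecidableEq N]
    [DecidableEq L] (G : SeedGraph N L) {i j k l : Seed L} (hi : G.node i ≠ G.node j)
    (hk : G.node k ≠ G.node j) (hl : G.node l ≠ G.node j) :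
    bracket i j * bracket k l ∈ nodeRange G := by
  refine nodeRangeAt_le_nodeRange G (G.node j) ?_
  have hkl : ∀ a, nodeConstraint G (G.node j) a (bracket k l) = 0 := by
    intro a
    simp only [bracket, map_sum, map_smul, nodeConstraint_X_mul_X_of_ne G hk hl, smul_zero,
      Finset.sum_const_zero]
  rw [mul_comm]
  refine mul_mem_nodeRangeAt G hkl ?_
  refine Submodule.sum_mem _ fun A _ => Submodule.sum_mem _ fun B _ => Submodule.smul_mem _ _ ?_
  exact mul_mem_nodeRangeAt G (fun a => nodeConstraint_X_of_ne G hi a A) (X_mem_nodeRangeAt G j B)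

/-- The source of the braiding. The pair at the first node is reduced to `½ ε^{AC} [ik]`, with the
variables of the second node as a factor blind to that node; then the pair at the second node is
reduced with the invariant `[ik]` as a factor. -/
theorem bracket_mul_bracket_sub_mem {N L : Type*} [Fintype L] [DecidableEq N]
    [DecidableEq L] (G : SeedGraph N L) {i j k l : Seed L} (hij : G.node i ≠ G.node j)
    (hik : G.node k = G.node i) (hjl : G.node l = G.node j) :
    bracket i j * bracket k l - (1 / 2 : ℂ) • (bracket i k * bracket j l) ∈ nodeRange G := by
  have hterm : ∀ A B C D : Fin 2,
      (MvPolynomial.X (i, A) * MvPolynomial.X (j, B)) *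
        (MvPolynomial.X (k, C) * MvPolynomial.X (l, D)) -
      ((1 / 2 : ℂ) * epsTensor A C * ((1 / 2 : ℂ) * epsTensor B D)) •
        (bracket i k * bracket j l) ∈ nodeRange G := by
    intro A B C D
    have h1 := nodeRangeAt_le_nodeRange G _ (mul_mem_nodeRangeAt G
      (q := MvPolynomial.X (j, B) * MvPolynomial.X (l, D))
      (fun a => nodeConstraint_X_mul_X_of_ne G hij.symm (hjl ▸ hij.symm) a B D)
      (X_mul_X_sub_mem_nodeRangeAt G hik A C))
    have h2 := mul_mem_nodeRange G (q := bracket i k) (nodeConstraint_bracket G hik.symm)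
      (nodeRangeAt_le_nodeRange G _ (X_mul_X_sub_mem_nodeRangeAt G hjl B D))
    have h3 := Submodule.add_mem _ h1
      (Submodule.smul_mem _ ((1 / 2 : ℂ) * epsTensor A C) h2)
    convert h3 using 1
    simp only [MvPolynomial.smul_eq_C_mul, map_mul]
    ring
  have h := Submodule.sum_mem (nodeRange G) fun (A : Fin 2) (_ : A ∈ Finset.univ) =>
    Submodule.sum_mem (nodeRange G) fun (B : Fin 2) (_ : B ∈ Finset.univ) =>
    Submodule.sum_mem (nodeRange G) fun (C : Fin 2) (_ : C ∈ Finset.univ) =>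
    Submodule.sum_mem (nodeRange G) fun (D : Fin 2) (_ : D ∈ Finset.univ) =>
      Submodule.smul_mem (nodeRange G) (epsTensor A B * epsTensor C D) (hterm A B C D)
  convert h using 1
  generalize bracket i k * bracket j l = q
  -- Two factors `½` come from the two reductions, and `2` is the full contraction of the four `ε`
  -- tensors.
  have hh : (1 / 2 : ℂ) • q = (MvPolynomial.C (1 / 2) * MvPolynomial.C (1 / 2) * 2) * q := by
    rw [MvPolynomial.smul_eq_C_mul, mul_assoc (MvPolynomial.C _), C_half_mul_two, mul_one]
  rw [hh, bracket_eq, bracket_eq]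
  simp only [Fin.sum_univ_two, epsTensor, MvPolynomial.smul_eq_C_mul]
  simp
  ring

/-! ### The quadratic polynomial of a spinor squeezing -/

/-- `½ γ_{ij} ε_{AB} a_i^A† a_j^B†`. -/
noncomputable def seedPoly {L : Type*} [Fintype L] (γ : Matrix (Seed L) (Seed L) ℂ) :
    MvPolynomial (Mode L) ℂ :=
  (1 / 2 : ℂ) • ∑ i, ∑ j, γ i j • bracket i j

theorem squeezingPoly_spinorSqueezing {L : Type*} [Fintype L]
    (γ : Matrix (Seed L) (Seed L) ℂ) : squeezingPoly (spinorSqueezing γ) = seedPoly γ := by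
  rw [squeezingPoly, seedPoly, Fintype.sum_prod_type]
  congr 1
  refine Finset.sum_congr rfl fun i _ => ?_
  simp only [Fintype.sum_prod_type (α₁ := Seed L) (α₂ := Fin 2), bracket, Finset.smul_sum, smul_smul]
  rw [Finset.sum_comm]
  simp only [spinorSqueezing, mul_comm]

theorem seedPoly_add_smul {L : Type*} [Fintype L] (γ δ : Matrix (Seed L) (Seed L) ℂ) (ε : ℂ) :
    seedPoly (γ + ε • δ) = seedPoly γ + ε • seedPoly δ := by
  simp only [seedPoly, Matrix.add_apply, Matrix.smul_apply, add_smul, Finset.sum_add_distrib,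
    smul_add, Finset.smul_sum, smul_smul, smul_eq_mul]
  congr 1
  refine Finset.sum_congr rfl fun i _ => Finset.sum_congr rfl fun j _ => ?_
  rw [mul_left_comm]

theorem nodeConstraint_seedPoly {N L : Type*} [Fintype L] [DecidableEq N]
    (G : SeedGraph N L) {γ : Matrix (Seed L) (Seed L) ℂ}
    (hγ : ∀ i j, G.node i ≠ G.node j → γ i j = 0) (n : N) (a : Fin 3) :
    nodeConstraint G n a (seedPoly γ) = 0 := by
  simp only [seedPoly, map_smul, map_sum]
  rw [Finset.sum_eq_zero, smul_zero]
  refine fun i _ => Finset.sum_eq_zero fun j _ => ?_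
  by_cases h : G.node i = G.node j
  · rw [nodeConstraint_bracket G h, smul_zero]
  · rw [hγ i j h, zero_smul]

theorem nodeConstraint_pow {N L : Type*} [Fintype L] [DecidableEq N]
    (G : SeedGraph N L) {n : N} {a : Fin 3} {p : MvPolynomial (Mode L) ℂ}
    (h : nodeConstraint G n a p = 0) (m : ℕ) : nodeConstraint G n a (p ^ m) = 0 := by
  rw [← Multiset.prod_replicate]
  refine nodeConstraint_multiset_prod G n a _ fun q hq => ?_
  rw [Multiset.eq_of_mem_replicate hq, h]

theorem seedPoly_mem_nodeRange {N L : Type*} [Fintype L] [DecidableEq N] [DecidableEq L]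
    (G : SeedGraph N L) {δ : Matrix (Seed L) (Seed L) ℂ}
    (hδ : ∀ i j, G.node i = G.node j → δ i j = 0) : seedPoly δ ∈ nodeRange G := by
  refine Submodule.smul_mem _ _ (Submodule.sum_mem _ fun i _ => Submodule.sum_mem _ fun j _ => ?_)
  by_cases h : G.node i = G.node j
  · rw [hδ i j h, zero_smul]
    exact Submodule.zero_mem _
  · exact Submodule.smul_mem _ _ (bracket_mem_nodeRange G h)

/-- The contribution of a pair of matrix elements which join the same two nodes. -/
noncomputable def braidTerm {N L : Type*} [DecidableEq N] (G : SeedGraph N L)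
    (δ : Matrix (Seed L) (Seed L) ℂ) (i j k l : Seed L) : MvPolynomial (Mode L) ℂ :=
  if G.node k = G.node i ∧ G.node l = G.node j then
    (δ i j * δ k l) • (bracket i k * bracket j l) else 0

/-- The two brackets leave a singlet only if they join the same two nodes, in either order. The two
orders exclude each other, and the second is brought to the first by antisymmetry. -/
theorem smul_bracket_mul_bracket_sub_mem {N L : Type*} [Fintype L] [DecidableEq N]
    [DecidableEq L] (G : SeedGraph N L) {δ : Matrix (Seed L) (Seed L) ℂ} (hδ' : δᵀ = -δ)
    (hδ : ∀ i j, G.node i = G.node j → δ i j = 0) (i j k l : Seed L) :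
    (δ i j * δ k l) • (bracket i j * bracket k l) -
      (1 / 2 : ℂ) • (braidTerm G δ i j k l + braidTerm G δ i j l k) ∈ nodeRange G := by
  have hanti : δ l k = -δ k l := congrFun (congrFun hδ' k) l
  unfold braidTerm
  by_cases hij : G.node i = G.node j
  · simp [hδ i j hij]
  by_cases hkl : G.node k = G.node l
  · simp [hanti, hδ k l hkl]
  by_cases h1 : G.node k = G.node i ∧ G.node l = G.node j
  · have h2 : ¬ (G.node l = G.node i ∧ G.node k = G.node j) :=
      fun h => hkl (h1.1.trans h.1.symm)
    rw [if_pos h1, if_neg h2, add_zero, smul_comm, ← smul_sub]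
    exact Submodule.smul_mem _ _ (bracket_mul_bracket_sub_mem G hij h1.1 h1.2)
  by_cases h2 : G.node l = G.node i ∧ G.node k = G.node j
  · rw [if_neg h1, if_pos h2, zero_add, bracket_swap l k, hanti, smul_comm, mul_neg, smul_neg,
      mul_neg, neg_smul, sub_neg_eq_add, neg_add_eq_sub, ← neg_sub, ← smul_sub]
    exact Submodule.neg_mem _ (Submodule.smul_mem _ _
      (bracket_mul_bracket_sub_mem G hij h2.1 h2.2))
  rw [if_neg h1, if_neg h2, add_zero, smul_zero, sub_zero]
  refine Submodule.smul_mem _ _ ?_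
  by_cases h3 : G.node k ≠ G.node j ∧ G.node l ≠ G.node j
  · exact bracket_mul_bracket_mem_of_alone G hij h3.1 h3.2
  -- If `j` has company, exactly one of `k`, `l` sits at its node. The other cannot sit at the node
  -- of `i`, as one of the excluded cases would hold, so `i` is alone.
  · have h4 : G.node k ≠ G.node i ∧ G.node l ≠ G.node i := by
      constructor <;> intro h <;> simp_all
    rw [bracket_swap j i, neg_mul]
    exact Submodule.neg_mem _ (bracket_mul_bracket_mem_of_alone G (Ne.symm hij) h4.1 h4.2)

/-- Both sides are multiples of the sum `S` of all `braidTerm`s. The square carries `½ · ¼` and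
reduces to `S/8`; the two products in `braidPair` each contribute one copy of `S`, so the double sum
is `2 S`, whence `1/16`. -/
theorem half_seedPoly_sq_sub_mem {N L : Type*} [Fintype L] [DecidableEq N]
    [DecidableEq L] (G : SeedGraph N L) {δ : Matrix (Seed L) (Seed L) ℂ} (hδ' : δᵀ = -δ)
    (hδ : ∀ i j, G.node i = G.node j → δ i j = 0) :
    (1 / 2 : ℂ) • seedPoly δ ^ 2 - (1 / 16 : ℂ) • ∑ w, ∑ v,
      braidPair G δ w v • (wedgeCreation G w * wedgeCreation G v) ∈ nodeRange G := by
  have h1 : seedPoly δ ^ 2 = (1 / 4 : ℂ) • ∑ i, ∑ j, ∑ k, ∑ l,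
      (δ i j * δ k l) • (bracket i j * bracket k l) := by
    rw [sq, seedPoly, smul_mul_smul_comm]
    norm_num
    simp only [Finset.sum_mul, Finset.mul_sum, smul_mul_smul_comm]
    refine Finset.sum_congr rfl fun i _ => Finset.sum_congr rfl fun j _ =>
      Finset.sum_congr rfl fun k _ => Finset.sum_congr rfl fun l _ => ?_
    rw [mul_comm (δ i j), mul_comm (bracket i j)]
  have h2 := Submodule.sum_mem (nodeRange G) fun (i : Seed L) (_ : i ∈ Finset.univ) =>
    Submodule.sum_mem (nodeRange G) fun (j : Seed L) (_ : j ∈ Finset.univ) =>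
    Submodule.sum_mem (nodeRange G) fun (k : Seed L) (_ : k ∈ Finset.univ) =>
    Submodule.sum_mem (nodeRange G) fun (l : Seed L) (_ : l ∈ Finset.univ) =>
      smul_bracket_mul_bracket_sub_mem G hδ' hδ i j k l
  have h3 : ∀ i k j l, braidPair G δ (i, k) (j, l) •
      (wedgeCreation G (i, k) * wedgeCreation G (j, l)) =
      braidTerm G δ i j k l + braidTerm G δ i l k j := by
    intro i k j l
    rw [wedgeCreation_eq, wedgeCreation_eq, braidPair, braidTerm, braidTerm]
    by_cases hik : G.node k = G.node i
    · by_cases hjl : G.node l = G.node j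
      · by_cases hij : G.node i = G.node j
        · have hil : G.node i = G.node l := hij.trans hjl.symm
          simp [hδ i j hij, hδ i l hil, hij]
        · simp only [hik, hjl, hij, ne_eq, not_false_eq_true, and_self, if_true]
          rw [bracket_swap j l, mul_neg, smul_neg, ← sub_eq_add_neg, sub_smul]
      · have hjl' : ¬ G.node j = G.node l := fun h => hjl h.symm
        simp [hjl, hjl']
    · have hik' : ¬ G.node i = G.node k := fun h => hik h.symm
      simp [hik, hik']
  set S := ∑ i, ∑ j, ∑ k, ∑ l, braidTerm G δ i j k l with hS
  have hswap : ∑ i, ∑ j, ∑ k, ∑ l, braidTerm G δ i j l k = S := by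
    refine Finset.sum_congr rfl fun i _ => Finset.sum_congr rfl fun j _ => ?_
    rw [Finset.sum_comm]
  have h4 : ∑ w, ∑ v, braidPair G δ w v • (wedgeCreation G w * wedgeCreation G v) =
      (2 : ℂ) • S := by
    simp only [Fintype.sum_prod_type (α₁ := Seed L) (α₂ := Seed L), h3, Finset.sum_add_distrib]
    rw [two_smul, hS]
    congr 1
    · refine Finset.sum_congr rfl fun i _ => ?_
      rw [Finset.sum_comm]
    · refine Finset.sum_congr rfl fun i _ => ?_
      have : ∀ k, ∑ j, ∑ l, braidTerm G δ i l k j = ∑ l, ∑ j, braidTerm G δ i l k j :=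
        fun k => Finset.sum_comm
      simp only [this]
      rw [Finset.sum_comm]
  rw [h1, h4, smul_smul, smul_smul]
  simp only [Finset.sum_sub_distrib, ← Finset.smul_sum, Finset.sum_add_distrib, hswap] at h2
  rw [← hS] at h2
  convert Submodule.smul_mem _ (1 / 8 : ℂ) h2 using 1
  rw [smul_sub, smul_smul, ← two_smul ℂ S, smul_smul]
  norm_num

/-! ### Powers of words -/

/-- A word which is not a nontrivial rotation of itself. -/
def IsPrimitiveWord {α : Type*} (u : List α) : Prop :=
  ∀ k, 0 < k → k < u.length → u.rotate k ≠ u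

/-- The `j`-th power of a word. -/
def wordPow {α : Type*} (u : List α) (j : ℕ) : List α := (List.replicate j u).flatten

theorem wordPow_zero {α : Type*} (u : List α) : wordPow u 0 = [] := rfl

theorem wordPow_succ {α : Type*} (u : List α) (j : ℕ) :
    wordPow u (j + 1) = u ++ wordPow u j := by
  simp [wordPow, List.replicate_succ]

theorem length_wordPow {α : Type*} (u : List α) (j : ℕ) :
    (wordPow u j).length = j * u.length := by
  simp [wordPow]

theorem wordPow_append_comm {α : Type*} (a b : List α) (j : ℕ) :
    wordPow (a ++ b) j ++ a = a ++ wordPow (b ++ a) j := by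
  induction j with
  | zero => simp [wordPow_zero]
  | succ j ih => rw [wordPow_succ, wordPow_succ, List.append_assoc, ih]; simp

theorem rotate_wordPow {α : Type*} (u : List α) (j : ℕ) {k : ℕ} (hk : k ≤ u.length) :
    (wordPow u j).rotate k = wordPow (u.rotate k) j := by
  cases j with
  | zero => simp [wordPow_zero]
  | succ j =>
    obtain ⟨a, b, rfl, rfl⟩ : ∃ a b, u = a ++ b ∧ k = a.length :=
      ⟨u.take k, u.drop k, (List.take_append_drop k u).symm, by simp [hk]⟩
    rw [List.rotate_append_length_eq, wordPow_succ, wordPow_succ, List.append_assoc,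
      List.rotate_append_length_eq, List.append_assoc, wordPow_append_comm, List.append_assoc]

/-- If `u` and `v` commute and `v` is at least as long, then `u` is a prefix of `v` and can be
stripped off, leaving a shorter word that commutes with `u`. -/
theorem eq_wordPow_of_append_comm {α : Type*} (u : List α) (j : ℕ) (v : List α)
    (h : u ++ v = v ++ u) (hl : v.length = j * u.length) : v = wordPow u j := by
  induction j generalizing v with
  | zero =>
    rw [zero_mul, List.length_eq_zero_iff] at hl
    rw [hl, wordPow_zero]
  | succ j ih =>
    have hp : u <+: v := by
      refine List.prefix_of_prefix_length_le (l₃ := u ++ v) (List.prefix_append u v)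
        (h ▸ List.prefix_append v u) ?_
      rw [hl]; exact Nat.le_mul_of_pos_left _ (Nat.succ_pos _)
    obtain ⟨v', rfl⟩ := hp
    rw [wordPow_succ, ← ih v']
    · rw [List.append_assoc] at h
      exact List.append_cancel_left h
    · rw [List.length_append, Nat.succ_mul] at hl
      omega

theorem eq_wordPow_of_rotate {α : Type*} {l : List α} {q j : ℕ} (hq : l.rotate q = l)
    (hl : l.length = j * q) (hj : 0 < j) : l = wordPow (l.take q) j := by
  obtain ⟨j, rfl⟩ := Nat.exists_eq_succ_of_ne_zero hj.ne'
  have hle : q ≤ l.length := by rw [hl]; exact Nat.le_mul_of_pos_left _ hj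
  have hlen : (l.take q).length = q := by simp [hle]
  rw [List.rotate_eq_drop_append_take hle] at hq
  rw [wordPow_succ, ← eq_wordPow_of_append_comm (l.take q) j (l.drop q)]
  · exact (List.take_append_drop q l).symm
  · rw [List.take_append_drop, hq]
  · rw [List.length_drop, hlen, hl, Nat.succ_mul, Nat.add_sub_cancel]

theorem iterate_rotate_one {α : Type*} (l : List α) (k : ℕ) :
    (fun l : List α => l.rotate 1)^[k] l = l.rotate k := by
  induction k with
  | zero => simp
  | succ k ih => rw [Function.iterate_succ_apply', ih, List.rotate_rotate]

theorem isPeriodicPt_rotate_iff {α : Type*} (l : List α) (k : ℕ) :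
    Function.IsPeriodicPt (fun l : List α => l.rotate 1) k l ↔ l.rotate k = l := by
  rw [Function.IsPeriodicPt, Function.IsFixedPt, iterate_rotate_one]

/-- The length of the primitive root of a word. -/
noncomputable def wordPeriod {α : Type*} (l : List α) : ℕ :=
  Function.minimalPeriod (fun l : List α => l.rotate 1) l

theorem rotate_wordPeriod {α : Type*} (l : List α) : l.rotate (wordPeriod l) = l :=
  (isPeriodicPt_rotate_iff _ _).1 (Function.isPeriodicPt_minimalPeriod _ _)

theorem wordPeriod_dvd {α : Type*} {l : List α} {k : ℕ} (h : l.rotate k = l) :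
    wordPeriod l ∣ k :=
  ((isPeriodicPt_rotate_iff _ _).2 h).minimalPeriod_dvd

/-- The minimal period of `l` under rotation by one letter divides its length, and the prefix of
that length is the root. A rotation fixing the root would fix `l`, contradicting minimality. -/
theorem exists_primitive_root {α : Type*} {l : List α} (hl : l ≠ []) :
    ∃ u j, 0 < j ∧ IsPrimitiveWord u ∧ l = wordPow u j := by
  obtain ⟨j, hj⟩ := wordPeriod_dvd (List.rotate_length l)
  have hpos : 0 < l.length := List.length_pos_iff.2 hl
  have hj0 : 0 < j := Nat.pos_of_ne_zero fun h => by simp [h] at hj; exact hl hj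
  have hq0 : 0 < wordPeriod l := Nat.pos_of_ne_zero fun h => by simp [h] at hj; exact hl hj
  have h := eq_wordPow_of_rotate (rotate_wordPeriod l) (by rw [hj, mul_comm]) hj0
  refine ⟨l.take (wordPeriod l), j, hj0, fun k hk hku hrot => ?_, h⟩
  have h1 : l.rotate k = l := by
    conv_lhs => rw [h]
    rw [rotate_wordPow _ _ hku.le, hrot, ← h]
  have h2 := Nat.le_of_dvd hk (wordPeriod_dvd h1)
  rw [List.length_take] at hku
  omega

theorem wordPow_left_injective {α : Type*} {u v : List α} {j : ℕ} (hj : 0 < j)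
    (hlen : u.length = v.length) (h : wordPow u j = wordPow v j) : u = v := by
  obtain ⟨j, rfl⟩ := Nat.exists_eq_succ_of_ne_zero hj.ne'
  rw [wordPow_succ, wordPow_succ] at h
  exact (List.append_inj h hlen).1

theorem wordPeriod_wordPow {α : Type*} {u : List α} (hu : IsPrimitiveWord u) (h0 : u ≠ [])
    {j : ℕ} (hj : 0 < j) : wordPeriod (wordPow u j) = u.length := by
  have hpos : 0 < u.length := List.length_pos_iff.2 h0
  have h1 : wordPeriod (wordPow u j) ∣ u.length :=
    wordPeriod_dvd (by rw [rotate_wordPow _ _ le_rfl, List.rotate_length])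
  have hle := Nat.le_of_dvd hpos h1
  by_contra hne
  have hlt := lt_of_le_of_ne hle hne
  refine hu _ (Nat.pos_of_dvd_of_pos h1 hpos) hlt ?_
  refine wordPow_left_injective hj (List.length_rotate _ _) ?_
  rw [← rotate_wordPow _ _ hle, rotate_wordPeriod]

/-- The rotation period of the power recovers the length of the root, and with it the exponent. -/
theorem wordPow_injective {α : Type*} {u v : List α} (hu : IsPrimitiveWord u) (hu0 : u ≠ [])
    (hv : IsPrimitiveWord v) (hv0 : v ≠ []) {i j : ℕ} (hi : 0 < i) (hj : 0 < j)
    (h : wordPow u i = wordPow v j) : u = v ∧ i = j := by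
  have hlen : u.length = v.length := by
    rw [← wordPeriod_wordPow hu hu0 hi, ← wordPeriod_wordPow hv hv0 hj, h]
  have hij : i = j := by
    have := congrArg List.length h
    rw [length_wordPow, length_wordPow, hlen] at this
    exact Nat.eq_of_mul_eq_mul_right (List.length_pos_iff.2 hv0) this
  subst hij
  exact ⟨wordPow_left_injective hi hlen h, rfl⟩

theorem isNonRepeating_coe_iff {α : Type*} (u : List α) :
    Cycle.IsNonRepeating (u : Cycle α) ↔ IsPrimitiveWord u := by
  refine ⟨fun h => h u rfl, fun h l hl k hk hkl hrot => ?_⟩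
  obtain ⟨n, rfl⟩ := Cycle.coe_eq_coe.1 hl
  refine h k hk (by rwa [List.length_rotate]) ?_
  rw [List.rotate_rotate, add_comm, ← List.rotate_rotate, hrot]

/-- The number of rotations of a primitive word with a given first letter. -/
theorem card_rotations_head {α : Type*} [DecidableEq α] {l : List α} (hl : IsPrimitiveWord l)
    (x : α) : Nat.card {u : List α // u.head? = some x ∧ u ~r l} = l.countP (fun y => y = x) := by
  have h1 : ∀ k : Fin l.length, (l.rotate k).head? = some l[k] := by
    intro k
    rw [List.head?_rotate k.2]
    simp
  let f : {k : Fin l.length // l[k] = x} → {u : List α // u.head? = some x ∧ u ~r l} :=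
    fun k => ⟨l.rotate k.1, by rw [h1, k.2], List.IsRotated.forall l k.1⟩
  have hinj : ∀ a b : ℕ, a ≤ b → b < l.length → l.rotate a = l.rotate b → a = b := by
    intro a b hab hb h
    by_contra hne
    refine hl (b - a) (by omega) (by omega) ?_
    have : (l.rotate (b - a)).rotate a = l.rotate a := by
      rw [List.rotate_rotate, Nat.sub_add_cancel hab, h]
    exact List.rotate_injective a this
  have hf : Function.Bijective f := by
    constructor
    · rintro ⟨a, ha⟩ ⟨b, hb⟩ h
      have h' : l.rotate a = l.rotate b := congrArg Subtype.val h
      refine Subtype.ext (Fin.ext ?_)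
      rcases le_total a.1 b.1 with hab | hab
      · exact hinj a b hab b.2 h'
      · exact (hinj b a hab a.2 h'.symm).symm
    · rintro ⟨u, hu, hr⟩
      obtain ⟨n, rfl⟩ := hr.symm
      have hne : l ≠ [] := by rintro rfl; simp at hu
      have hlt : n % l.length < l.length := Nat.mod_lt _ (List.length_pos_iff.2 hne)
      refine ⟨⟨⟨n % l.length, hlt⟩, ?_⟩, Subtype.ext (List.rotate_mod l n)⟩
      have := h1 ⟨n % l.length, hlt⟩
      rw [List.rotate_mod, hu] at this
      exact (Option.some.inj this).symm
  rw [← Nat.card_congr (Equiv.ofBijective f hf), Nat.card_eq_fintype_card, Fintype.card_subtype]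
  have := Fin.card_filter_univ_eq_vector_get_eq_count x (⟨l, rfl⟩ : List.Vector α l.length)
  exact this

/-! ### Unoriented wedges -/

theorem Seed.other_other {L : Type*} (i : Seed L) : i.other.other = i := by
  simp [Seed.other]

theorem Seed.other_ne {L : Type*} (i : Seed L) : i.other ≠ i := by
  intro h
  have := congrArg Prod.snd h
  simp [Seed.other] at this

/-- The unoriented wedges of the path which starts at the seed `e`, follows the oriented links of
the list, and ends at the seed `f`. -/
def pathWedges {L : Type*} : Seed L → List (Seed L) → Seed L → Multiset (Sym2 (Seed L))
  | e, [], f => {s(e, f)}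
  | e, d :: c, f => s(e, d) ::ₘ pathWedges d.other c f

theorem pathWedges_append {L : Type*} (e : Seed L) (c : List (Seed L)) (d : Seed L)
    (c' : List (Seed L)) (f : Seed L) :
    pathWedges e (c ++ d :: c') f = pathWedges e c d + pathWedges d.other c' f := by
  induction c generalizing e with
  | nil => simp [pathWedges]
  | cons a c ih => simp [pathWedges, ih]

theorem pathWedges_reverse {L : Type*} (e : Seed L) (c : List (Seed L)) (f : Seed L) :
    pathWedges f (c.reverse.map Seed.other) e = pathWedges e c f := by
  induction c generalizing e with
  | nil => simp [pathWedges, Sym2.eq_swap]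
  | cons d c ih =>
    rw [List.reverse_cons, List.map_append, List.map_cons, List.map_nil, pathWedges_append, ih]
    simp only [pathWedges, Seed.other_other]
    rw [Sym2.eq_swap, add_comm, Multiset.singleton_add]

theorem card_pathWedges {L : Type*} (e : Seed L) (c : List (Seed L)) (f : Seed L) :
    (pathWedges e c f).card = c.length + 1 := by
  induction c generalizing e with
  | nil => simp [pathWedges]
  | cons d c ih => simp [pathWedges, ih]

/-- The unoriented wedges of a closed sequence of oriented links. -/
def unorientedWedges {L : Type*} (W : Multiset (Seed L × Seed L)) : Multiset (Sym2 (Seed L)) :=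
  W.map fun w => s(w.1, w.2)

theorem unorientedWedges_cycleWedges_nil {L : Type*} :
    unorientedWedges (cycleWedges (([] : List (Seed L)) : Cycle (Seed L))) = 0 := rfl

theorem unorientedWedges_cycleWedges_cons {L : Type*} (d : Seed L) (c : List (Seed L)) :
    unorientedWedges (cycleWedges ((d :: c : List (Seed L)) : Cycle (Seed L))) =
      pathWedges d.other c d := by
  have h : ∀ (d f : Seed L) (c : List (Seed L)),
      (((List.zipWith (fun d e => (d.other, e)) (d :: c) (c ++ [f]) : List (Seed L × Seed L)) :
        Multiset (Seed L × Seed L)).map fun w => s(w.1, w.2)) = pathWedges d.other c f := by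
    intro d f c
    induction c generalizing d with
    | nil => simp [pathWedges]
    | cons a c ih =>
      have := ih a
      simp only [Multiset.map_coe] at this ⊢
      simp only [List.cons_append, List.zipWith_cons_cons, List.map_cons, pathWedges] at this ⊢
      rw [← this]
      rfl
  have hr : (d :: c).rotate 1 = c ++ [d] := by simp
  rw [← h d d c, ← hr]
  rfl

theorem unorientedWedges_reverseCycle {L : Type*} (c : Cycle (Seed L)) :
    unorientedWedges (cycleWedges (reverseCycle c)) = unorientedWedges (cycleWedges c) := by
  induction c using Quotient.inductionOn with
  | h l =>
    cases l with
    | nil => rfl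
    | cons d c =>
      have h : reverseCycle ((d :: c : List (Seed L)) : Cycle (Seed L)) =
          ((d.other :: c.reverse.map Seed.other : List (Seed L)) : Cycle (Seed L)) := by
        rw [Cycle.coe_cons_eq_coe_append]
        simp [reverseCycle]
      change unorientedWedges (cycleWedges (reverseCycle ((d :: c : List (Seed L)) :
        Cycle (Seed L)))) = unorientedWedges (cycleWedges ((d :: c : List (Seed L)) :
        Cycle (Seed L)))
      rw [h, unorientedWedges_cycleWedges_cons, unorientedWedges_cycleWedges_cons,
        Seed.other_other, pathWedges_reverse]

/-- Running `j` times around a closed path meets at each junction the same wedge that closes a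
single turn. -/
theorem unorientedWedges_wordPow {L : Type*} (u : List (Seed L)) (j : ℕ) :
    unorientedWedges (cycleWedges (wordPow u j : Cycle (Seed L))) =
      j • unorientedWedges (cycleWedges (u : Cycle (Seed L))) := by
  cases u with
  | nil =>
    have : wordPow ([] : List (Seed L)) j = [] := by simp [wordPow]
    rw [this, unorientedWedges_cycleWedges_nil, smul_zero]
  | cons d c =>
    induction j with
    | zero => rw [wordPow_zero, unorientedWedges_cycleWedges_nil, zero_smul]
    | succ j ih =>
      cases j with
      | zero => simp [wordPow_succ, wordPow_zero]
      | succ j =>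
        rw [wordPow_succ, List.cons_append, unorientedWedges_cycleWedges_cons, add_smul, ← ih,
          one_smul, wordPow_succ, List.cons_append, pathWedges_append,
          unorientedWedges_cycleWedges_cons, unorientedWedges_cycleWedges_cons, add_comm]

theorem isChain_of_pathWedges {N L : Type*} (G : SeedGraph N L) (d : Seed L)
    (c : List (Seed L)) (f : Seed L) :
    List.IsChain (fun d e => G.node d.other = G.node e) (d :: (c ++ [f])) ↔
      ∀ p ∈ pathWedges d.other c f, (p.map G.node).IsDiag := by
  induction c generalizing d with
  | nil => simp [pathWedges]
  | cons a c ih =>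
    rw [List.cons_append, List.isChain_cons_cons, ih]
    simp [pathWedges]

theorem cycle_chain_iff {N L : Type*} (G : SeedGraph N L) (c : Cycle (Seed L)) :
    Cycle.Chain (fun d e => G.node d.other = G.node e) c ↔
      ∀ p ∈ unorientedWedges (cycleWedges c), (p.map G.node).IsDiag := by
  induction c using Quotient.inductionOn with
  | h l =>
    cases l with
    | nil => exact ⟨fun _ p hp => absurd hp (Multiset.notMem_zero p), fun _ => trivial⟩
    | cons d c =>
      change Cycle.Chain _ ((d :: c : List (Seed L)) : Cycle (Seed L)) ↔
        ∀ p ∈ unorientedWedges (cycleWedges ((d :: c : List (Seed L)) : Cycle (Seed L))), _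
      rw [Cycle.chain_coe_cons, unorientedWedges_cycleWedges_cons, isChain_of_pathWedges]

theorem isPrimitiveWord_reverse_map_other {L : Type*} {l : List (Seed L)}
    (h : IsPrimitiveWord l) : IsPrimitiveWord (l.reverse.map Seed.other) := by
  have hinj : Function.Injective (Seed.other : Seed L → Seed L) := fun a b hab => by
    rw [← Seed.other_other a, hab, Seed.other_other]
  intro k hk hkl hrot
  rw [List.length_map, List.length_reverse] at hkl
  rw [← List.map_rotate] at hrot
  have h1 := (List.map_injective_iff.2 hinj) hrot
  rw [List.rotate_reverse, Nat.mod_eq_of_lt hkl] at h1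
  exact h (l.length - k) (by omega) (by omega) (List.reverse_injective h1)

theorem zipWith_mem_of_rotate {α β : Type*} (f : α → α → β) (l : List α) (q : ℕ)
    (hq : q < l.length) (hq' : (q + 1) % l.length < l.length) :
    f l[q] (l[(q + 1) % l.length]) ∈ List.zipWith f l (l.rotate 1) := by
  have hlen : q < (List.zipWith f l (l.rotate 1)).length := by simp [hq]
  have : (List.zipWith f l (l.rotate 1))[q] = f l[q] (l[(q + 1) % l.length]) := by
    simp [List.getElem_rotate]
  rw [← this]
  exact List.getElem_mem hlen

/-- A closed sequence of oriented links which is its own reversal has a backtracking. -/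
theorem exists_isDiag_of_isRotated_reverse {L : Type*} {l : List (Seed L)} (hl : l ≠ [])
    (h : l ~r l.reverse.map Seed.other) :
    ∃ p ∈ unorientedWedges (cycleWedges (l : Cycle (Seed L))), p.IsDiag := by
  have hpos : 0 < l.length := List.length_pos_iff.2 hl
  obtain ⟨k, hk, hrot⟩ := List.isRotated_iff_mod.1 h
  -- Self-reversal is a reflection of the cyclic positions: letters at positions with sum `k - 1`
  -- modulo the length are each other's reversals.
  have hget : ∀ i (hi : i < l.length) (hi' : l.length - 1 - i < l.length)
      (hm : (i + k) % l.length < l.length),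
      l[(i + k) % l.length] = (l[l.length - 1 - i]).other := by
    intro i hi hi' hm
    have h1 : (l.rotate k)[i]'(by simpa using hi) =
        (l.reverse.map Seed.other)[i]'(by simpa using hi) := by
      simp only [hrot]
    simpa [List.getElem_rotate] using h1
  have hmem : ∀ q (hq : q < l.length) (hq' : (q + 1) % l.length < l.length),
      l[(q + 1) % l.length] = (l[q]).other →
      ∃ p ∈ unorientedWedges (cycleWedges (l : Cycle (Seed L))), p.IsDiag := by
    intro q hq hq' heq
    refine ⟨s((l[q]).other, l[(q + 1) % l.length]), ?_, by simp [heq]⟩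
    refine Multiset.mem_map.2 ⟨((l[q]).other, l[(q + 1) % l.length]), ?_, rfl⟩
    exact zipWith_mem_of_rotate (fun d e => (Seed.other d, e)) l q hq hq'
  -- For `k = 2r` the reflection exchanges the consecutive positions `r - 1` and `r`, which is a
  -- backtracking. For `k = 2r + 1` it fixes the position `r`, whose letter would be its own
  -- reversal.
  rcases Nat.even_or_odd' k with ⟨r, rfl | rfl⟩
  · rcases Nat.eq_zero_or_pos r with rfl | hr
    · have := hget 0 hpos (by omega) (Nat.mod_lt _ hpos)
      refine hmem (l.length - 1) (by omega) (Nat.mod_lt _ hpos) ?_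
      have e1 : (l.length - 1 + 1) % l.length = 0 := by
        rw [Nat.sub_add_cancel hpos, Nat.mod_self]
      have e2 : (0 + 2 * 0) % l.length = 0 := Nat.zero_mod _
      simp only [e1, e2, Nat.sub_zero] at this ⊢
      exact this
    · have hlt : l.length - r < l.length := by omega
      have := hget (l.length - r) hlt (by omega) (Nat.mod_lt _ hpos)
      have e1 : (l.length - r + 2 * r) % l.length = r % l.length := by
        rw [show l.length - r + 2 * r = r + l.length by omega, Nat.add_mod_right]
      have e2 : l.length - 1 - (l.length - r) = r - 1 := by omega
      refine hmem (r - 1) (by omega) (Nat.mod_lt _ hpos) ?_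
      simp only [e1, e2] at this
      simp only [Nat.sub_add_cancel hr]
      exact this
  · have := hget (l.length - (r + 1)) (by omega) (by omega) (Nat.mod_lt _ hpos)
    have e1 : (l.length - (r + 1) + (2 * r + 1)) % l.length = r := by
      rw [show l.length - (r + 1) + (2 * r + 1) = r + l.length by omega, Nat.add_mod_right,
        Nat.mod_eq_of_lt (by omega)]
    have e2 : l.length - 1 - (l.length - (r + 1)) = r := by omega
    simp only [e1, e2] at this
    exact absurd this.symm (Seed.other_ne _)

/-! ### Loops with a base point -/

/-- The unoriented wedges of a loop. -/
def loopWedges {N L : Type*} {G : SeedGraph N L} (o : LoopOrientation G) (α : GraphLoop G) :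
    Multiset (Sym2 (Seed L)) :=
  unorientedWedges (cycleWedges (o.pick α).1)

/-- The unoriented wedges of a multiloop. -/
def multiloopWedges {N L : Type*} {G : SeedGraph N L} (o : LoopOrientation G)
    (Φ : Multiloop G) : Multiset (Sym2 (Seed L)) :=
  unorientedWedges (Φ.wedges o)

theorem multiloopWedges_add {N L : Type*} {G : SeedGraph N L} (o : LoopOrientation G)
    (Φ Ψ : Multiloop G) :
    multiloopWedges o (Φ + Ψ) = multiloopWedges o Φ + multiloopWedges o Ψ := by
  simp [multiloopWedges, Multiloop.wedges, unorientedWedges]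

theorem multiloopWedges_zero {N L : Type*} {G : SeedGraph N L} (o : LoopOrientation G) :
    multiloopWedges o 0 = 0 := by
  simp [multiloopWedges, Multiloop.wedges, unorientedWedges]

theorem multiloopWedges_singleton {N L : Type*} {G : SeedGraph N L} (o : LoopOrientation G)
    (α : GraphLoop G) : multiloopWedges o {α} = loopWedges o α := by
  simp [multiloopWedges, Multiloop.wedges, loopWedges]

theorem multiloopWedges_replicate {N L : Type*} {G : SeedGraph N L} (o : LoopOrientation G)
    (α : GraphLoop G) (j : ℕ) :
    multiloopWedges o (Multiset.replicate j α) = j • loopWedges o α := by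
  induction j with
  | zero => simp [multiloopWedges_zero]
  | succ j ih =>
    rw [Multiset.replicate_add, multiloopWedges_add, ih, Multiset.replicate_one,
      multiloopWedges_singleton, add_smul, one_smul]

theorem multiloopWedges_eq_bind {N L : Type*} {G : SeedGraph N L} (o : LoopOrientation G)
    (Φ : Multiloop G) : multiloopWedges o Φ = Φ.bind (loopWedges o) := by
  rw [multiloopWedges, Multiloop.wedges, unorientedWedges, Multiset.map_bind]
  rfl

/-- Unoriented wedges do not see the orientation, so the chosen representative may be replaced by
any other. -/
theorem loopWedges_mk {N L : Type*} {G : SeedGraph N L} (o : LoopOrientation G)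
    (c : OrientedLoop G) :
    loopWedges o (Quotient.mk (OrientedLoop.setoid G) c) = unorientedWedges (cycleWedges c.1) := by
  rcases Quotient.exact (o.pick_spec (Quotient.mk (OrientedLoop.setoid G) c)) with h | h
  · exact congrArg (fun c => unorientedWedges (cycleWedges c)) h
  · exact (congrArg (fun c => unorientedWedges (cycleWedges c)) h).trans
      (unorientedWedges_reverseCycle _)

/-- The non-repeating loops with a base point at a given oriented link. -/
def BasedLoop {N L : Type*} (G : SeedGraph N L) (x : Seed L) : Type _ :=
  {u : List (Seed L) // u.head? = some x ∧ IsPrimitiveWord u ∧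
    ∀ p ∈ unorientedWedges (cycleWedges (u : Cycle (Seed L))), (p.map G.node).IsDiag}

theorem BasedLoop.ne_nil {N L : Type*} {G : SeedGraph N L} {x : Seed L} (u : BasedLoop G x) :
    u.1 ≠ [] := by
  intro h
  have := u.2.1
  simp [h] at this

/-- The oriented loop of a loop with a base point. -/
def BasedLoop.toOrientedLoop {N L : Type*} {G : SeedGraph N L} {x : Seed L}
    (u : BasedLoop G x) : OrientedLoop G :=
  ⟨(u.1 : Cycle (Seed L)), by
    rw [Ne, Cycle.coe_eq_nil]
    exact u.ne_nil, (cycle_chain_iff G _).2 u.2.2.2, (isNonRepeating_coe_iff _).2 u.2.2.1⟩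

/-- The loop underlying a loop with a base point. -/
def BasedLoop.toLoop {N L : Type*} {G : SeedGraph N L} {x : Seed L} (u : BasedLoop G x) :
    GraphLoop G :=
  Quotient.mk (OrientedLoop.setoid G) u.toOrientedLoop

theorem loopWedges_toLoop {N L : Type*} {G : SeedGraph N L} (o : LoopOrientation G) {x : Seed L}
    (u : BasedLoop G x) :
    loopWedges o u.toLoop = unorientedWedges (cycleWedges (u.1 : Cycle (Seed L))) :=
  loopWedges_mk o _

theorem finite_isRotated {α : Type*} (l : List α) (x : α) :
    {u : List α | u.head? = some x ∧ u ~r l}.Finite := by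
  classical
  refine (l.cyclicPermutations.toFinset.finite_toSet).subset fun u hu => ?_
  simpa using hu.2

theorem countP_add_countP_eq_count_fst {L : Type*} [DecidableEq L] (l : List (Seed L)) (ℓ : L) :
    l.countP (fun y => y = (ℓ, false)) + l.countP (fun y => y = (ℓ, true)) =
      (l.map Prod.fst).count ℓ := by
  induction l with
  | nil => rfl
  | cons d l ih =>
    obtain ⟨ℓ', b⟩ := d
    simp only [List.map_cons, List.count_cons, List.countP_cons, ← ih]
    cases b <;> by_cases h : ℓ' = ℓ <;> simp [h] <;> omega

/-- The base points are the passages of the loop through `ℓ`. A passage in the chosen direction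
gives a rotation of `l`, an opposite one a rotation of its reversal, and for primitive words
distinct passages give distinct words. -/
theorem card_basedLoop_toLoop_eq {N L : Type*} [DecidableEq L] {G : SeedGraph N L}
    (o : LoopOrientation G) {α : GraphLoop G} (hα : ∀ p ∈ loopWedges o α, ¬ p.IsDiag) (ℓ : L) :
    Finite {u : BasedLoop G (ℓ, false) // u.toLoop = α} ∧
      Nat.card {u : BasedLoop G (ℓ, false) // u.toLoop = α} = α.links.count ℓ := by
  obtain ⟨c, rfl⟩ := Quotient.exists_rep α
  rw [loopWedges_mk] at hα
  obtain ⟨c, hc0, hc1, hc2⟩ := c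
  change ∀ p ∈ unorientedWedges (cycleWedges c), ¬ p.IsDiag at hα
  obtain ⟨l, rfl⟩ : ∃ l : List (Seed L), (l : Cycle (Seed L)) = c := Quotient.exists_rep c
  have hl : IsPrimitiveWord l := (isNonRepeating_coe_iff l).1 hc2
  have hl0 : l ≠ [] := by rwa [Ne, Cycle.coe_eq_nil] at hc0
  have hrev : reverseCycle (l : Cycle (Seed L)) =
      ((l.reverse.map Seed.other : List (Seed L)) : Cycle (Seed L)) := rfl
  have hchain := (cycle_chain_iff G _).1 hc1
  set A : Set (List (Seed L)) := {u | u.head? = some (ℓ, false) ∧ u ~r l} with hA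
  set B : Set (List (Seed L)) :=
    {u | u.head? = some (ℓ, false) ∧ u ~r l.reverse.map Seed.other} with hB
  have hAf : A.Finite := finite_isRotated l _
  have hBf : B.Finite := finite_isRotated _ _
  -- A loop equal to its own reversal would backtrack, which the absence of diagonal wedges forbids;
  -- otherwise base points would be counted twice.
  have hdisj : Disjoint A B := by
    rw [Set.disjoint_left]
    rintro u ⟨-, h1⟩ ⟨-, h2⟩
    obtain ⟨p, hp, hp'⟩ := exists_isDiag_of_isRotated_reverse hl0 (h1.symm.trans h2)
    exact hα p hp hp'
  let f : {u : BasedLoop G (ℓ, false) //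
      u.toLoop = Quotient.mk (OrientedLoop.setoid G) ⟨(l : Cycle (Seed L)), hc0, hc1, hc2⟩} →
      (A ∪ B : Set (List (Seed L))) := fun u => ⟨u.1.1, by
    rcases Quotient.exact u.2 with h | h
    · exact Or.inl ⟨u.1.2.1, Cycle.coe_eq_coe.1 h⟩
    · exact Or.inr ⟨u.1.2.1, Cycle.coe_eq_coe.1 h⟩⟩
  have hf : Function.Bijective f := by
    constructor
    · intro u v h
      have h' : (f u).1 = (f v).1 := congrArg Subtype.val h
      exact Subtype.ext (Subtype.ext h')
    · rintro ⟨u, ⟨h1, h2⟩ | ⟨h1, h2⟩⟩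
      · have h3 : (u : Cycle (Seed L)) = l := Cycle.coe_eq_coe.2 h2
        refine ⟨⟨⟨u, h1, (isNonRepeating_coe_iff u).1 (h3 ▸ hc2), by rwa [h3]⟩,
          Quotient.sound (Or.inl h3)⟩, rfl⟩
      · have h3 : (u : Cycle (Seed L)) = reverseCycle l := Cycle.coe_eq_coe.2 h2
        refine ⟨⟨⟨u, h1, (isNonRepeating_coe_iff u).1 ?_, ?_⟩,
          Quotient.sound (Or.inr h3)⟩, rfl⟩
        · rw [h3, hrev, isNonRepeating_coe_iff]
          exact isPrimitiveWord_reverse_map_other hl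
        · rwa [h3, unorientedWedges_reverseCycle]
  have hfin : Finite (A ∪ B : Set (List (Seed L))) := (hAf.union hBf).to_subtype
  refine ⟨Finite.of_injective f hf.1, ?_⟩
  rw [Nat.card_congr (Equiv.ofBijective f hf), Nat.card_coe_set_eq,
    Set.ncard_union_eq hdisj hAf hBf, ← Nat.card_coe_set_eq, ← Nat.card_coe_set_eq]
  have h1 : Nat.card A = l.countP (fun y => y = (ℓ, false)) := card_rotations_head hl _
  have h2 : Nat.card B = l.countP (fun y => y = (ℓ, true)) := by
    refine (card_rotations_head (isPrimitiveWord_reverse_map_other hl) _).trans ?_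
    rw [List.countP_map, List.countP_reverse]
    refine List.countP_congr fun y _ => ?_
    obtain ⟨ℓ', b⟩ := y
    cases b <;> simp [Seed.other]
  rw [h1, h2]
  change _ = Multiset.count ℓ ((l : Multiset (Seed L)).map Prod.fst)
  rw [Multiset.map_coe, Multiset.coe_count]
  exact countP_add_countP_eq_count_fst l ℓ

/-- The number `y.2 + 1` is the number of copies of the loop that will be cut out, so it runs from
one to the multiplicity. Summing multiplicity times number of passages over the loops gives the
total number of passages. -/
theorem card_basedLoop_lt_count {N L : Type*} [DecidableEq L] {G : SeedGraph N L}
    [DecidableEq (GraphLoop G)]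
    (o : LoopOrientation G) {Φ : Multiloop G} (hΦ : ∀ p ∈ multiloopWedges o Φ, ¬ p.IsDiag)
    (ℓ : L) :
    Finite {y : BasedLoop G (ℓ, false) × ℕ // y.2 < Φ.count y.1.toLoop} ∧
      Nat.card {y : BasedLoop G (ℓ, false) × ℕ // y.2 < Φ.count y.1.toLoop} =
        Φ.twiceSpin ℓ := by
  have hα : ∀ α ∈ Φ.toFinset, ∀ p ∈ loopWedges o α, ¬ p.IsDiag := by
    intro α hα p hp
    refine hΦ p ?_
    rw [multiloopWedges_eq_bind]
    exact Multiset.mem_bind.2 ⟨α, Multiset.mem_toFinset.1 hα, hp⟩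
  let T : {α // α ∈ Φ.toFinset} → Type _ := fun α =>
    {u : BasedLoop G (ℓ, false) // u.toLoop = α.1} × Fin (Φ.count α.1)
  let f : (Σ α, T α) → {y : BasedLoop G (ℓ, false) × ℕ // y.2 < Φ.count y.1.toLoop} :=
    fun z => ⟨(z.2.1.1, z.2.2.1),
      lt_of_lt_of_eq z.2.2.2 (congrArg (fun α => Φ.count α) z.2.1.2.symm)⟩
  have hf : Function.Bijective f := by
    constructor
    · rintro ⟨⟨α, hα⟩, ⟨u, hu⟩, i⟩ ⟨⟨β, hβ⟩, ⟨v, hv⟩, j⟩ h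
      have h1 : u = v := congrArg (fun y => y.1.1) h
      have h2 : i.1 = j.1 := congrArg (fun y => y.1.2) h
      dsimp only at hu hv
      subst h1 hu hv
      obtain rfl : i = j := Fin.ext h2
      rfl
    · rintro ⟨⟨u, i⟩, hi⟩
      have : u.toLoop ∈ Φ.toFinset := by
        rw [Multiset.mem_toFinset, ← Multiset.count_pos]
        exact lt_of_le_of_lt (Nat.zero_le _) hi
      exact ⟨⟨⟨u.toLoop, this⟩, ⟨u, rfl⟩, ⟨i, hi⟩⟩, rfl⟩
  have hfin : ∀ α, Finite (T α) := fun α => by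
    have := (card_basedLoop_toLoop_eq o (hα α.1 α.2) ℓ).1
    exact Finite.instProd
  refine ⟨Finite.of_surjective f hf.2, ?_⟩
  rw [← Nat.card_congr (Equiv.ofBijective f hf), Nat.card_sigma, Multiloop.twiceSpin,
    Multiset.count_bind, Finset.sum_multiset_map_count,
    ← Finset.sum_coe_sort Φ.toFinset fun α => Φ.count α • α.links.count ℓ]
  refine Finset.sum_congr rfl fun α _ => ?_
  rw [Nat.card_prod, (card_basedLoop_toLoop_eq o (hα α.1 α.2) ℓ).2, Nat.card_eq_fintype_card,
    Fintype.card_fin, smul_eq_mul, mul_comm]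

/-! ### Multiloops with an open path -/

/-- The multiloops with given unoriented wedges. -/
def MultiloopWith {N L : Type*} {G : SeedGraph N L} (o : LoopOrientation G)
    (m : Multiset (Sym2 (Seed L))) : Type _ :=
  {Φ : Multiloop G // multiloopWedges o Φ = m}

/-- The pairs of a multiloop and a path from the seed `e` to the seed `f`, with given total
unoriented wedges. -/
def OpenMultiloopWith {N L : Type*} {G : SeedGraph N L} (o : LoopOrientation G)
    (m : Multiset (Sym2 (Seed L))) (e f : Seed L) : Type _ :=
  {x : Multiloop G × List (Seed L) // pathWedges e x.2 f + multiloopWedges o x.1 = m}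

/-- The number of times that a seed occurs in a multiset of unoriented wedges. -/
def seedDegree {L : Type*} [DecidableEq L] (m : Multiset (Sym2 (Seed L))) (i : Seed L) : ℕ :=
  (m.map fun p => p.toMultiset.count i).sum

theorem seedDegree_zero {L : Type*} [DecidableEq L] (i : Seed L) : seedDegree 0 i = 0 := rfl

theorem seedDegree_add {L : Type*} [DecidableEq L] (m m' : Multiset (Sym2 (Seed L)))
    (i : Seed L) : seedDegree (m + m') i = seedDegree m i + seedDegree m' i := by
  simp [seedDegree]

theorem seedDegree_cons {L : Type*} [DecidableEq L] (a b : Seed L)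
    (m : Multiset (Sym2 (Seed L))) (i : Seed L) :
    seedDegree (s(a, b) ::ₘ m) i =
      (if a = i then 1 else 0) + (if b = i then 1 else 0) + seedDegree m i := by
  have : (s(a, b) : Sym2 (Seed L)).toMultiset = a ::ₘ {b} := rfl
  rw [seedDegree, Multiset.map_cons, Multiset.sum_cons, this, Multiset.count_cons,
    Multiset.count_singleton]
  simp only [eq_comm (a := i), seedDegree]
  omega

/-- Traversing a link uses both of its seeds once; the two ends of the path add one each. -/
theorem seedDegree_pathWedges {L : Type*} [DecidableEq L] (e : Seed L) (c : List (Seed L))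
    (f i : Seed L) :
    seedDegree (pathWedges e c f) i =
      (if e = i then 1 else 0) + (if f = i then 1 else 0) + (c.map Prod.fst).count i.1 := by
  induction c generalizing e with
  | nil =>
    rw [pathWedges, ← Multiset.cons_zero, seedDegree_cons, seedDegree_zero]
    simp
  | cons d c ih =>
    rw [pathWedges, seedDegree_cons, ih, List.map_cons, List.count_cons]
    have : (if d = i then 1 else 0) + (if d.other = i then 1 else 0) =
        if d.1 == i.1 then 1 else 0 := by
      obtain ⟨ℓ, b⟩ := d
      obtain ⟨ℓ', b'⟩ := i
      by_cases h : ℓ = ℓ' <;> cases b <;> cases b' <;> simp [Seed.other, h]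
    omega

theorem seedDegree_cycleWedges {L : Type*} [DecidableEq L] (c : Cycle (Seed L)) (i : Seed L) :
    seedDegree (unorientedWedges (cycleWedges c)) i = (c.toMultiset.map Prod.fst).count i.1 := by
  induction c using Quotient.inductionOn with
  | h l =>
    cases l with
    | nil => rfl
    | cons d c =>
      change seedDegree (unorientedWedges (cycleWedges ((d :: c : List (Seed L)) :
        Cycle (Seed L)))) i = Multiset.count i.1 (((d :: c : List (Seed L)) :
          Multiset (Seed L)).map Prod.fst)
      rw [unorientedWedges_cycleWedges_cons, seedDegree_pathWedges, Multiset.map_coe,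
        Multiset.coe_count, List.map_cons, List.count_cons]
      have : (if d.other = i then 1 else 0) + (if d = i then 1 else 0) =
          if d.1 == i.1 then 1 else 0 := by
        obtain ⟨ℓ, b⟩ := d
        obtain ⟨ℓ', b'⟩ := i
        by_cases h : ℓ = ℓ' <;> cases b <;> cases b' <;> simp [Seed.other, h]
      omega

theorem seedDegree_multiloopWedges {N L : Type*} [DecidableEq L] {G : SeedGraph N L}
    (o : LoopOrientation G) (Φ : Multiloop G) (i : Seed L) :
    seedDegree (multiloopWedges o Φ) i = Φ.twiceSpin i.1 := by
  induction Φ using Multiset.induction_on with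
  | empty => rw [multiloopWedges_zero, seedDegree_zero]; rfl
  | cons α Φ ih =>
    have h1 : (α ::ₘ Φ : Multiloop G) = {α} + Φ := (Multiset.singleton_add α Φ).symm
    rw [h1, multiloopWedges_add, seedDegree_add, ih, multiloopWedges_singleton, loopWedges,
      seedDegree_cycleWedges]
    have h2 : ((o.pick α).1.toMultiset.map Prod.fst) = α.links := by
      conv_rhs => rw [← o.pick_spec α]
      rfl
    rw [h2]
    simp [Multiloop.twiceSpin]

theorem finite_setOf_multiloopWedges_eq {N L : Type*} [Fintype L] [DecidableEq L]
    {G : SeedGraph N L} (o : LoopOrientation G) (m : Multiset (Sym2 (Seed L))) :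
    {Φ : Multiloop G | multiloopWedges o Φ = m}.Finite := by
  refine (Multiloop.finite_twiceSpin_eq G fun ℓ => seedDegree m (ℓ, false)).subset ?_
  rintro Φ rfl
  funext ℓ
  exact (seedDegree_multiloopWedges o Φ (ℓ, false)).symm

theorem finite_multiloopWith {N L : Type*} [Fintype L] [DecidableEq L] {G : SeedGraph N L}
    (o : LoopOrientation G) (m : Multiset (Sym2 (Seed L))) : Finite (MultiloopWith o m) :=
  (finite_setOf_multiloopWedges_eq o m).to_subtype

theorem finite_openMultiloopWith {N L : Type*} [Fintype L] [DecidableEq L] {G : SeedGraph N L}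
    (o : LoopOrientation G) (m : Multiset (Sym2 (Seed L))) (e f : Seed L) :
    Finite (OpenMultiloopWith o m e f) := by
  have h1 : {Φ : Multiloop G | multiloopWedges o Φ ≤ m}.Finite :=
    Set.Finite.preimage' (s := {m' | m' ≤ m}) (f := multiloopWedges o) (Set.finite_Iic m)
      fun m' _ => finite_setOf_multiloopWedges_eq o m'
  have h2 := List.finite_length_le (Seed L) m.card
  have h3 : {x : Multiloop G × List (Seed L) |
      pathWedges e x.2 f + multiloopWedges o x.1 = m}.Finite := by
    refine (h1.prod h2).subset ?_
    rintro ⟨Φ, c⟩ rfl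
    refine ⟨Multiset.le_add_left _ _, ?_⟩
    simp only [Set.mem_ofPred, Multiset.card_add, card_pathWedges]
    omega
  exact h3.to_subtype

/-- An open path from the target to the source of `ℓ` becomes a closed word when `ℓ` is put in
front. That word is uniquely a power of a primitive word, and adding as many copies of the
corresponding loop to the multiloop gives a closed multiloop. The inverse cuts some copies of a loop
through `ℓ` out of a multiloop and concatenates them at a base point. -/
theorem card_openMultiloopWith_link {N L : Type*} [Fintype L] [DecidableEq L]
    {G : SeedGraph N L} (o : LoopOrientation G) {m : Multiset (Sym2 (Seed L))}
    (hm : ∀ p ∈ m, ¬ p.IsDiag) (hn : ∀ p ∈ m, (p.map G.node).IsDiag) (ℓ : L) :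
    Nat.card (OpenMultiloopWith o m (ℓ, true) (ℓ, false)) =
      Nat.card (MultiloopWith o m) * seedDegree m (ℓ, false) := by
  classical
  have := finite_multiloopWith o m
  have := Fintype.ofFinite (MultiloopWith o m)
  let T : MultiloopWith o m → Type _ := fun Φ =>
    {y : BasedLoop G (ℓ, false) × ℕ // y.2 < Φ.1.count y.1.toLoop}
  have hT : ∀ Φ, Finite (T Φ) ∧ Nat.card (T Φ) = seedDegree m (ℓ, false) := by
    intro Φ
    have h := card_basedLoop_lt_count o (Φ := Φ.1) (by rw [Φ.2]; exact hm) ℓ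
    refine ⟨h.1, h.2.trans ?_⟩
    rw [← seedDegree_multiloopWedges o Φ.1 (ℓ, false), Φ.2]
  have hTf : ∀ Φ, Finite (T Φ) := fun Φ => (hT Φ).1
  have hhead : ∀ (u : BasedLoop G (ℓ, false)) (j : ℕ),
      wordPow u.1 (j + 1) = (ℓ, false) :: (wordPow u.1 (j + 1)).tail := by
    intro u j
    rw [wordPow_succ]
    obtain ⟨u, hu, -⟩ := u
    cases u with
    | nil => simp at hu
    | cons d c => simp at hu; simp [hu]
  have hwed : ∀ (u : BasedLoop G (ℓ, false)) (j : ℕ),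
      pathWedges (ℓ, true) (wordPow u.1 (j + 1)).tail (ℓ, false) =
        (j + 1) • loopWedges o u.toLoop := by
    intro u j
    rw [loopWedges_toLoop, ← unorientedWedges_wordPow]
    conv_rhs => rw [hhead u j]
    rw [unorientedWedges_cycleWedges_cons]
    rfl
  have hle : ∀ (Φ : MultiloopWith o m) (y : T Φ),
      Multiset.replicate (y.1.2 + 1) y.1.1.toLoop ≤ Φ.1 := fun Φ y =>
    Multiset.le_count_iff_replicate_le.1 y.2
  -- The shift by one keeps the power nonempty; its first letter is `ℓ` itself, and dropping it
  -- opens the path.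
  let f : (Σ Φ, T Φ) → OpenMultiloopWith o m (ℓ, true) (ℓ, false) := fun z =>
    ⟨(z.1.1 - Multiset.replicate (z.2.1.2 + 1) z.2.1.1.toLoop,
      (wordPow z.2.1.1.1 (z.2.1.2 + 1)).tail), by
      dsimp only
      rw [hwed, ← multiloopWedges_replicate, ← multiloopWedges_add,
        add_tsub_cancel_of_le (hle _ _), z.1.2]⟩
  have hf : Function.Bijective f := by
    constructor
    · rintro ⟨⟨Φ, hΦ⟩, ⟨⟨u, i⟩, hi⟩⟩ ⟨⟨Ψ, hΨ⟩, ⟨⟨v, j⟩, hj⟩⟩ h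
      have h1 : Φ - Multiset.replicate (i + 1) u.toLoop =
          Ψ - Multiset.replicate (j + 1) v.toLoop := congrArg (fun x => x.1.1) h
      have h2 : (wordPow u.1 (i + 1)).tail = (wordPow v.1 (j + 1)).tail :=
        congrArg (fun x => x.1.2) h
      have h3 : wordPow u.1 (i + 1) = wordPow v.1 (j + 1) := by
        rw [hhead u i, hhead v j, h2]
      obtain ⟨h4, h5⟩ := wordPow_injective u.2.2.1 u.ne_nil v.2.2.1 v.ne_nil
        (Nat.succ_pos i) (Nat.succ_pos j) h3
      obtain rfl : u = v := Subtype.ext h4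
      obtain rfl : i = j := Nat.succ_injective h5
      have h6 : Φ = Ψ := by
        have hΦ' := hle ⟨Φ, hΦ⟩ ⟨⟨u, i⟩, hi⟩
        have hΨ' := hle ⟨Ψ, hΨ⟩ ⟨⟨u, i⟩, hj⟩
        exact (tsub_left_inj hΦ' hΨ').1 h1
      subst h6
      rfl
    · rintro ⟨⟨Φ', c⟩, hc⟩
      dsimp only at hc
      obtain ⟨u, j, hj, hu, huj⟩ := exists_primitive_root (List.cons_ne_nil (ℓ, false) c)
      obtain ⟨j, rfl⟩ : ∃ j', j = j' + 1 := ⟨j - 1, by omega⟩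
      have hu0 : u ≠ [] := by
        rintro rfl
        have := congrArg List.length huj
        simp [length_wordPow] at this
      have hhd : u.head? = some (ℓ, false) := by
        rw [wordPow_succ] at huj
        cases u with
        | nil => exact absurd rfl hu0
        | cons d c' => rw [List.cons_append, List.cons.injEq] at huj; simp [huj.1]
      have hcw : unorientedWedges (cycleWedges (((ℓ, false) :: c : List (Seed L)) :
          Cycle (Seed L))) = pathWedges (ℓ, true) c (ℓ, false) :=
        unorientedWedges_cycleWedges_cons _ _
      -- The wedges of the root are among those of `m`, so the root is a genuine closed path of the
      -- graph.
      have hsub : unorientedWedges (cycleWedges (u : Cycle (Seed L))) ≤ m := by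
        rw [← hc, ← hcw, huj, unorientedWedges_wordPow, add_smul, one_smul, add_right_comm]
        exact le_add_self
      let v : BasedLoop G (ℓ, false) :=
        ⟨u, hhd, hu, fun p hp => hn p (Multiset.mem_of_le hsub hp)⟩
      have hv : pathWedges (ℓ, true) c (ℓ, false) = (j + 1) • loopWedges o v.toLoop := by
        rw [← hcw, huj, unorientedWedges_wordPow, loopWedges_toLoop]
      refine ⟨⟨⟨Φ' + Multiset.replicate (j + 1) v.toLoop, ?_⟩, ⟨(v, j), ?_⟩⟩, ?_⟩
      · rw [multiloopWedges_add, multiloopWedges_replicate, ← hv, add_comm, hc]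
      · simp
      · refine Subtype.ext (Prod.ext ?_ ?_)
        · exact add_tsub_cancel_right _ _
        · change (wordPow u (j + 1)).tail = c
          rw [← huj, List.tail_cons]
  rw [← Nat.card_congr (Equiv.ofBijective f hf), Nat.card_sigma]
  simp only [(hT _).2, Finset.sum_const, Finset.card_univ, smul_eq_mul, Nat.card_eq_fintype_card]

/-! ### The number of multiloops with given wedges -/

theorem card_cons_eq {X β : Type*} [DecidableEq β] (g : X → Multiset β) (p : β)
    (m : Multiset β) :
    Nat.card {y : X // p ::ₘ g y = m} =
      if p ∈ m then Nat.card {y : X // g y = m.erase p} else 0 := by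
  split_ifs with h
  · refine Nat.card_congr (Equiv.subtypeEquivRight fun y => ?_)
    constructor
    · rintro rfl
      rw [Multiset.erase_cons_head]
    · intro hy
      rw [hy, Multiset.cons_erase h]
  · have : IsEmpty {y : X // p ::ₘ g y = m} := ⟨fun y => h (y.2 ▸ Multiset.mem_cons_self _ _)⟩
    exact Nat.card_of_isEmpty

/-- The path is split at its first wedge: either it ends at once at `f`, or it enters the link of
`d` and goes on from the other seed of that link. -/
theorem card_openMultiloopWith {N L : Type*} [Fintype L] [DecidableEq L] {G : SeedGraph N L}
    (o : LoopOrientation G) (m : Multiset (Sym2 (Seed L))) (e f : Seed L) :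
    Nat.card (OpenMultiloopWith o m e f) =
      (if s(e, f) ∈ m then Nat.card (MultiloopWith o (m.erase s(e, f))) else 0) +
      ∑ d, if s(e, d) ∈ m then
        Nat.card (OpenMultiloopWith o (m.erase s(e, d)) d.other f) else 0 := by
  let A : Type _ := {Φ : Multiloop G // s(e, f) ::ₘ multiloopWedges o Φ = m}
  let B : Seed L → Type _ := fun d => {x : Multiloop G × List (Seed L) //
    s(e, d) ::ₘ (pathWedges d.other x.2 f + multiloopWedges o x.1) = m}
  have hfin := finite_openMultiloopWith o m e f
  let F : A ⊕ (Σ d, B d) → OpenMultiloopWith o m e f := fun z => match z with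
    | Sum.inl Φ => ⟨(Φ.1, []), by simpa [pathWedges] using Φ.2⟩
    | Sum.inr ⟨d, x⟩ => ⟨(x.1.1, d :: x.1.2), by simpa [pathWedges] using x.2⟩
  have hF : Function.Bijective F := by
    constructor
    · rintro (⟨Φ, hΦ⟩ | ⟨d, ⟨⟨Φ, c⟩, hx⟩⟩) (⟨Ψ, hΨ⟩ | ⟨d', ⟨⟨Ψ, c'⟩, hx'⟩⟩) h
      · have h1 : Φ = Ψ := congrArg (fun x => x.1.1) h
        subst h1; rfl
      · have h2 : [] = d' :: c' := congrArg (fun x => x.1.2) h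
        exact absurd h2 (by simp)
      · have h2 : d :: c = [] := congrArg (fun x => x.1.2) h
        exact absurd h2 (by simp)
      · have h1 : Φ = Ψ := congrArg (fun x => x.1.1) h
        have h2 : d :: c = d' :: c' := congrArg (fun x => x.1.2) h
        obtain ⟨rfl, rfl⟩ := List.cons.inj h2
        subst h1; rfl
    · rintro ⟨⟨Φ, c⟩, h⟩
      cases c with
      | nil => exact ⟨Sum.inl ⟨Φ, by rw [← h]; simp [pathWedges]⟩, rfl⟩
      | cons d c => exact ⟨Sum.inr ⟨d, ⟨(Φ, c), by rw [← h]; simp [pathWedges]⟩⟩, rfl⟩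
  have hfin' : Finite (A ⊕ (Σ d, B d)) := Finite.of_injective F hF.1
  have hA : Finite A := Finite.of_injective (Sum.inl : A → A ⊕ (Σ d, B d)) Sum.inl_injective
  have hB : ∀ d, Finite (B d) := fun d => Finite.of_injective
    (fun x => (Sum.inr ⟨d, x⟩ : A ⊕ (Σ d, B d)))
    (Sum.inr_injective.comp sigma_mk_injective)
  rw [← Nat.card_congr (Equiv.ofBijective F hF), Nat.card_sum, Nat.card_sigma]
  congr 1
  · exact card_cons_eq (multiloopWedges o) s(e, f) m
  · exact Finset.sum_congr rfl fun d _ =>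
      card_cons_eq (fun x : Multiloop G × List (Seed L) =>
        pathWedges d.other x.2 f + multiloopWedges o x.1) s(e, d) m

/-! ### Factorial identities and the induction that counts multiloops -/

/-- The product of the factorials of the multiplicities of a multiset. -/
def multisetFactorial {β : Type*} [Fintype β] [DecidableEq β] (m : Multiset β) : ℕ :=
  ∏ p, (m.count p).factorial

theorem multisetFactorial_pos {β : Type*} [Fintype β] [DecidableEq β] (m : Multiset β) :
    0 < multisetFactorial m := Finset.prod_pos fun _ _ => Nat.factorial_pos _

theorem multisetFactorial_cons {β : Type*} [Fintype β] [DecidableEq β] (p : β)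
    (m : Multiset β) : multisetFactorial (p ::ₘ m) = (m.count p + 1) * multisetFactorial m := by
  rw [multisetFactorial, multisetFactorial, ← Finset.mul_prod_erase _ _ (Finset.mem_univ p),
    ← Finset.mul_prod_erase _ _ (Finset.mem_univ p), Multiset.count_cons_self,
    Nat.factorial_succ, mul_assoc]
  congr 2
  refine Finset.prod_congr rfl fun q hq => ?_
  rw [Multiset.count_cons_of_ne (Finset.ne_of_mem_erase hq)]

theorem multisetFactorial_erase {β : Type*} [Fintype β] [DecidableEq β] {p : β}
    {m : Multiset β} (h : p ∈ m) :
    multisetFactorial m = m.count p * multisetFactorial (m.erase p) := by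
  conv_lhs => rw [← Multiset.cons_erase h]
  rw [multisetFactorial_cons, Multiset.count_erase_self,
    Nat.sub_add_cancel (Multiset.count_pos.2 h)]

theorem sum_count_eq_seedDegree {L : Type*} [Fintype L] [DecidableEq L]
    {m : Multiset (Sym2 (Seed L))} (hm : ∀ p ∈ m, ¬ p.IsDiag) (e : Seed L) :
    ∑ d, m.count s(e, d) = seedDegree m e := by
  induction m using Multiset.induction_on with
  | empty => simp [seedDegree_zero]
  | cons p m ih =>
    have ih' := ih fun q hq => hm q (Multiset.mem_cons_of_mem hq)
    have hp := hm p (Multiset.mem_cons_self _ _)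
    induction p using Sym2.ind with
    | _ a b =>
      have hab : a ≠ b := by simpa using hp
      rw [seedDegree_cons, ← ih']
      simp only [Multiset.count_cons, Finset.sum_add_distrib]
      rw [add_comm]
      congr 1
      have : ∀ d, (if s(e, d) = s(a, b) then 1 else 0) =
          (if b = d then (if a = e then 1 else 0) else 0) +
          (if a = d then (if b = e then 1 else 0) else 0) := by
        intro d
        by_cases h1 : s(e, d) = s(a, b)
        · rw [if_pos h1]
          rcases Sym2.eq_iff.1 h1 with ⟨rfl, rfl⟩ | ⟨rfl, rfl⟩
          · simp [hab]
          · simp [hab]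
        · rw [if_neg h1]
          by_cases ha : a = e <;> by_cases hb : b = d <;> by_cases ha' : a = d <;>
            by_cases hb' : b = e <;> simp_all
      simp only [this, Finset.sum_add_distrib, Finset.sum_ite_eq, Finset.mem_univ, if_true]

theorem seedDegree_pos_of_mem {L : Type*} [DecidableEq L]
    {m : Multiset (Sym2 (Seed L))} {a b : Seed L} (h : s(a, b) ∈ m) : 0 < seedDegree m a := by
  rw [← Multiset.cons_erase h, seedDegree_cons, if_pos rfl]
  omega

/-- The first wedge of the path always contains `e`. -/
theorem isEmpty_openMultiloopWith {N L : Type*} [DecidableEq L] {G : SeedGraph N L}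
    (o : LoopOrientation G) {m : Multiset (Sym2 (Seed L))} {e : Seed L} (f : Seed L)
    (h : seedDegree m e = 0) : IsEmpty (OpenMultiloopWith o m e f) := by
  refine ⟨fun x => ?_⟩
  obtain ⟨⟨Φ, c⟩, rfl⟩ := x
  rw [seedDegree_add, seedDegree_pathWedges, if_pos rfl] at h
  omega

theorem prod_factorial_add_ite {β : Type*} [Fintype β] [DecidableEq β] (g : β → ℕ) (a : β) :
    ∏ i, (g i + if a = i then 1 else 0).factorial = (g a + 1) * ∏ i, (g i).factorial := by
  rw [← Finset.mul_prod_erase _ _ (Finset.mem_univ a),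
    ← Finset.mul_prod_erase _ _ (Finset.mem_univ a), if_pos rfl, Nat.factorial_succ, mul_assoc]
  congr 2
  refine Finset.prod_congr rfl fun i hi => ?_
  rw [if_neg (Finset.ne_of_mem_erase hi).symm, add_zero]

theorem prod_factorial_link {L : Type*} [Fintype L] (k : L → ℕ) :
    ∏ i : Seed L, (k i.1).factorial = (∏ ℓ, (k ℓ).factorial) * ∏ ℓ, (k ℓ).factorial := by
  rw [Fintype.prod_prod_type, ← Finset.prod_mul_distrib]
  exact Finset.prod_congr rfl fun ℓ _ => by simp [sq]

theorem prod_factorial_seedDegree_cons {L : Type*} [Fintype L] [DecidableEq L] (e d : Seed L)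
    (hed : e ≠ d) (m : Multiset (Sym2 (Seed L))) :
    ∏ i, (seedDegree (s(e, d) ::ₘ m) i).factorial =
      (seedDegree (s(e, d) ::ₘ m) e * seedDegree (s(e, d) ::ₘ m) d) *
        ∏ i, (seedDegree m i).factorial := by
  have h : ∀ i, seedDegree (s(e, d) ::ₘ m) i =
      seedDegree m i + (if e = i then 1 else 0) + if d = i then 1 else 0 := fun i => by
    rw [seedDegree_cons]; omega
  simp only [h]
  rw [prod_factorial_add_ite (fun i => seedDegree m i + if e = i then 1 else 0) d,
    prod_factorial_add_ite]
  simp only [if_true, if_neg hed, if_neg hed.symm, add_zero]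
  ring

theorem prod_factorial_update_pred {L : Type*} [Fintype L] [DecidableEq L] (k : L → ℕ) {ℓ : L}
    (h : 0 < k ℓ) :
    ∏ x, (k x).factorial = k ℓ * ∏ x, (k x - if ℓ = x then 1 else 0).factorial := by
  have := prod_factorial_add_ite (fun x => k x - if ℓ = x then 1 else 0) ℓ
  rw [if_pos rfl, Nat.sub_add_cancel h] at this
  rw [← this]
  refine Finset.prod_congr rfl fun x _ => ?_
  split_ifs with hx
  · subst hx
    rw [Nat.sub_add_cancel h]
  · rfl

theorem multiloopWith_zero {N L : Type*} {G : SeedGraph N L} (o : LoopOrientation G) :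
    Nat.card (MultiloopWith o (0 : Multiset (Sym2 (Seed L)))) = 1 := by
  classical
  rw [Nat.card_eq_one_iff_unique]
  refine ⟨⟨?_⟩, ⟨⟨0, multiloopWedges_zero o⟩⟩⟩
  have key : ∀ Φ : Multiloop G, multiloopWedges o Φ = 0 → Φ = 0 := by
    intro Φ hΦ
    rw [Multiset.eq_zero_iff_forall_notMem]
    intro α hα
    have h1 := seedDegree_multiloopWedges o Φ
    rw [hΦ] at h1
    obtain ⟨ℓ, hℓ⟩ := Multiset.card_pos_iff_exists_mem.1 α.card_links_pos
    have h2 : ℓ ∈ Φ.bind GraphLoop.links := Multiset.mem_bind.2 ⟨α, hα, hℓ⟩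
    have h3 := Multiset.count_pos.2 h2
    have h4 : 0 = Multiset.count ℓ _ := h1 (ℓ, false)
    omega
  rintro ⟨Φ, hΦ⟩ ⟨Ψ, hΨ⟩
  exact Subtype.ext ((key Φ hΦ).trans (key Ψ hΨ).symm)

/-- The induction step for open paths. It uses both counts, closed and open, with one wedge less,
because the first wedge may or may not be the last. -/
theorem card_openMultiloopWith_mul_of_forall {N L : Type*} [Fintype L] [DecidableEq L]
    {G : SeedGraph N L} (o : LoopOrientation G) (m : Multiset (Sym2 (Seed L)))
    (hm : ∀ p ∈ m, ¬ p.IsDiag)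
    (hclosed : ∀ p ∈ m, ∀ k : L → ℕ, (∀ i, seedDegree (m.erase p) i = k i.1) →
      Nat.card (MultiloopWith o (m.erase p)) * multisetFactorial (m.erase p) =
        ∏ ℓ, (k ℓ).factorial)
    (hopen : ∀ p ∈ m, ∀ (k : L → ℕ) (e f : Seed L),
      (∀ i, seedDegree (m.erase p) i =
        k i.1 + (if e = i then 1 else 0) + if f = i then 1 else 0) →
      Nat.card (OpenMultiloopWith o (m.erase p) e f) *
        ((∏ ℓ, (k ℓ).factorial) * multisetFactorial (m.erase p)) =
        ∏ i, (seedDegree (m.erase p) i).factorial)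
    (k : L → ℕ) (e f : Seed L)
    (h : ∀ i, seedDegree m i = k i.1 + (if e = i then 1 else 0) + if f = i then 1 else 0) :
    Nat.card (OpenMultiloopWith o m e f) * ((∏ ℓ, (k ℓ).factorial) * multisetFactorial m) =
      ∏ i, (seedDegree m i).factorial := by
  set K := ∏ ℓ, (k ℓ).factorial with hK
  set T : Seed L → ℕ := fun d =>
    (if d = f then Nat.card (MultiloopWith o (m.erase s(e, d))) else 0) +
      Nat.card (OpenMultiloopWith o (m.erase s(e, d)) d.other f) with hT
  have hcard : Nat.card (OpenMultiloopWith o m e f) = ∑ d, if s(e, d) ∈ m then T d else 0 := by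
    rw [card_openMultiloopWith]
    have : (if s(e, f) ∈ m then Nat.card (MultiloopWith o (m.erase s(e, f))) else 0) =
        ∑ d, if d = f then
          (if s(e, d) ∈ m then Nat.card (MultiloopWith o (m.erase s(e, d))) else 0) else 0 := by
      rw [Finset.sum_ite_eq' Finset.univ f
        (fun d => if s(e, d) ∈ m then Nat.card (MultiloopWith o (m.erase s(e, d))) else 0),
        if_pos (Finset.mem_univ f)]
    rw [this, ← Finset.sum_add_distrib]
    refine Finset.sum_congr rfl fun d _ => ?_
    simp only [hT]
    split_ifs <;> simp
  -- After multiplication by the degree of `e`, the paths starting with the wedge `{e, d}` account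
  -- for the multiplicity of that wedge. These multiplicities add up to the degree of `e`, which
  -- then cancels.
  have hterm : ∀ d, (if s(e, d) ∈ m then T d else 0) * (K * multisetFactorial m) *
      seedDegree m e = m.count s(e, d) * ∏ i, (seedDegree m i).factorial := by
    intro d
    split_ifs with hp
    swap
    · rw [Multiset.count_eq_zero_of_notMem hp]; simp
    have hed : e ≠ d := by simpa using hm _ hp
    obtain ⟨m', hm'⟩ : ∃ m', m.erase s(e, d) = m' := ⟨_, rfl⟩
    have hmm : m = s(e, d) ::ₘ m' := by rw [← hm', Multiset.cons_erase hp]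
    have hdeg : ∀ i, seedDegree m i =
        (if e = i then 1 else 0) + (if d = i then 1 else 0) + seedDegree m' i := fun i => by
      rw [hmm, seedDegree_cons]
    have hdeg' : ∀ i, seedDegree m' i + (if d = i then 1 else 0) =
        k i.1 + if f = i then 1 else 0 := fun i => by
      have := h i; have := hdeg i; omega
    have hclosed' := hclosed _ hp
    have hopen' := hopen _ hp
    rw [hm'] at hclosed' hopen'
    -- The degree of `d` splits as `[f = d] + k d.1`: the first part counts the paths that stop at
    -- `d`, the second those that continue through its link.
    have hmain : T d * (K * multisetFactorial m') =
        (∏ i, (seedDegree m' i).factorial) * seedDegree m d := by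
      have hdd : seedDegree m d = k d.1 + if f = d then 1 else 0 := by
        rw [h d, if_neg hed]; omega
      have h1 : (if d = f then Nat.card (MultiloopWith o m') else 0) *
          (K * multisetFactorial m') =
          (∏ i, (seedDegree m' i).factorial) * if f = d then 1 else 0 := by
        by_cases hdf : d = f
        · subst hdf
          have hk : ∀ i, seedDegree m' i = k i.1 := fun i => by have := hdeg' i; omega
          rw [if_pos rfl, if_pos rfl, mul_left_comm, hclosed' k hk, Finset.prod_congr rfl
            fun i _ => congrArg Nat.factorial (hk i), prod_factorial_link, mul_one]
        · rw [if_neg hdf, if_neg (Ne.symm hdf), zero_mul, mul_zero]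
      have h2 : Nat.card (OpenMultiloopWith o m' d.other f) * (K * multisetFactorial m') =
          (∏ i, (seedDegree m' i).factorial) * k d.1 := by
        have hod : d.other ≠ d := by
          intro hx
          have := congrArg Prod.snd hx
          simp [Seed.other] at this
        -- With no passage left through the link of `d` the path cannot continue; otherwise one
        -- passage is used up and the hypothesis applies to `k` lowered by one on that link.
        rcases Nat.eq_zero_or_pos (k d.1) with hk | hk
        · have hfd : f = d := by
            by_contra hfd
            have := hdeg' d
            rw [if_pos rfl, if_neg hfd, hk] at this
            omega
          have hz : seedDegree m' d.other = 0 := by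
            have := hdeg' d.other
            rw [hfd, show d.other.1 = d.1 from rfl, hk] at this
            omega
          have := isEmpty_openMultiloopWith o f hz
          rw [Nat.card_of_isEmpty, hk, zero_mul, mul_zero]
        · have := hopen' (fun x => k x - if d.1 = x then 1 else 0) d.other f (fun i => by
            have hi := hdeg' i
            have hx : (if d.1 = i.1 then 1 else 0) =
                (if d = i then 1 else 0) + if d.other = i then 1 else 0 := by
              obtain ⟨ℓ, b⟩ := d
              obtain ⟨ℓ', b'⟩ := i
              by_cases hl : ℓ = ℓ' <;> cases b <;> cases b' <;> simp [Seed.other, hl]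
            have hle : (if d.1 = i.1 then 1 else 0) ≤ k i.1 := by
              split_ifs with hl
              · rw [← hl]; exact hk
              · exact Nat.zero_le _
            omega)
          rw [← this, hK, prod_factorial_update_pred k hk]
          ring
      rw [hdd, mul_add, add_comm, ← h1, ← h2, ← add_mul]
      simp only [hT, hm']
    rw [multisetFactorial_erase hp, hm']
    have hP : ∏ i, (seedDegree m i).factorial = (seedDegree m e * seedDegree m d) *
        ∏ i, (seedDegree m' i).factorial := by
      rw [hmm]; exact prod_factorial_seedDegree_cons e d hed m'
    rw [hP]
    linear_combination (m.count s(e, d) * seedDegree m e) * hmain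
  have hpos : 0 < seedDegree m e := by rw [h e, if_pos rfl]; omega
  refine Nat.eq_of_mul_eq_mul_right hpos ?_
  rw [hcard, Finset.sum_mul, Finset.sum_mul, Finset.sum_congr rfl fun d _ => hterm d,
    ← Finset.sum_mul, sum_count_eq_seedDegree hm, mul_comm]

/-- The open count for `m` follows from both counts for fewer wedges. The closed count for the same
`m` then follows from the open one, by opening all multiloops at a link that they traverse. -/
theorem card_multiloopWith_mul_aux {N L : Type*} [Fintype L] [DecidableEq L]
    {G : SeedGraph N L} (o : LoopOrientation G) (c : ℕ) :
    ∀ m : Multiset (Sym2 (Seed L)), m.card = c → (∀ p ∈ m, ¬ p.IsDiag) →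
      (∀ p ∈ m, (p.map G.node).IsDiag) →
      (∀ k : L → ℕ, (∀ i, seedDegree m i = k i.1) →
        Nat.card (MultiloopWith o m) * multisetFactorial m = ∏ ℓ, (k ℓ).factorial) ∧
      ∀ (k : L → ℕ) (e f : Seed L),
        (∀ i, seedDegree m i = k i.1 + (if e = i then 1 else 0) + if f = i then 1 else 0) →
        Nat.card (OpenMultiloopWith o m e f) * ((∏ ℓ, (k ℓ).factorial) * multisetFactorial m) =
          ∏ i, (seedDegree m i).factorial := by
  induction c using Nat.strong_induction_on with
  | _ c ih =>
    intro m hc hm hn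
    have ih' : ∀ p ∈ m, _ := fun p hp => ih (m.erase p).card
      (by rw [← hc]; exact Multiset.card_erase_lt_of_mem hp) (m.erase p) rfl
      (fun q hq => hm q (Multiset.mem_of_mem_erase hq))
      (fun q hq => hn q (Multiset.mem_of_mem_erase hq))
    have ho := card_openMultiloopWith_mul_of_forall o m hm (fun p hp => (ih' p hp).1)
      (fun p hp => (ih' p hp).2)
    refine ⟨fun k hk => ?_, ho⟩
    by_cases hk0 : ∀ ℓ, k ℓ = 0
    · have : m = 0 := by
        rw [Multiset.eq_zero_iff_forall_notMem]
        intro p hp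
        induction p using Sym2.ind with
        | _ a b =>
          have := seedDegree_pos_of_mem hp
          rw [hk, hk0] at this
          exact lt_irrefl _ this
      subst this
      rw [multiloopWith_zero]
      simp [multisetFactorial, hk0]
    · push Not at hk0
      obtain ⟨ℓ, hℓ⟩ := hk0
      have hℓ' : 0 < k ℓ := Nat.pos_of_ne_zero hℓ
      have h1 := card_openMultiloopWith_link o hm hn ℓ
      -- The two ends of the opened path take over one quantum at each seed of `ℓ`, so the spin of
      -- `ℓ` drops by one passage.
      have h2 := ho (fun x => k x - if ℓ = x then 1 else 0) (ℓ, true) (ℓ, false) (fun i => by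
        have hi := hk i
        have hx : (if ℓ = i.1 then 1 else 0) =
            (if ((ℓ, true) : Seed L) = i then 1 else 0) +
              if ((ℓ, false) : Seed L) = i then 1 else 0 := by
          obtain ⟨ℓ', b'⟩ := i
          by_cases hl : ℓ = ℓ' <;> cases b' <;> simp [hl]
        have hle : (if ℓ = i.1 then 1 else 0) ≤ k i.1 := by
          split_ifs with hl
          · rw [← hl]; exact hℓ'
          · exact Nat.zero_le _
        omega)
      rw [h1, hk, Finset.prod_congr rfl fun i _ => congrArg Nat.factorial (hk i),
        prod_factorial_link] at h2
      refine Nat.eq_of_mul_eq_mul_right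
        (Finset.prod_pos fun ℓ _ => Nat.factorial_pos (k ℓ) : 0 < ∏ ℓ, (k ℓ).factorial) ?_
      rw [← h2]
      conv_lhs => rw [prod_factorial_update_pred k hℓ']
      ring

/-- The number of multiloops with given unoriented wedges. -/
theorem card_multiloopWith_mul {N L : Type*} [Fintype L] [DecidableEq L]
    {G : SeedGraph N L} (o : LoopOrientation G) {m : Multiset (Sym2 (Seed L))}
    (hm : ∀ p ∈ m, ¬ p.IsDiag) (hn : ∀ p ∈ m, (p.map G.node).IsDiag) {k : L → ℕ}
    (hk : ∀ i, seedDegree m i = k i.1) :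
    Nat.card (MultiloopWith o m) * multisetFactorial m = ∏ ℓ, (k ℓ).factorial :=
  (card_multiloopWith_mul_aux o m.card m rfl hm hn).1 k hk

/-! ### Sums over multisets -/

/-- Choosing an occurrence of `p` in `m` gives the factor `m_p`, and `m_p / m! = 1 / (m - p)!`.
Pulling out one element is thus free when sums carry these weights. -/
theorem sum_sym_inv_multisetFactorial {β V : Type*} [Fintype β] [DecidableEq β]
    [AddCommGroup V] [Module ℂ V] (n : ℕ) (g : β → Multiset β → V) :
    ∑ m : Sym β (n + 1), (multisetFactorial m.1 : ℂ)⁻¹ •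
        (m.1.map fun p => g p (m.1.erase p)).sum =
      ∑ p, ∑ m : Sym β n, (multisetFactorial m.1 : ℂ)⁻¹ • g p m.1 := by
  have h1 : ∀ m : Sym β (n + 1), (multisetFactorial m.1 : ℂ)⁻¹ •
      (m.1.map fun p => g p (m.1.erase p)).sum =
      ∑ p, if p ∈ m.1 then
        (multisetFactorial (m.1.erase p) : ℂ)⁻¹ • g p (m.1.erase p) else 0 := by
    intro m
    rw [Finset.sum_multiset_map_count, Finset.smul_sum, ← Finset.sum_filter]
    have : Finset.univ.filter (fun p => p ∈ m.1) = m.1.toFinset := by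
      ext p; simp
    rw [this]
    refine Finset.sum_congr rfl fun p hp => ?_
    have hp' := Multiset.mem_toFinset.1 hp
    have hc : (m.1.count p : ℂ) ≠ 0 := by
      exact_mod_cast (Multiset.count_pos.2 hp').ne'
    have hmf : (multisetFactorial (m.1.erase p) : ℂ) ≠ 0 := by
      exact_mod_cast (multisetFactorial_pos _).ne'
    rw [multisetFactorial_erase hp', ← Nat.cast_smul_eq_nsmul ℂ, smul_smul]
    congr 1
    push_cast
    field_simp
  rw [Finset.sum_congr rfl fun m _ => h1 m, Finset.sum_comm]
  refine Finset.sum_congr rfl fun p _ => ?_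
  rw [← Finset.sum_filter]
  symm
  refine Finset.sum_bij (fun (m : Sym β n) _ => (p ::ₛ m)) ?_ ?_ ?_ ?_
  · intro m _
    simp
  · intro m _ m' _ h
    exact Sym.cons_inj_right _ _ _ |>.1 h
  · intro m hm
    have hm' : p ∈ m := (Finset.mem_filter.1 hm).2
    exact ⟨m.erase p hm', Finset.mem_univ _, Sym.cons_erase hm'⟩
  · intro m _
    have : (p ::ₛ m).1.erase p = m.1 := Multiset.erase_cons_head _ _
    rw [this]

/-- The multinomial theorem, by induction: every element of a multiset of size `n + 1` can be the
one pulled out. -/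
theorem sum_sym_prod {β R : Type*} [Fintype β] [DecidableEq β] [CommRing R] [Algebra ℂ R]
    (y : β → R) (n : ℕ) :
    ∑ m : Sym β n, (multisetFactorial m.1 : ℂ)⁻¹ • (m.1.map y).prod =
      (n.factorial : ℂ)⁻¹ • (∑ p, y p) ^ n := by
  induction n with
  | zero =>
    rw [Fintype.sum_unique, Multiset.card_eq_zero.1 (default : Sym β 0).2]
    simp [multisetFactorial]
  | succ n ih =>
    have h := sum_sym_inv_multisetFactorial n fun p m => y p * (m.map y).prod
    have h1 : ∀ m : Sym β (n + 1), (m.1.map fun p => y p * ((m.1.erase p).map y).prod).sum =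
        ((n : ℂ) + 1) • (m.1.map y).prod := by
      intro m
      rw [Multiset.map_congr rfl (fun p hp => by
        rw [Multiset.prod_map_erase hp] : ∀ p ∈ m.1, y p * ((m.1.erase p).map y).prod =
          (m.1.map y).prod), Multiset.map_const', Multiset.sum_replicate, m.2,
        ← Nat.cast_smul_eq_nsmul ℂ]
      push_cast; rfl
    simp only [h1, ← mul_smul_comm, ← Finset.mul_sum, ih] at h
    have hn : (n : ℂ) + 1 ≠ 0 := by exact_mod_cast Nat.succ_ne_zero n
    rw [← Finset.sum_mul, mul_smul_comm, ← pow_succ'] at h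
    simp only [smul_comm _ ((n : ℂ) + 1), ← Finset.smul_sum] at h
    rw [Nat.factorial_succ]
    push_cast
    rw [mul_inv, mul_smul, ← h, smul_smul, inv_mul_cancel₀ hn, one_smul]

theorem sum_sum_eq_two_smul_sum_sym2 {β V : Type*} [Fintype β] [DecidableEq β]
    [AddCommGroup V] [Module ℂ V] (g : Sym2 β → V) (hg : ∀ i, g s(i, i) = 0) :
    ∑ i, ∑ j, g s(i, j) = (2 : ℂ) • ∑ p, g p := by
  rw [← Fintype.sum_prod_type (fun x : β × β => g s(x.1, x.2)),
    ← Finset.sum_fiberwise Finset.univ (fun x : β × β => s(x.1, x.2)), Finset.smul_sum]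
  refine Finset.sum_congr rfl fun p _ => ?_
  induction p using Sym2.ind with
  | _ a b =>
    rw [Finset.sum_congr rfl fun x hx => congrArg g (Finset.mem_filter.1 hx).2,
      Finset.sum_const, ← Nat.cast_smul_eq_nsmul ℂ]
    by_cases hab : a = b
    · subst hab
      rw [hg, smul_zero, smul_zero]
    · have : Finset.univ.filter (fun x : β × β => s(x.1, x.2) = s(a, b)) =
          {(a, b), (b, a)} := by
        ext ⟨c, d⟩
        simp
      rw [this, Finset.card_pair (by simp [hab])]
      norm_num

/-! ### Sums over multiloops as sums over wedges -/

theorem sum_seedDegree {L : Type*} [Fintype L] [DecidableEq L] (m : Multiset (Sym2 (Seed L))) :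
    ∑ i, seedDegree m i = 2 * m.card := by
  induction m using Multiset.induction_on with
  | empty => simp [seedDegree_zero]
  | cons p m ih =>
    induction p using Sym2.ind with
    | _ a b =>
      simp only [seedDegree_cons, Finset.sum_add_distrib, ih, Finset.sum_ite_eq, Finset.mem_univ,
        if_true, Multiset.card_cons]
      ring

theorem isDiag_map_node_of_mem_multiloopWedges {N L : Type*} {G : SeedGraph N L}
    (o : LoopOrientation G) {Φ : Multiloop G} {p : Sym2 (Seed L)}
    (hp : p ∈ multiloopWedges o Φ) : (p.map G.node).IsDiag := by
  rw [multiloopWedges_eq_bind] at hp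
  obtain ⟨α, -, hα⟩ := Multiset.mem_bind.1 hp
  exact (cycle_chain_iff G _).1 (o.pick α).2.2.1 p hα

theorem node_eq_of_mem_wedges {N L : Type*} {G : SeedGraph N L}
    (o : LoopOrientation G) {Φ : Multiloop G} {w : Seed L × Seed L}
    (hw : w ∈ Φ.wedges o) : G.node w.1 = G.node w.2 := by
  have := isDiag_map_node_of_mem_multiloopWedges o (Φ := Φ) (p := s(w.1, w.2))
    (Multiset.mem_map_of_mem (fun w : Seed L × Seed L => s(w.1, w.2)) hw)
  simpa using this

theorem mem_multiloopsWithSpins {N L : Type*} [Fintype L] [DecidableEq L] {G : SeedGraph N L}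
    {k : L → ℕ} {Φ : Multiloop G} : Φ ∈ multiloopsWithSpins G k ↔ Φ.twiceSpin = k := by
  simp [multiloopsWithSpins]

theorem seedDegree_multiloopWedges_of_mem {N L : Type*} [Fintype L] [DecidableEq L]
    {G : SeedGraph N L} (o : LoopOrientation G) {k : L → ℕ} {Φ : Multiloop G}
    (hΦ : Φ ∈ multiloopsWithSpins G k) : seedDegree (multiloopWedges o Φ) = linkDegree k := by
  funext i
  rw [seedDegree_multiloopWedges, mem_multiloopsWithSpins.1 hΦ]
  rfl

theorem card_of_seedDegree {L : Type*} [Fintype L] [DecidableEq L] {k : L → ℕ}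
    {m : Multiset (Sym2 (Seed L))} (h : seedDegree m = linkDegree k) : m.card = ∑ ℓ, k ℓ := by
  have h1 := sum_seedDegree m
  rw [h, Fintype.sum_prod_type] at h1
  simp only [linkDegree, Fintype.sum_bool, ← two_mul, ← Finset.mul_sum] at h1
  omega

/-- The sum over the multisets of wedges, weighted by the reciprocals of their symmetry factors,
restricted to a spin configuration, is a sum over multiloops. -/
theorem seedComponent_sum_sym {N L : Type*} [Fintype L] [DecidableEq L] {G : SeedGraph N L}
    (o : LoopOrientation G) (k : L → ℕ)
    (t : Multiset (Sym2 (Seed L)) → MvPolynomial (Mode L) ℂ)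
    (ht : ∀ m, (t m).IsWeightedHomogeneous seedWeight (seedDegree m))
    (ht0 : ∀ m, ∀ p ∈ m, p.IsDiag ∨ ¬ (p.map G.node).IsDiag → t m = 0) :
    seedComponent (linkDegree k)
        (∑ m : Sym (Sym2 (Seed L)) (∑ ℓ, k ℓ), (multisetFactorial m.1 : ℂ)⁻¹ • t m.1) =
      (∏ ℓ, ((k ℓ).factorial : ℂ))⁻¹ •
        ∑ Φ ∈ multiloopsWithSpins G k, t (multiloopWedges o Φ) := by
  have h1 : ∑ Φ ∈ multiloopsWithSpins G k, t (multiloopWedges o Φ) =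
      ∑ m : Sym (Sym2 (Seed L)) (∑ ℓ, k ℓ), ∑ Φ ∈ multiloopsWithSpins G k,
        if multiloopWedges o Φ = m.1 then t m.1 else 0 := by
    rw [Finset.sum_comm]
    refine Finset.sum_congr rfl fun Φ hΦ => ?_
    have hc := card_of_seedDegree (seedDegree_multiloopWedges_of_mem o hΦ)
    rw [Finset.sum_eq_single ⟨multiloopWedges o Φ, hc⟩]
    · rw [if_pos rfl]
    · intro m _ hm
      rw [if_neg fun h => hm (Subtype.ext h.symm)]
    · intro h
      exact absurd (Finset.mem_univ _) h
  rw [h1, map_sum, Finset.smul_sum]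
  refine Finset.sum_congr rfl fun m _ => ?_
  rw [map_smul]
  by_cases hbad : ∃ p ∈ m.1, p.IsDiag ∨ ¬ (p.map G.node).IsDiag
  · obtain ⟨p, hp, hp'⟩ := hbad
    rw [ht0 m.1 p hp hp']
    simp only [ite_self, smul_zero, map_zero, Finset.sum_const_zero]
  have hm : ∀ p ∈ m.1, ¬ p.IsDiag := fun p hp h => hbad ⟨p, hp, Or.inl h⟩
  have hn : ∀ p ∈ m.1, (p.map G.node).IsDiag := fun p hp => by
    by_contra h
    exact hbad ⟨p, hp, Or.inr h⟩
  by_cases hdeg : seedDegree m.1 = linkDegree k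
  · rw [seedComponent_eq_self (hdeg ▸ ht m.1), ← Finset.sum_filter, Finset.sum_const,
      ← Nat.cast_smul_eq_nsmul ℂ, smul_smul]
    congr 1
    -- The counting theorem enters here: the number of multiloops over `m` converts the symmetry
    -- factor of `m` into the product of spin factorials.
    have hcard := card_multiloopWith_mul o hm hn (k := k) fun i => congrFun hdeg i
    have hN : Nat.card (MultiloopWith o m.1) =
        ((multiloopsWithSpins G k).filter fun Φ => multiloopWedges o Φ = m.1).card := by
      rw [← Nat.card_eq_finsetCard]
      refine Nat.card_congr (Equiv.subtypeEquivRight fun Φ => ?_)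
      rw [Finset.mem_filter, mem_multiloopsWithSpins]
      refine ⟨fun h => ⟨?_, h⟩, fun h => h.2⟩
      funext ℓ
      have := seedDegree_multiloopWedges o Φ (ℓ, false)
      rw [h, hdeg] at this
      exact this.symm
    rw [← hN]
    have h2 : (multisetFactorial m.1 : ℂ) ≠ 0 := by exact_mod_cast (multisetFactorial_pos _).ne'
    have h3 : ∏ ℓ, ((k ℓ).factorial : ℂ) ≠ 0 :=
      Finset.prod_ne_zero_iff.2 fun ℓ _ => by exact_mod_cast Nat.factorial_ne_zero _
    have hcard' : (Nat.card (MultiloopWith o m.1) : ℂ) * multisetFactorial m.1 =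
        ∏ ℓ, ((k ℓ).factorial : ℂ) := by exact_mod_cast hcard
    field_simp
    rw [← hcard', mul_comm]
  · rw [seedComponent_eq_zero (ht m.1) (Ne.symm hdeg), smul_zero, Finset.sum_eq_zero, smul_zero]
    intro Φ hΦ
    rw [if_neg]
    intro h
    exact hdeg (h ▸ seedDegree_multiloopWedges_of_mem o hΦ)

/-! ### The terms of the squeezed vacuum as sums over multisets of wedges -/

theorem seedDegree_pair {L : Type*} [DecidableEq L] (a b : Seed L) :
    seedDegree {s(a, b)} = (Pi.single a 1 + Pi.single b 1 : Seed L → ℕ) := by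
  funext i
  rw [← Multiset.cons_zero, seedDegree_cons, seedDegree_zero, Pi.add_apply, Pi.single_apply,
    Pi.single_apply]
  simp only [eq_comm (a := i), add_zero]

/-- The contribution of a pair of seeds to the squeezing polynomial. -/
noncomputable def pairTerm {L : Type*} {γ : Matrix (Seed L) (Seed L) ℂ} (hγ : γᵀ = -γ) :
    Sym2 (Seed L) → MvPolynomial (Mode L) ℂ :=
  Sym2.lift ⟨fun i j => γ i j • bracket i j, fun i j => by
    have h : γ j i = -γ i j := congrFun (congrFun hγ i) j
    dsimp only
    rw [h, bracket_swap i j, neg_smul_neg]⟩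

theorem pairTerm_mk {L : Type*} {γ : Matrix (Seed L) (Seed L) ℂ} (hγ : γᵀ = -γ) (i j : Seed L) :
    pairTerm hγ s(i, j) = γ i j • bracket i j := rfl

theorem seedPoly_eq_sum_pairTerm {L : Type*} [Fintype L] [DecidableEq L]
    {γ : Matrix (Seed L) (Seed L) ℂ} (hγ : γᵀ = -γ) : seedPoly γ = ∑ p, pairTerm hγ p := by
  have h := sum_sum_eq_two_smul_sum_sym2 (pairTerm hγ) fun i => by
    rw [pairTerm_mk, bracket_self, smul_zero]
  simp only [pairTerm_mk] at h
  rw [seedPoly, h, smul_smul]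
  norm_num

theorem isWeightedHomogeneous_pairTerm {L : Type*} [DecidableEq L]
    {γ : Matrix (Seed L) (Seed L) ℂ} (hγ : γᵀ = -γ) (p : Sym2 (Seed L)) :
    (pairTerm hγ p).IsWeightedHomogeneous seedWeight (seedDegree {p}) := by
  induction p using Sym2.ind with
  | _ i j =>
    rw [pairTerm_mk, seedDegree_pair]
    exact Submodule.smul_mem (MvPolynomial.weightedHomogeneousSubmodule ℂ _ _) _
      (isWeightedHomogeneous_bracket i j)

theorem pairTerm_eq_zero {N L : Type*} {G : SeedGraph N L} {γ : Matrix (Seed L) (Seed L) ℂ}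
    (hγ : γᵀ = -γ) (hn : ∀ i j, G.node i ≠ G.node j → γ i j = 0) {p : Sym2 (Seed L)}
    (hp : p.IsDiag ∨ ¬ (p.map G.node).IsDiag) : pairTerm hγ p = 0 := by
  induction p using Sym2.ind with
  | _ i j =>
    rw [pairTerm_mk]
    rcases hp with hp | hp
    · obtain rfl : i = j := by simpa using hp
      rw [bracket_self, smul_zero]
    · rw [hn i j (by simpa using hp), zero_smul]

theorem isWeightedHomogeneous_prod_pairTerm {L : Type*} [DecidableEq L]
    {γ : Matrix (Seed L) (Seed L) ℂ} (hγ : γᵀ = -γ) (m : Multiset (Sym2 (Seed L))) :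
    (m.map (pairTerm hγ)).prod.IsWeightedHomogeneous seedWeight (seedDegree m) := by
  induction m using Multiset.induction_on with
  | empty => exact MvPolynomial.isWeightedHomogeneous_one _ _
  | cons p m ih =>
    have : seedDegree (p ::ₘ m) = seedDegree {p} + seedDegree m := by
      funext i
      rw [← Multiset.singleton_add, seedDegree_add, Pi.add_apply]
    rw [Multiset.map_cons, Multiset.prod_cons, this]
    exact (isWeightedHomogeneous_pairTerm hγ p).mul ih

theorem prod_pairTerm_eq_zero {N L : Type*} {G : SeedGraph N L}
    {γ : Matrix (Seed L) (Seed L) ℂ}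
    (hγ : γᵀ = -γ) (hn : ∀ i j, G.node i ≠ G.node j → γ i j = 0) {m : Multiset (Sym2 (Seed L))}
    {p : Sym2 (Seed L)} (hpm : p ∈ m) (hp : p.IsDiag ∨ ¬ (p.map G.node).IsDiag) :
    (m.map (pairTerm hγ)).prod = 0 :=
  Multiset.prod_eq_zero (Multiset.mem_map.2 ⟨p, hpm, pairTerm_eq_zero hγ hn hp⟩)

/-! ### Braidings of unoriented wedges -/

/-- The contribution of the braiding of two wedges. -/
noncomputable def braidedPair {N L : Type*} [DecidableEq N] (G : SeedGraph N L)
    (δ : Matrix (Seed L) (Seed L) ℂ) :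
    Sym2 (Seed L) → Sym2 (Seed L) → MvPolynomial (Mode L) ℂ :=
  Sym2.lift₂ ⟨fun i j k l => braidPair G δ (i, j) (k, l) •
      (wedgeCreation G (i, j) * wedgeCreation G (k, l)), fun i j k l => by
    constructor
    · by_cases h : G.node i = G.node j
      · have h1 : braidPair G δ (j, i) (k, l) = -braidPair G δ (i, j) (k, l) := by
          simp only [braidPair, h, true_and]
          split_ifs <;> ring
        dsimp only
        rw [h1, wedgeCreation_eq G (j, i), wedgeCreation_eq G (i, j), if_pos h, if_pos h.symm]
        dsimp only
        rw [bracket_swap i j, neg_mul, neg_smul_neg]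
      · dsimp only [braidPair]
        rw [if_neg fun h' => h h'.1, if_neg fun h' => h h'.1.symm,
          zero_smul, zero_smul]
    · by_cases h : G.node k = G.node l
      · have h1 : braidPair G δ (i, j) (l, k) = -braidPair G δ (i, j) (k, l) := by
          simp only [braidPair, h, true_and]
          split_ifs <;> ring
        dsimp only
        rw [h1, wedgeCreation_eq G (l, k), wedgeCreation_eq G (k, l), if_pos h, if_pos h.symm]
        dsimp only
        rw [bracket_swap k l, mul_neg, neg_smul_neg]
      · dsimp only [braidPair]
        rw [if_neg fun h' => h h'.2.1, if_neg fun h' => h h'.2.1.symm,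
          zero_smul, zero_smul]⟩

theorem braidedPair_mk {N L : Type*} [DecidableEq N] (G : SeedGraph N L)
    (δ : Matrix (Seed L) (Seed L) ℂ) (w v : Seed L × Seed L) :
    braidedPair G δ s(w.1, w.2) s(v.1, v.2) =
      braidPair G δ w v • (wedgeCreation G w * wedgeCreation G v) := rfl

theorem wedgeCreation_eq_zero {N L : Type*} [DecidableEq N] {G : SeedGraph N L}
    {w : Seed L × Seed L}
    (hw : s(w.1, w.2).IsDiag ∨ ¬ ((s(w.1, w.2) : Sym2 (Seed L)).map G.node).IsDiag) :
    wedgeCreation G w = 0 := by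
  rw [wedgeCreation_eq]
  rcases hw with hw | hw
  · obtain h : w.1 = w.2 := by simpa using hw
    rw [h, bracket_self, ite_self]
  · rw [if_neg (by simpa using hw)]

theorem braidedPair_eq_zero {N L : Type*} [DecidableEq N] {G : SeedGraph N L}
    (δ : Matrix (Seed L) (Seed L) ℂ) {p q : Sym2 (Seed L)}
    (h : (p.IsDiag ∨ ¬ (p.map G.node).IsDiag) ∨ (q.IsDiag ∨ ¬ (q.map G.node).IsDiag)) :
    braidedPair G δ p q = 0 := by
  induction p using Sym2.ind with
  | _ i j =>
    induction q using Sym2.ind with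
    | _ k l =>
      rw [braidedPair_mk G δ (i, j) (k, l)]
      rcases h with h | h
      · rw [wedgeCreation_eq_zero (w := (i, j)) h, zero_mul, smul_zero]
      · rw [wedgeCreation_eq_zero (w := (k, l)) h, mul_zero, smul_zero]

theorem isWeightedHomogeneous_braidedPair {N L : Type*} [DecidableEq N] [DecidableEq L]
    (G : SeedGraph N L) (δ : Matrix (Seed L) (Seed L) ℂ) (p q : Sym2 (Seed L)) :
    (braidedPair G δ p q).IsWeightedHomogeneous seedWeight
      (seedDegree {p} + seedDegree {q}) := by
  induction p using Sym2.ind with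
  | _ i j =>
    induction q using Sym2.ind with
    | _ k l =>
      rw [braidedPair_mk G δ (i, j) (k, l), seedDegree_pair, seedDegree_pair]
      exact Submodule.smul_mem (MvPolynomial.weightedHomogeneousSubmodule ℂ _ _) _
        ((isWeightedHomogeneous_wedgeCreation G (i, j)).mul
          (isWeightedHomogeneous_wedgeCreation G (k, l)))

/-- Each of the two wedges is met in both orientations with the same contribution, and degenerate
wedges contribute nothing. -/
theorem sum_braidPair_eq {N L : Type*} [Fintype L] [DecidableEq N] [DecidableEq L]
    (G : SeedGraph N L) (δ : Matrix (Seed L) (Seed L) ℂ) :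
    ∑ w, ∑ v, braidPair G δ w v • (wedgeCreation G w * wedgeCreation G v) =
      (4 : ℂ) • ∑ p, ∑ q, braidedPair G δ p q := by
  have h1 : ∀ p, ∑ v : Seed L × Seed L, braidedPair G δ p s(v.1, v.2) =
      (2 : ℂ) • ∑ q, braidedPair G δ p q := fun p => by
    rw [Fintype.sum_prod_type]
    exact sum_sum_eq_two_smul_sum_sym2 (braidedPair G δ p) fun i =>
      braidedPair_eq_zero δ (Or.inr (Or.inl (by simp)))
  have h2 := sum_sum_eq_two_smul_sum_sym2 (fun p => ∑ q, braidedPair G δ p q) fun i =>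
    Finset.sum_eq_zero fun q _ => braidedPair_eq_zero δ (Or.inl (Or.inl (by simp)))
  simp only [← braidedPair_mk, h1]
  rw [← Finset.smul_sum, Fintype.sum_prod_type, h2, smul_smul]
  norm_num

/-- The contribution of a multiset of wedges to the second order. -/
noncomputable def braidedTerm {N L : Type*} [DecidableEq N] [DecidableEq L] (G : SeedGraph N L)
    {γ : Matrix (Seed L) (Seed L) ℂ} (hγ : γᵀ = -γ) (δ : Matrix (Seed L) (Seed L) ℂ)
    (m : Multiset (Sym2 (Seed L))) : MvPolynomial (Mode L) ℂ :=
  (m.map fun p => ((m.erase p).map fun q =>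
    braidedPair G δ p q * (((m.erase p).erase q).map (pairTerm hγ)).prod).sum).sum

theorem isWeightedHomogeneous_braidedTerm {N L : Type*} [DecidableEq N] [DecidableEq L]
    (G : SeedGraph N L) {γ : Matrix (Seed L) (Seed L) ℂ} (hγ : γᵀ = -γ)
    (δ : Matrix (Seed L) (Seed L) ℂ) (m : Multiset (Sym2 (Seed L))) :
    (braidedTerm G hγ δ m).IsWeightedHomogeneous seedWeight (seedDegree m) := by
  rw [← MvPolynomial.mem_weightedHomogeneousSubmodule]
  refine multiset_sum_mem _ fun r hr => ?_
  obtain ⟨p, hp, rfl⟩ := Multiset.mem_map.1 hr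
  refine multiset_sum_mem _ fun r hr => ?_
  obtain ⟨q, hq, rfl⟩ := Multiset.mem_map.1 hr
  have : seedDegree m = seedDegree {p} + seedDegree {q} + seedDegree ((m.erase p).erase q) := by
    funext i
    conv_lhs => rw [← Multiset.cons_erase hp, ← Multiset.cons_erase hq]
    rw [← Multiset.singleton_add, seedDegree_add, ← Multiset.singleton_add, seedDegree_add,
      Pi.add_apply, Pi.add_apply, add_assoc]
  rw [this]
  exact (isWeightedHomogeneous_braidedPair G δ p q).mul
    (isWeightedHomogeneous_prod_pairTerm hγ _)

theorem braidedTerm_eq_zero {N L : Type*} [DecidableEq N] [DecidableEq L] {G : SeedGraph N L}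
    {γ : Matrix (Seed L) (Seed L) ℂ} (hγ : γᵀ = -γ)
    (hn : ∀ i j, G.node i ≠ G.node j → γ i j = 0) (δ : Matrix (Seed L) (Seed L) ℂ)
    {m : Multiset (Sym2 (Seed L))} {x : Sym2 (Seed L)} (hxm : x ∈ m)
    (hx : x.IsDiag ∨ ¬ (x.map G.node).IsDiag) : braidedTerm G hγ δ m = 0 := by
  refine Multiset.sum_eq_zero fun r hr => ?_
  obtain ⟨p, hp, rfl⟩ := Multiset.mem_map.1 hr
  refine Multiset.sum_eq_zero fun r hr => ?_
  obtain ⟨q, hq, rfl⟩ := Multiset.mem_map.1 hr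
  by_cases hxp : x = p
  · rw [braidedPair_eq_zero δ (Or.inl (hxp ▸ hx)), zero_mul]
  by_cases hxq : x = q
  · rw [braidedPair_eq_zero δ (Or.inr (hxq ▸ hx)), zero_mul]
  · rw [prod_pairTerm_eq_zero hγ hn
      ((Multiset.mem_erase_of_ne hxq).2 ((Multiset.mem_erase_of_ne hxp).2 hxm)) hx, mul_zero]

/-- The two braided wedges are pulled out one after the other; the remaining `n` wedges resum by the
multinomial theorem. -/
theorem sum_sym_braidedTerm {N L : Type*} [Fintype L] [DecidableEq N] [DecidableEq L]
    (G : SeedGraph N L) {γ : Matrix (Seed L) (Seed L) ℂ} (hγ : γᵀ = -γ)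
    (δ : Matrix (Seed L) (Seed L) ℂ) (n : ℕ) :
    ∑ m : Sym (Sym2 (Seed L)) (n + 2), (multisetFactorial m.1 : ℂ)⁻¹ • braidedTerm G hγ δ m.1 =
      ((n.factorial : ℂ)⁻¹ • seedPoly γ ^ n) * ∑ p, ∑ q, braidedPair G δ p q := by
  unfold braidedTerm
  rw [sum_sym_inv_multisetFactorial (n + 1) fun p m => (m.map fun q =>
    braidedPair G δ p q * ((m.erase q).map (pairTerm hγ)).prod).sum, Finset.mul_sum]
  refine Finset.sum_congr rfl fun p _ => ?_
  rw [sum_sym_inv_multisetFactorial n fun q m =>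
    braidedPair G δ p q * (m.map (pairTerm hγ)).prod, Finset.mul_sum]
  refine Finset.sum_congr rfl fun q _ => ?_
  simp only [← mul_smul_comm]
  rw [← Finset.mul_sum, sum_sym_prod, ← seedPoly_eq_sum_pairTerm, mul_comm]

theorem map_erase_sum {X Y V : Type*} [DecidableEq X] [DecidableEq Y] [AddCommMonoid V]
    (f : X → Y) (h : Y → Multiset Y → V) (W : Multiset X) :
    ((W.map f).map fun p => h p ((W.map f).erase p)).sum =
      (W.map fun w => h (f w) ((W.erase w).map f)).sum := by
  rw [Multiset.map_map]
  congr 1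
  refine Multiset.map_congr rfl fun w hw => ?_
  rw [Function.comp_apply, Multiset.map_erase_of_mem _ _ hw]

theorem prod_pairTerm_unorientedWedges {N L : Type*} [DecidableEq N] (G : SeedGraph N L)
    {γ : Matrix (Seed L) (Seed L) ℂ} (hγ : γᵀ = -γ) {W : Multiset (Seed L × Seed L)}
    (hW : ∀ w ∈ W, G.node w.1 = G.node w.2) :
    ((unorientedWedges W).map (pairTerm hγ)).prod =
      (W.map fun w => γ w.1 w.2).prod • wedgeProd G W := by
  induction W using Multiset.induction_on with
  | empty => simp [unorientedWedges, wedgeProd]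
  | cons w W ih =>
    have h := ih fun v hv => hW v (Multiset.mem_cons_of_mem hv)
    have hw := hW w (Multiset.mem_cons_self _ _)
    simp only [unorientedWedges, wedgeProd, Multiset.map_cons, Multiset.prod_cons] at h ⊢
    rw [h, pairTerm_mk, wedgeCreation_eq, if_pos hw, smul_mul_smul_comm]

theorem braidedTerm_unorientedWedges {N L : Type*} [DecidableEq N] [DecidableEq L]
    (G : SeedGraph N L) {γ : Matrix (Seed L) (Seed L) ℂ} (hγ : γᵀ = -γ)
    (δ : Matrix (Seed L) (Seed L) ℂ) {W : Multiset (Seed L × Seed L)}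
    (hW : ∀ w ∈ W, G.node w.1 = G.node w.2) :
    braidedTerm G hγ δ (unorientedWedges W) =
      (W.map fun w => ((W.erase w).map fun v => braidPair G δ w v *
        (((W.erase w).erase v).map fun u => γ u.1 u.2).prod).sum).sum • wedgeProd G W := by
  rw [braidedTerm, unorientedWedges, map_erase_sum (fun w : Seed L × Seed L => s(w.1, w.2))
    (fun p m => (m.map fun q => braidedPair G δ p q * ((m.erase q).map (pairTerm hγ)).prod).sum),
    Multiset.sum_smul, Multiset.map_map]
  congr 1
  refine Multiset.map_congr rfl fun w hw => ?_
  rw [map_erase_sum (fun w : Seed L × Seed L => s(w.1, w.2)) (fun q m =>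
    braidedPair G δ s(w.1, w.2) q * (m.map (pairTerm hγ)).prod), Function.comp_apply,
    Multiset.sum_smul, Multiset.map_map]
  congr 1
  refine Multiset.map_congr rfl fun v hv => ?_
  have h := prod_pairTerm_unorientedWedges G hγ (W := (W.erase w).erase v) fun u hu =>
    hW u (Multiset.mem_of_mem_erase (Multiset.mem_of_mem_erase hu))
  rw [unorientedWedges] at h
  rw [h, braidedPair_mk, Function.comp_apply, smul_mul_smul_comm]
  congr 1
  rw [wedgeProd, wedgeProd, ← Multiset.prod_map_erase hw, ← Multiset.prod_map_erase hv, mul_assoc]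

theorem seedDegree_unorientedWedges {L : Type*} [DecidableEq L]
    (W : Multiset (Seed L × Seed L)) : seedDegree (unorientedWedges W) = wedgeDegree W := by
  induction W using Multiset.induction_on with
  | empty => rfl
  | cons w W ih =>
    funext i
    have h1 : unorientedWedges (w ::ₘ W) = {s(w.1, w.2)} + unorientedWedges W := by
      simp [unorientedWedges]
    have h2 : wedgeDegree (w ::ₘ W) =
        (Pi.single w.1 1 + Pi.single w.2 1 : Seed L → ℕ) + wedgeDegree W := by
      simp [wedgeDegree]
    rw [h1, h2, seedDegree_add, seedDegree_pair, ih]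
    rfl

theorem wedgeCreation_swap {N L : Type*} [DecidableEq N] (G : SeedGraph N L) (i j : Seed L) :
    wedgeCreation G (j, i) = -wedgeCreation G (i, j) := by
  rw [wedgeCreation_eq, wedgeCreation_eq]
  dsimp only
  rw [bracket_swap i j]
  by_cases h : G.node i = G.node j
  · rw [if_pos h, if_pos h.symm]
  · rw [if_neg h, if_neg (Ne.symm h), neg_zero]

/-- Products of wedge operators depend on the orientations of the wedges only by a factor. -/
theorem exists_wedgeProd_eq_smul {N L : Type*} [DecidableEq N] [DecidableEq L]
    (G : SeedGraph N L) (W W' : Multiset (Seed L × Seed L))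
    (h : unorientedWedges W = unorientedWedges W') :
    ∃ c : ℂ, wedgeProd G W = c • wedgeProd G W' := by
  induction W using Multiset.induction_on generalizing W' with
  | empty =>
    have : W' = 0 := by
      rw [unorientedWedges, unorientedWedges, Multiset.map_zero] at h
      exact Multiset.map_eq_zero.1 h.symm
    exact ⟨1, by rw [this, one_smul]⟩
  | cons w W ih =>
    have hmem : s(w.1, w.2) ∈ unorientedWedges W' := by
      rw [← h, unorientedWedges, Multiset.map_cons]
      exact Multiset.mem_cons_self _ _
    obtain ⟨w', hw', hs⟩ := Multiset.mem_map.1 hmem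
    obtain ⟨W'', rfl⟩ := Multiset.exists_cons_of_mem hw'
    have h' : unorientedWedges W = unorientedWedges W'' := by
      rw [unorientedWedges, unorientedWedges, Multiset.map_cons, Multiset.map_cons, hs] at h
      exact (Multiset.cons_inj_right _).1 h
    obtain ⟨c, hc⟩ := ih W'' h'
    have h1 : ∃ c' : ℂ, wedgeCreation G w = c' • wedgeCreation G w' := by
      obtain ⟨i, j⟩ := w
      obtain ⟨i', j'⟩ := w'
      rcases Sym2.eq_iff.1 hs with ⟨h1, h2⟩ | ⟨h1, h2⟩
      · dsimp only at h1 h2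
        exact ⟨1, by rw [h1, h2, one_smul]⟩
      · dsimp only at h1 h2
        exact ⟨-1, by rw [h1, h2, wedgeCreation_swap G j i, neg_one_smul]⟩
    obtain ⟨c', hc'⟩ := h1
    refine ⟨c' * c, ?_⟩
    rw [wedgeProd, wedgeProd, Multiset.map_cons, Multiset.map_cons, Multiset.prod_cons,
      Multiset.prod_cons, hc', ← wedgeProd, hc, smul_mul_smul_comm]
    rfl

/-- The resummation over multiloops is applied to a function supported on the single multiset of
wedges of `W`. It expresses a nonzero multiple of the product through multiloops with these wedges,
whose own products differ only by scalars. -/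
theorem wedgeProd_mem_span_multiloops {N L : Type*} [Fintype L] [DecidableEq N] [DecidableEq L]
    {G : SeedGraph N L} (o : LoopOrientation G) {k : L → ℕ} {W : Multiset (Seed L × Seed L)}
    (hW : wedgeDegree W = linkDegree k) :
    wedgeProd G W ∈ Submodule.span ℂ
      ((fun Φ : Multiloop G => wedgeProd G (Φ.wedges o)) '' (multiloopsWithSpins G k)) := by
  have hW' : seedDegree (unorientedWedges W) = linkDegree k :=
    (seedDegree_unorientedWedges W).trans hW
  have h := seedComponent_sum_sym o k
    (fun m => if m = unorientedWedges W then wedgeProd G W else 0) (fun m => by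
      split_ifs with hm
      · rw [hm, seedDegree_unorientedWedges]
        exact isWeightedHomogeneous_wedgeProd G W
      · exact MvPolynomial.isWeightedHomogeneous_zero _ _ _) (fun m p hp hbad => by
      split_ifs with hm
      · subst hm
        obtain ⟨w, hw, rfl⟩ := Multiset.mem_map.1 hp
        exact Multiset.prod_eq_zero (Multiset.mem_map.2 ⟨w, hw, wedgeCreation_eq_zero hbad⟩)
      · rfl)
  have hsum : ∑ m : Sym (Sym2 (Seed L)) (∑ ℓ, k ℓ), (multisetFactorial m.1 : ℂ)⁻¹ •
      (if m.1 = unorientedWedges W then wedgeProd G W else 0) =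
      (multisetFactorial (unorientedWedges W) : ℂ)⁻¹ • wedgeProd G W := by
    rw [Finset.sum_eq_single ⟨unorientedWedges W, card_of_seedDegree hW'⟩]
    · rw [if_pos rfl]
    · intro m _ hm
      rw [if_neg fun h => hm (Subtype.ext h), smul_zero]
    · intro h
      exact absurd (Finset.mem_univ _) h
  rw [hsum, map_smul, seedComponent_eq_self (hW ▸ isWeightedHomogeneous_wedgeProd G W)] at h
  have hne : (multisetFactorial (unorientedWedges W) : ℂ) ≠ 0 := by
    exact_mod_cast (multisetFactorial_pos _).ne'
  rw [inv_smul_eq_iff₀ hne] at h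
  rw [h]
  refine Submodule.smul_mem _ _ (Submodule.smul_mem _ _ (Submodule.sum_mem _ fun Φ hΦ => ?_))
  split_ifs with hm
  · obtain ⟨c, hc⟩ := exists_wedgeProd_eq_smul G W (Φ.wedges o) hm.symm
    rw [hc]
    exact Submodule.smul_mem _ _ (Submodule.subset_span ⟨Φ, hΦ, rfl⟩)
  · exact Submodule.zero_mem _

theorem projectedState_wedgeProd {N L : Type*} [Fintype L] [DecidableEq N] [DecidableEq L]
    {G : SeedGraph N L} (o : LoopOrientation G) (Φ : Multiloop G) :
    projectedState G (wedgeProd G (Φ.wedges o)) = multiloopState o Φ := by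
  refine projectedState_eq_fockVector G (fun ℓ => ?_) fun n a => nodeConstraint_wedgeProd G _ n a
  have h : wedgeDegree (Φ.wedges o) = linkDegree Φ.twiceSpin := by
    rw [← seedDegree_unorientedWedges]
    exact seedDegree_multiloopWedges_of_mem o (mem_multiloopsWithSpins.2 rfl)
  rw [linkConstraint_of_isWeightedHomogeneous (isWeightedHomogeneous_wedgeProd G _), h]
  simp [linkDegree]

/-- The projections of the states of given spins are combinations of multiloop states. -/
theorem exists_projectedState_eq_sum {N L : Type*} [Fintype L] [DecidableEq N] [DecidableEq L]
    {G : SeedGraph N L} (o : LoopOrientation G) (k : L → ℕ) (p : MvPolynomial (Mode L) ℂ) :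
    ∃ c : Multiloop G → ℂ, projectedState G (seedComponent (linkDegree k) p) =
      ∑ Φ ∈ multiloopsWithSpins G k, c Φ • multiloopState o Φ := by
  have hp : (seedComponent (linkDegree k) p).IsWeightedHomogeneous seedWeight (linkDegree k) :=
    MvPolynomial.weightedHomogeneousComponent_isWeightedHomogeneous _ _
  obtain ⟨a, ha, b, hb, hab⟩ := Submodule.mem_sup.1 (mem_nodeRange_sup_wedgeSpan G hp)
  rw [← hab, map_add, projectedState_of_mem_nodeRange G ha, zero_add]
  have hle : wedgeSpan G (linkDegree k) ≤ Submodule.span ℂ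
      ((fun Φ : Multiloop G => wedgeProd G (Φ.wedges o)) '' (multiloopsWithSpins G k)) := by
    refine Submodule.span_le.2 ?_
    rintro _ ⟨W, hW, rfl⟩
    exact wedgeProd_mem_span_multiloops o hW
  obtain ⟨c, hc⟩ := (Submodule.mem_span_image_finset_iff_exists_fun' ℂ).1 (hle hb)
  refine ⟨c, ?_⟩
  rw [← hc, map_sum]
  simp only [map_smul, projectedState_wedgeProd]

/-! ### The expansion in powers of the coupling between distinct nodes -/

/-- The coefficient of order `b` in `ε` of the term of degree `M` of the series of the squeezed
vacuum with squeezing matrix `γ + ε δ`. -/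
noncomputable def orderTerm {L : Type*} [Fintype L] (γ δ : Matrix (Seed L) (Seed L) ℂ)
    (M b : ℕ) : MvPolynomial (Mode L) ℂ :=
  if b ≤ M then (((M - b).factorial : ℂ)⁻¹ • seedPoly γ ^ (M - b)) *
    ((b.factorial : ℂ)⁻¹ • seedPoly δ ^ b) else 0

theorem squeezedPoly_spinorSqueezing_add_smul {L : Type*} [Fintype L]
    (γ δ : Matrix (Seed L) (Seed L) ℂ) (ε : ℂ) (M : ℕ) :
    squeezedPoly (spinorSqueezing (γ + ε • δ)) M =
      orderTerm γ δ M 0 + ε • orderTerm γ δ M 1 + ε ^ 2 • orderTerm γ δ M 2 +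
        ∑ b ∈ Finset.range M, ε ^ (b + 3) • orderTerm γ δ M (b + 3) := by
  have h1 : squeezedPoly (spinorSqueezing (γ + ε • δ)) M =
      ∑ b ∈ Finset.range (M + 1), ε ^ b • orderTerm γ δ M b := by
    rw [squeezedPoly, squeezingPoly_spinorSqueezing, seedPoly_add_smul, add_comm (seedPoly γ),
      add_pow, Finset.smul_sum]
    refine Finset.sum_congr rfl fun b hb => ?_
    have hbM : b ≤ M := Nat.lt_succ_iff.1 (Finset.mem_range.1 hb)
    have h2 : (M.choose b : ℂ) = M.factorial / (b.factorial * (M - b).factorial) :=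
      Nat.cast_choose ℂ hbM
    have h3 : (M.factorial : ℂ) ≠ 0 := by exact_mod_cast Nat.factorial_ne_zero M
    rw [orderTerm, if_pos hbM, smul_pow, smul_mul_smul_comm, ← nsmul_eq_mul',
      ← Nat.cast_smul_eq_nsmul ℂ, h2, smul_mul_assoc, smul_smul, smul_smul, smul_smul,
      mul_comm (seedPoly δ ^ b)]
    congr 1
    field_simp
  -- Two vanishing orders are appended so that the first three can be split off for every `M`, even
  -- when `M < 2`.
  have h2 : ∑ b ∈ Finset.range (M + 1), ε ^ b • orderTerm γ δ M b =
      ∑ b ∈ Finset.range (M + 3), ε ^ b • orderTerm γ δ M b := by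
    refine Finset.sum_subset (Finset.range_mono (by omega)) fun b _ hb => ?_
    rw [orderTerm, if_neg (by simpa using hb), smul_zero]
  rw [h1, h2, Finset.sum_range_succ', Finset.sum_range_succ', Finset.sum_range_succ']
  simp only [zero_add, pow_zero, pow_one, one_smul]
  ring_nf

theorem seedComponent_orderTerm_zero {N L : Type*} [Fintype L] [DecidableEq L]
    {G : SeedGraph N L} (o : LoopOrientation G) {γ : Matrix (Seed L) (Seed L) ℂ} (hγ : γᵀ = -γ)
    (hn : ∀ i j, G.node i ≠ G.node j → γ i j = 0) (δ : Matrix (Seed L) (Seed L) ℂ) (k : L → ℕ) :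
    seedComponent (linkDegree k) (orderTerm γ δ (∑ ℓ, k ℓ) 0) =
      (∏ ℓ, ((k ℓ).factorial : ℂ))⁻¹ • ∑ Φ ∈ multiloopsWithSpins G k,
        ((multiloopWedges o Φ).map (pairTerm hγ)).prod := by
  rw [← seedComponent_sum_sym o k (fun m => (m.map (pairTerm hγ)).prod)
    (isWeightedHomogeneous_prod_pairTerm hγ) (fun m p hpm hp => prod_pairTerm_eq_zero hγ hn hpm hp),
    sum_sym_prod, ← seedPoly_eq_sum_pairTerm, orderTerm, if_pos (Nat.zero_le _)]
  simp

theorem nodeConstraint_smul_seedPoly_pow {N L : Type*} [Fintype L] [DecidableEq N]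
    (G : SeedGraph N L) {γ : Matrix (Seed L) (Seed L) ℂ}
    (hn : ∀ i j, G.node i ≠ G.node j → γ i j = 0) (c : ℂ) (m : ℕ) (n : N) (a : Fin 3) :
    nodeConstraint G n a (c • seedPoly γ ^ m) = 0 := by
  rw [map_smul, nodeConstraint_pow G (nodeConstraint_seedPoly G hn n a), smul_zero]

/-- A single bracket between distinct nodes lies in the range, and the invariant power of `seedPoly
γ` keeps it there. -/
theorem projectedState_orderTerm_one {N L : Type*} [Fintype L] [DecidableEq N] [DecidableEq L]
    (G : SeedGraph N L) {γ δ : Matrix (Seed L) (Seed L) ℂ}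
    (hn : ∀ i j, G.node i ≠ G.node j → γ i j = 0) (hδ : ∀ i j, G.node i = G.node j → δ i j = 0)
    (d : Seed L → ℕ) (M : ℕ) :
    projectedState G (seedComponent d (orderTerm γ δ M 1)) = 0 := by
  refine projectedState_of_mem_nodeRange G (seedComponent_mem_nodeRange G d ?_)
  unfold orderTerm
  split_ifs
  · refine mul_mem_nodeRange G (nodeConstraint_smul_seedPoly_pow G hn _ _) ?_
    rw [pow_one]
    exact Submodule.smul_mem _ _ (seedPoly_mem_nodeRange G hδ)
  · exact Submodule.zero_mem _

theorem braidedTerm_eq_zero_of_card_lt {N L : Type*} [DecidableEq N] [DecidableEq L]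
    (G : SeedGraph N L) {γ : Matrix (Seed L) (Seed L) ℂ} (hγ : γᵀ = -γ)
    (δ : Matrix (Seed L) (Seed L) ℂ) {m : Multiset (Sym2 (Seed L))} (hm : m.card < 2) :
    braidedTerm G hγ δ m = 0 := by
  refine Multiset.sum_eq_zero fun r hr => ?_
  obtain ⟨p, hp, rfl⟩ := Multiset.mem_map.1 hr
  have : m.erase p = 0 := by
    rw [← Multiset.card_eq_zero, Multiset.card_erase_of_mem hp, Nat.pred_eq_sub_one]
    omega
  rw [this, Multiset.map_zero, Multiset.sum_zero]

/-- The factor `¼` is `1/16`, from the reduction of the square, times `4`, from passing to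
unoriented wedges. It later matches `½ B`, since `B` carries its own `½` for ordered pairs. -/
theorem projectedState_orderTerm_two {N L : Type*} [Fintype L] [DecidableEq N] [DecidableEq L]
    {G : SeedGraph N L} (o : LoopOrientation G) {γ δ : Matrix (Seed L) (Seed L) ℂ}
    (hγ : γᵀ = -γ) (hδ' : δᵀ = -δ)
    (hn : ∀ i j, G.node i ≠ G.node j → γ i j = 0) (hδ : ∀ i j, G.node i = G.node j → δ i j = 0)
    (k : L → ℕ) :
    projectedState G (seedComponent (linkDegree k) (orderTerm γ δ (∑ ℓ, k ℓ) 2)) =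
      (∏ ℓ, ((k ℓ).factorial : ℂ))⁻¹ • ∑ Φ ∈ multiloopsWithSpins G k,
        projectedState G ((1 / 4 : ℂ) • braidedTerm G hγ δ (multiloopWedges o Φ)) := by
  -- With fewer than two wedges there is neither a second order nor a pair to braid.
  rcases Nat.lt_or_ge (∑ ℓ, k ℓ) 2 with hM | hM
  · rw [orderTerm, if_neg (by omega), map_zero, map_zero, Finset.sum_eq_zero, smul_zero]
    intro Φ hΦ
    rw [braidedTerm_eq_zero_of_card_lt G hγ δ, smul_zero, map_zero]
    rwa [card_of_seedDegree (seedDegree_multiloopWedges_of_mem o hΦ)]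
  · obtain ⟨n, hM⟩ := Nat.exists_eq_add_of_le' hM
    have h1 := mul_mem_nodeRange G (nodeConstraint_smul_seedPoly_pow G hn (n.factorial : ℂ)⁻¹ n)
      (half_seedPoly_sq_sub_mem G hδ' hδ)
    have h2 := sum_sym_braidedTerm G hγ δ n
    rw [mul_sub, sum_braidPair_eq, smul_smul, mul_smul_comm (_ * _ : ℂ), ← h2] at h1
    have h3 := projectedState_of_mem_nodeRange G (seedComponent_mem_nodeRange G (linkDegree k) h1)
    rw [map_sub, map_sub, sub_eq_zero] at h3
    have h4 : orderTerm γ δ (∑ ℓ, k ℓ) 2 =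
        ((n.factorial : ℂ)⁻¹ • seedPoly γ ^ n) * ((1 / 2 : ℂ) • seedPoly δ ^ 2) := by
      rw [orderTerm, if_pos (by omega), hM, Nat.add_sub_cancel]
      norm_num
    rw [h4, h3, ← hM, map_smul, seedComponent_sum_sym o k (braidedTerm G hγ δ)
      (isWeightedHomogeneous_braidedTerm G hγ δ)
      (fun m p hpm hp => braidedTerm_eq_zero hγ hn δ hpm hp)]
    simp only [map_smul, map_sum, ← Finset.smul_sum]
    rw [smul_comm]
    norm_num

theorem multiloopWeight_add_smul {N L : Type*} {G : SeedGraph N L} (o : LoopOrientation G)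
    (γ : Matrix (Seed L) (Seed L) ℂ) {δ : Matrix (Seed L) (Seed L) ℂ}
    (hδ : ∀ i j, G.node i = G.node j → δ i j = 0) (ε : ℂ) (Φ : Multiloop G) :
    multiloopWeight o (γ + ε • δ) Φ = multiloopWeight o γ Φ := by
  unfold multiloopWeight
  congr 1
  refine Multiset.map_congr rfl fun w hw => ?_
  rw [Matrix.add_apply, Matrix.smul_apply, hδ _ _ (node_eq_of_mem_wedges o hw), smul_zero,
    add_zero]

/-- Braiding replaces matrix elements inside nodes by elements between distinct nodes, which see
only the perturbation, so it is exactly quadratic in `ε`. -/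
theorem braidPair_add_smul {N L : Type*} [DecidableEq N] (G : SeedGraph N L)
    {γ : Matrix (Seed L) (Seed L) ℂ} (hn : ∀ i j, G.node i ≠ G.node j → γ i j = 0)
    (δ : Matrix (Seed L) (Seed L) ℂ) (ε : ℂ) (w v : Seed L × Seed L) :
    braidPair G (γ + ε • δ) w v = ε ^ 2 * braidPair G δ w v := by
  unfold braidPair
  split_ifs with h
  · obtain ⟨h1, h2, h3⟩ := h
    simp only [Matrix.add_apply, Matrix.smul_apply, smul_eq_mul]
    rw [hn w.1 v.1 h3, hn w.2 v.2 (by rwa [← h1, ← h2]), hn w.1 v.2 (by rwa [← h2]),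
      hn w.2 v.1 (by rwa [← h1])]
    ring
  · rw [mul_zero]

theorem multiloopBraiding_add_smul {N L : Type*} [DecidableEq N] [DecidableEq L]
    {G : SeedGraph N L} (o : LoopOrientation G) {γ δ : Matrix (Seed L) (Seed L) ℂ}
    (hn : ∀ i j, G.node i ≠ G.node j → γ i j = 0) (hδ : ∀ i j, G.node i = G.node j → δ i j = 0)
    (ε : ℂ) (Φ : Multiloop G) :
    multiloopBraiding o (γ + ε • δ) Φ = (1 / 2) * (ε ^ 2 *
      ((Φ.wedges o).map fun w => (((Φ.wedges o).erase w).map fun v => braidPair G δ w v *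
        ((((Φ.wedges o).erase w).erase v).map fun u => γ u.1 u.2).prod).sum).sum) := by
  rw [multiloopBraiding, braidMonomial]
  congr 1
  rw [← Multiset.sum_map_mul_left]
  congr 1
  refine Multiset.map_congr rfl fun w _ => ?_
  rw [← Multiset.sum_map_mul_left]
  congr 1
  refine Multiset.map_congr rfl fun v _ => ?_
  rw [braidPair_add_smul G hn, mul_assoc]
  congr 3
  refine Multiset.map_congr rfl fun u hu => ?_
  have hu' := Multiset.mem_of_mem_erase (Multiset.mem_of_mem_erase hu)
  rw [Matrix.add_apply, Matrix.smul_apply, hδ _ _ (node_eq_of_mem_wedges o hu'), smul_zero,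
    add_zero]

theorem projectedState_prod_pairTerm {N L : Type*} [Fintype L] [DecidableEq N] [DecidableEq L]
    {G : SeedGraph N L} (o : LoopOrientation G) {γ : Matrix (Seed L) (Seed L) ℂ} (hγ : γᵀ = -γ)
    (Φ : Multiloop G) :
    projectedState G ((multiloopWedges o Φ).map (pairTerm hγ)).prod =
      multiloopWeight o γ Φ • multiloopState o Φ := by
  rw [multiloopWedges, prod_pairTerm_unorientedWedges G hγ fun w hw => node_eq_of_mem_wedges o hw,
    map_smul, projectedState_wedgeProd]
  rfl

theorem projectedState_braidedTerm {N L : Type*} [Fintype L] [DecidableEq N] [DecidableEq L]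
    {G : SeedGraph N L} (o : LoopOrientation G) {γ δ : Matrix (Seed L) (Seed L) ℂ}
    (hγ : γᵀ = -γ) (hn : ∀ i j, G.node i ≠ G.node j → γ i j = 0)
    (hδ : ∀ i j, G.node i = G.node j → δ i j = 0) (ε : ℂ) (Φ : Multiloop G) :
    ε ^ 2 • projectedState G ((1 / 4 : ℂ) • braidedTerm G hγ δ (multiloopWedges o Φ)) =
      ((1 / 2) * multiloopBraiding o (γ + ε • δ) Φ) • multiloopState o Φ := by
  rw [multiloopWedges, braidedTerm_unorientedWedges G hγ δ fun w hw => node_eq_of_mem_wedges o hw,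
    map_smul, map_smul, projectedState_wedgeProd, multiloopBraiding_add_smul o hn hδ, smul_smul,
    smul_smul]
  congr 1
  ring

theorem mainTheorem7 {N L : Type*} [DecidableEq N] [Fintype L] [DecidableEq L]
    (G : SeedGraph N L) (o : LoopOrientation G)
    (γD δγ : Matrix (Seed L) (Seed L) ℂ)
    (hD : γDᵀ = -γD) (hδ : δγᵀ = -δγ)
    (hD_diag : ∀ i j, G.node i ≠ G.node j → γD i j = 0)
    (hδ_off : ∀ i j, G.node i = G.node j → δγ i j = 0) :
    ∃ r : Multiloop G → ℂ → ℂ,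
      (∀ Φ, (r Φ) =O[𝓝 0] (fun ε : ℂ => ε ^ 3)) ∧
      ∀ ε : ℂ, spinorSqueezing (γD + ε • δγ) ∈ siegelDisk (Mode L) →
        Summable (squeezedTerm (spinorSqueezing (γD + ε • δγ))) ∧
        HasSum
          (fun k : L → ℕ => ∑ Φ ∈ multiloopsWithSpins G k,
            ((∏ ℓ, ((k ℓ).factorial : ℂ))⁻¹ *
              (multiloopWeight o (γD + ε • δγ) Φ
                + (1 / 2) * multiloopBraiding o (γD + ε • δγ) Φ + r Φ ε)) •
              multiloopState o Φ)
          (physicalProjector G (squeezedVacuum (spinorSqueezing (γD + ε • δγ)))) := by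
  choose c hc using fun (k : L → ℕ) (b : ℕ) =>
    exists_projectedState_eq_sum o k (orderTerm γD δγ (∑ ℓ, k ℓ) (b + 3))
  -- The remainder is a polynomial divisible by `ε ^ 3`, collecting all orders from three on. The
  -- coefficients `c` come from the spanning property, and the factorials undo the common
  -- normalization. It depends on `Φ` through its spins and its chosen coefficient only.
  refine ⟨fun Φ ε => ∑ b ∈ Finset.range (∑ ℓ, Φ.twiceSpin ℓ),
    ε ^ (b + 3) * ((∏ ℓ, ((Φ.twiceSpin ℓ).factorial : ℂ)) * c Φ.twiceSpin b Φ), fun Φ => ?_,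
    fun ε hε => ⟨summable_squeezedTerm hε, ?_⟩⟩
  · refine Asymptotics.IsBigO.fun_sum fun b _ => ?_
    set C := (∏ ℓ, ((Φ.twiceSpin ℓ).factorial : ℂ)) * c Φ.twiceSpin b Φ
    have h1 : (fun ε : ℂ => ε ^ b * C) =O[𝓝 0] fun _ => (1 : ℂ) :=
      (((continuous_pow b).mul continuous_const).tendsto (0 : ℂ)).isBigO_one ℂ
    have h2 := (Asymptotics.isBigO_refl (fun ε : ℂ => ε ^ 3) (𝓝 0)).mul h1
    simp only [mul_one] at h2
    refine h2.congr_left fun ε => ?_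
    ring
  -- It remains to identify, spin configuration by spin configuration, the projected component with
  -- the finite sum over multiloops.
  · convert hasSum_projectedState_squeezedPoly G (summable_squeezedTerm hε) using 1
    funext k
    have hk : ∏ ℓ, ((k ℓ).factorial : ℂ) ≠ 0 :=
      Finset.prod_ne_zero_iff.2 fun ℓ _ => by exact_mod_cast Nat.factorial_ne_zero _
    rw [squeezedPoly_spinorSqueezing_add_smul]
    simp only [map_add, map_sum, map_smul]
    rw [seedComponent_orderTerm_zero o hD hD_diag, projectedState_orderTerm_one G hD_diag hδ_off,
      projectedState_orderTerm_two o hD hδ hD_diag hδ_off]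
    simp only [hc]
    rw [smul_comm (ε ^ 2), Finset.smul_sum (r := ε ^ 2), map_smul, map_sum, smul_zero, add_zero,
      ← smul_add, ← Finset.sum_add_distrib]
    simp only [projectedState_prod_pairTerm, projectedState_braidedTerm o hD hD_diag hδ_off,
      Finset.smul_sum]
    rw [Finset.sum_comm, ← Finset.sum_add_distrib]
    refine Finset.sum_congr rfl fun Φ hΦ => ?_
    obtain rfl := mem_multiloopsWithSpins.1 hΦ
    rw [multiloopWeight_add_smul o γD hδ_off, ← add_smul, smul_smul, mul_add, add_smul,
      Finset.mul_sum, Finset.sum_smul]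
    congr 1
    refine Finset.sum_congr rfl fun b _ => ?_
    rw [smul_smul]
    congr 1
    field_simp
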